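/- Let $K\subset\mathbb{C}$ be an imaginary quadratic field of odd discriminant $D_K<-4$, and let $\sqrt{D_K}$ denote the square root with positive imaginary part. Let $k\ge 2$ and $j\ge 0$ be integers, and let $\psi_1,\psi_2$ be primitive Dirichlet characters of conductors $u$ and $t$ with $(\psi_1\psi_2)(-1)=(-1)^k$. If $k=2$, assume that $\psi_1,\psi_2$ are not both trivial. Put $N'=ut$, suppose every prime $\ell\mid N'$ splits in $K$, and let $\mathfrak{N}'=\mathfrak{u}\mathfrak{t}$ be an ideal of $\mathcal{O}_K$ with $\mathcal{O}_K/\mathfrak{N}'\cong\mathbb{Z}/N'$, $\mathcal{O}_K/\mathfrak{u}\cong\mathbb{Z}/u$ and $\mathcal{O}_K/\mathfrak{t}\cong\mathbb{Z}/t$. Let $\chi$ be a Hecke character of $K$ of infinity type $(k+j,-j)$ and of finite type $(\mathfrak{N}',\psi_1\psi_2)$. That is, if $\varepsilon=\psi_1\psi_2$ (as a primitive character) has conductor $N_\varepsilon$ and $\mathfrak{N}_\varepsilon\mid\mathfrak{N}'$ is the ideal of norm $N_\varepsilon$, then $\chi$ has conductor $\mathfrak{N}_\varepsilon$ and $\chi((\alpha))=\varepsilon(\alpha\bmod\mathfrak{N}_\varepsilon)\,\alpha^{k+j}\overline{\alpha}^{-j}$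 for all nonzero $\alpha\in\mathcal{O}_K$. Put $\chi_j(\mathfrak{b})=\chi(\mathfrak{b})\,\mathrm{Nm}(\mathfrak{b})^{j}$. Let $\psi_{1/K}=\psi_1\circ\mathrm{Nm}_{K/\mathbb{Q}}$, and let $L(\psi_{1/K}\chi^{-1},s)$ be the $L$-function, by analytic continuation, of the (primitive) Hecke character $\psi_{1/K}\chi^{-1}$. For $\operatorname{Im}\tau>0$ and $q=e^{2\pi i\tau}$ let $$E_k^{\psi_1,\psi_2}(\tau)=\delta_{\psi_1=1}\frac{L(\psi_2,1-k)}{2}+\sum_{n\ge 1}\Big(\sum_{0<d\mid n}\psi_1(n/d)\psi_2(d)d^{k-1}\Big)q^n ,$$ and let $\partial^j=\partial_{k+2(j-1)}\circ\cdots\circ\partial_k$ with $\partial_m=\frac{1}{2\pi i}\left(\frac{d}{d\tau}+\frac{m}{\tau-\overline{\tau}}\right)$. Let $\mathfrak{a}$ run through a set of representatives of $\mathcal{C}\ell(\mathcal{O}_K)$ consisting of integral ideals that are primitive (divisible by no rational integer other than $\pm1$) and prime to $N'$. Write $\mathfrak{a}\mathfrak{N}'=\mathbb{Z}\frac{b+\sqrt{D_K}}{2}+\mathbb{Z}aN'$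 with $a=\mathrm{Nm}(\mathfrak{a})$ and $b\in\mathbb{Z}$, and put $\tau_{\mathfrak{a}\mathfrak{N}'}=\frac{b+\sqrt{D_K}}{2aN'}$. Then $$\sum_{[\mathfrak{a}]\in\mathcal{C}\ell(\mathcal{O}_K)}(\chi_j)^{-1}(\overline{\mathfrak{a}\mathfrak{N}'})\,\partial^jE_k^{\psi_1,\psi_2}(\tau_{\mathfrak{a}\mathfrak{N}'})=(-1)^k\,\frac{t^k\,\Gamma(k+j)\,\psi_1^{-1}(-\sqrt{D_K}\bmod\mathfrak{u})\,\chi^{-1}(\overline{\mathfrak{t}})}{(2\pi i)^{k+j}\,\mathfrak{g}(\psi_2^{-1})\,\sqrt{D_K}^{\,j}}\,L(\psi_{1/K}\chi^{-1},0),$$ where $\mathfrak{g}(\psi)=\sum_{a\in(\mathbb{Z}/t)^\times}\psi(a)e^{2\pi i a/t}$ is the Gauss sum. -/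

import Mathlib

open NumberField Complex
open scoped NumberField

noncomputable section

/-! ### Hecke characters of an imaginary quadratic field

Algebraic Hecke characters are written in the classical language of characters on ideals
(Größencharaktere).  `K` is an imaginary quadratic field and `σ : K →+* ℂ` is its fixed complex
embedding. -/

/-- `χ`, a completely multiplicative function on the integral ideals of `K` which vanishes exactly
on the ideals that are not prime to `𝔪`, is a Größencharakter modulo `𝔪` of infinity type `(a, b)`:
`χ((α)) = α ^ a * ᾱ ^ b` for every nonzero integer `α ≡ 1` modulo `𝔪`. -/
def IsGroessencharakter {K : Type*} [Field K] [NumberField K] (σ : K →+* ℂ) (a b : ℤ)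
    (𝔪 : Ideal (𝓞 K)) (χ : Ideal (𝓞 K) →*₀ ℂ) : Prop :=
  𝔪 ≠ ⊥ ∧ (∀ 𝔞 : Ideal (𝓞 K), 𝔞 ≠ ⊥ → (χ 𝔞 ≠ 0 ↔ IsCoprime 𝔞 𝔪)) ∧
    ∀ α : 𝓞 K, α ≠ 0 → α - 1 ∈ 𝔪 →
      χ (Ideal.span {α}) = σ α ^ a * (starRingEnd ℂ) (σ α) ^ b

/-- An (algebraic) Hecke character of the imaginary quadratic field `K`, of infinity type `(a, b)`:
a primitive Größencharakter, i.e. one that is not induced from a proper divisor of its modulus.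
This modulus is the conductor, and the value at an ideal which is not prime to it is `0`. -/
structure HeckeCharacter {K : Type*} [Field K] [NumberField K] (σ : K →+* ℂ) (a b : ℤ) where
  /-- The values on integral ideals. -/
  toHom : Ideal (𝓞 K) →*₀ ℂ
  /-- The conductor. -/
  conductor : Ideal (𝓞 K)
  isGroessencharakter : IsGroessencharakter σ a b conductor toHom
  primitive : ∀ (𝔪 : Ideal (𝓞 K)) (χ : Ideal (𝓞 K) →*₀ ℂ), 𝔪 ∣ conductor →
    IsGroessencharakter σ a b 𝔪 χ →
    (∀ 𝔞 : Ideal (𝓞 K), IsCoprime 𝔞 conductor → χ 𝔞 = toHom 𝔞) → 𝔪 = conductor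

/-- Every Größencharakter modulo `𝔪` is induced by a Hecke character. -/
theorem IsGroessencharakter.exists_primitive {K : Type*} [Field K] [NumberField K] {σ : K →+* ℂ}
    {a b : ℤ} {𝔪 : Ideal (𝓞 K)} {χ : Ideal (𝓞 K) →*₀ ℂ} (h : IsGroessencharakter σ a b 𝔪 χ) :
    ∃ ξ : HeckeCharacter σ a b, ξ.conductor ∣ 𝔪 ∧
      ∀ 𝔞 : Ideal (𝓞 K), IsCoprime 𝔞 𝔪 → ξ.toHom 𝔞 = χ 𝔞 := by
  have hmono : ∀ {𝔞 𝔟 𝔠 : Ideal (𝓞 K)}, 𝔟 ∣ 𝔠 → IsCoprime 𝔞 𝔠 → IsCoprime 𝔞 𝔟 :=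
    fun hd hc => IsCoprime.of_isCoprime_of_dvd_right hc hd
  let S : Set (Ideal (𝓞 K)) := {𝔫 | 𝔫 ∣ 𝔪 ∧ ∃ χ' : Ideal (𝓞 K) →*₀ ℂ,
    IsGroessencharakter σ a b 𝔫 χ' ∧ ∀ 𝔞 : Ideal (𝓞 K), IsCoprime 𝔞 𝔪 → χ' 𝔞 = χ 𝔞}
  have hS : S.Nonempty := ⟨𝔪, dvd_rfl, χ, h, fun _ _ => rfl⟩
  obtain ⟨𝔫, ⟨hd, χ', hχ', hag⟩, hmax⟩ :=
    WellFounded.has_min (wellFounded_gt : WellFounded (· > · : Ideal (𝓞 K) → _ → Prop)) S hS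
  refine ⟨⟨χ', 𝔫, hχ', fun 𝔩 χ'' hl hg ha => ?_⟩, hd, hag⟩
  have hmem : 𝔩 ∈ S := ⟨hl.trans hd, χ'', hg, fun 𝔞 h𝔞 => by
    rw [ha 𝔞 (hmono hd h𝔞), hag 𝔞 h𝔞]⟩
  have hle : 𝔫 ≤ 𝔩 := Ideal.dvd_iff_le.mp hl
  by_contra hne
  exact hmax 𝔩 hmem (lt_of_le_of_ne hle (Ne.symm hne))

/-- The Hecke character inducing a given Größencharakter. -/
def IsGroessencharakter.inducing {K : Type*} [Field K] [NumberField K] {σ : K →+* ℂ}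
    {a b : ℤ} {𝔪 : Ideal (𝓞 K)} {χ : Ideal (𝓞 K) →*₀ ℂ} (h : IsGroessencharakter σ a b 𝔪 χ) :
    HeckeCharacter σ a b :=
  h.exists_primitive.choose

theorem IsGroessencharakter.mul {K : Type*} [Field K] [NumberField K] {σ : K →+* ℂ}
    {a b a' b' : ℤ} {𝔪 𝔪' : Ideal (𝓞 K)} {χ χ' : Ideal (𝓞 K) →*₀ ℂ}
    (h : IsGroessencharakter σ a b 𝔪 χ) (h' : IsGroessencharakter σ a' b' 𝔪' χ') :
    IsGroessencharakter σ (a + a') (b + b') (𝔪 * 𝔪') (χ * χ') := by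
  obtain ⟨h0, h1, h2⟩ := h
  obtain ⟨h0', h1', h2'⟩ := h'
  refine ⟨mul_ne_zero h0 h0', fun 𝔞 h𝔞 => ?_, fun α hα hm => ?_⟩
  · change χ 𝔞 * χ' 𝔞 ≠ 0 ↔ _
    rw [mul_ne_zero_iff, h1 𝔞 h𝔞, h1' 𝔞 h𝔞,
      IsCoprime.mul_right_iff]
  · have hα' : σ (α : K) ≠ 0 := by simpa using hα
    have hα'' : (starRingEnd ℂ) (σ (α : K)) ≠ 0 := by simpa using hα
    change χ (Ideal.span {α}) * χ' (Ideal.span {α}) = _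
    have hm1 : α - 1 ∈ 𝔪 := Ideal.dvd_iff_le.mp (dvd_mul_right 𝔪 𝔪') hm
    have hm2 : α - 1 ∈ 𝔪' := Ideal.dvd_iff_le.mp (dvd_mul_left 𝔪' 𝔪) hm
    rw [h2 α hα hm1, h2' α hα hm2, zpow_add₀ hα', zpow_add₀ hα'']
    ring

theorem IsGroessencharakter.inv {K : Type*} [Field K] [NumberField K] {σ : K →+* ℂ}
    {a b : ℤ} {𝔪 : Ideal (𝓞 K)} {χ : Ideal (𝓞 K) →*₀ ℂ} (h : IsGroessencharakter σ a b 𝔪 χ) :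
    IsGroessencharakter σ (-a) (-b) 𝔪 (invMonoidWithZeroHom.comp χ) := by
  obtain ⟨h0, h1, h2⟩ := h
  refine ⟨h0, fun 𝔞 h𝔞 => ?_, fun α hα hm => ?_⟩
  · rw [← h1 𝔞 h𝔞]
    simp [invMonoidWithZeroHom]
  · have : (invMonoidWithZeroHom.comp χ) (Ideal.span {α}) = (χ (Ideal.span {α}))⁻¹ := rfl
    rw [this, h2 α hα hm, zpow_neg, zpow_neg, mul_inv]

/-- The product of two Hecke characters: the Hecke character whose value is the product of the
values at all ideals prime to both conductors. -/
def HeckeCharacter.mul {K : Type*} [Field K] [NumberField K] {σ : K →+* ℂ} {a b a' b' : ℤ}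
    (χ : HeckeCharacter σ a b) (χ' : HeckeCharacter σ a' b') :
    HeckeCharacter σ (a + a') (b + b') :=
  (χ.isGroessencharakter.mul χ'.isGroessencharakter).inducing

/-- The inverse of a Hecke character. -/
def HeckeCharacter.inv {K : Type*} [Field K] [NumberField K] {σ : K →+* ℂ} {a b : ℤ}
    (χ : HeckeCharacter σ a b) : HeckeCharacter σ (-a) (-b) :=
  χ.isGroessencharakter.inv.inducing

/-- The value at `𝔞` of `χ_j = χ · 𝐍_K ^ (-j)`, where `𝐍_K` is the adelic norm character; on ideals
`𝐍_K(𝔞)` is the inverse of the absolute norm of `𝔞`. -/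
def HeckeCharacter.normTwist {K : Type*} [Field K] [NumberField K] {σ : K →+* ℂ} {a b : ℤ}
    (χ : HeckeCharacter σ a b) (j : ℤ) (𝔞 : Ideal (𝓞 K)) : ℂ :=
  χ.toHom 𝔞 * (Ideal.absNorm 𝔞 : ℂ) ^ j

/-- `χ` is of finite type `(𝔑, ε)` for a primitive Dirichlet character `ε` of conductor `M`: with
`𝔑_ε` the divisor of `𝔑` of norm `M`, and `𝓞 K ⧸ 𝔑_ε` identified with `ℤ/M`, the character `χ` has
conductor `𝔑_ε` and `χ((α)) = ε(α mod 𝔑_ε) * α ^ a * ᾱ ^ b` for all nonzero `α`. -/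
def HeckeCharacter.IsOfFiniteType {K : Type*} [Field K] [NumberField K] {σ : K →+* ℂ} {a b : ℤ}
    (χ : HeckeCharacter σ a b) (𝔑 : Ideal (𝓞 K)) {M : ℕ} (ε : DirichletCharacter ℂ M) : Prop :=
  ∃ (𝔑ε : Ideal (𝓞 K)) (e : (𝓞 K ⧸ 𝔑ε) ≃+* ZMod M), 𝔑ε ∣ 𝔑 ∧ χ.conductor = 𝔑ε ∧
    ∀ α : 𝓞 K, α ≠ 0 → χ.toHom (Ideal.span {α}) =
      ε (e (Ideal.Quotient.mk 𝔑ε α)) * σ α ^ a * (starRingEnd ℂ) (σ α) ^ b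

/-! ### Base change of a Dirichlet character -/

/-- The function `𝔞 ↦ ψ(N 𝔞)` on the integral ideals. -/
def dirichletNorm (K : Type*) [Field K] [NumberField K] {u : ℕ} (ψ : DirichletCharacter ℂ u) :
    Ideal (𝓞 K) →*₀ ℂ := by
  classical
  exact
  { toFun := fun 𝔞 => if 𝔞 = ⊥ then 0 else ψ (Ideal.absNorm 𝔞 : ZMod u)
    map_zero' := by simp
    map_one' := by simp
    map_mul' := fun 𝔞 𝔟 => by
      by_cases h : 𝔞 = ⊥
      · simp [h]
      by_cases h' : 𝔟 = ⊥
      · simp [h']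
      have : 𝔞 * 𝔟 ≠ ⊥ := mul_ne_zero h h'
      simp [h, h', this] }

theorem dirichletNorm_apply {K : Type*} [Field K] [NumberField K] {u : ℕ}
    (ψ : DirichletCharacter ℂ u) {𝔞 : Ideal (𝓞 K)} (h : 𝔞 ≠ ⊥) :
    dirichletNorm K ψ 𝔞 = ψ (Ideal.absNorm 𝔞 : ZMod u) := by
  simp [dirichletNorm, h]

theorem isCoprime_span_natCast_iff {K : Type*} [Field K] [NumberField K] {u : ℕ}
    {𝔞 : Ideal (𝓞 K)} (h : 𝔞 ≠ ⊥) :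
    (Ideal.absNorm 𝔞).Coprime u ↔ IsCoprime 𝔞 (Ideal.span {(u : 𝓞 K)}) := by
  constructor
  · intro hc
    rw [Ideal.isCoprime_iff_exists]
    have hz : IsCoprime ((Ideal.absNorm 𝔞 : ℕ) : ℤ) (u : ℤ) := Nat.isCoprime_iff_coprime.mpr hc
    obtain ⟨x, y, hxy⟩ := hz
    refine ⟨(x : 𝓞 K) * (Ideal.absNorm 𝔞 : 𝓞 K), Ideal.mul_mem_left _ _ (Ideal.absNorm_mem 𝔞),
      (y : 𝓞 K) * (u : 𝓞 K), Ideal.mul_mem_left _ _ (Ideal.mem_span_singleton_self _), ?_⟩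
    exact_mod_cast congrArg (Int.cast : ℤ → 𝓞 K) hxy
  · intro hc
    rw [Ideal.isCoprime_iff_exists] at hc
    obtain ⟨x, hx, y, hy, hxy⟩ := hc
    obtain ⟨z, rfl⟩ := Ideal.mem_span_singleton'.mp hy
    have hfin : Finite (𝓞 K ⧸ 𝔞) := Ideal.finiteQuotientOfFreeOfNeBot 𝔞 h
    rw [Nat.Coprime]
    by_contra hg
    obtain ⟨p, hp, hpd⟩ := Nat.exists_prime_and_dvd hg
    have : Fact p.Prime := ⟨hp⟩
    have hcard : p ∣ Nat.card (𝓞 K ⧸ 𝔞) := by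
      rw [← Submodule.cardQuot_apply, ← Ideal.absNorm_apply]
      exact hpd.trans (Nat.gcd_dvd_left _ _)
    obtain ⟨q, hq⟩ := exists_prime_addOrderOf_dvd_card' (G := 𝓞 K ⧸ 𝔞) p hcard
    obtain ⟨w, hw⟩ := hpd.trans (Nat.gcd_dvd_right _ _)
    have hpq : (p : 𝓞 K ⧸ 𝔞) * q = 0 := by
      rw [← nsmul_eq_mul, ← hq, addOrderOf_nsmul_eq_zero]
    have h1 : (Ideal.Quotient.mk 𝔞 z) * (u : 𝓞 K ⧸ 𝔞) = 1 := by
      have := congrArg (Ideal.Quotient.mk 𝔞) hxy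
      rw [map_add, Ideal.Quotient.eq_zero_iff_mem.mpr hx] at this
      simpa using this
    have hq0 : q = 0 := by
      calc q = ((Ideal.Quotient.mk 𝔞 z) * (u : 𝓞 K ⧸ 𝔞)) * q := by rw [h1, one_mul]
        _ = (Ideal.Quotient.mk 𝔞 z) * (w : 𝓞 K ⧸ 𝔞) * ((p : 𝓞 K ⧸ 𝔞) * q) := by
          rw [hw]; push_cast; ring
        _ = 0 := by rw [hpq, mul_zero]
    rw [hq0, addOrderOf_zero] at hq
    exact hp.one_lt.ne hq

theorem norm_pos_of_imaginaryQuadratic {K : Type*} [Field K] [NumberField K]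
    [Algebra.IsQuadraticExtension ℚ K] [IsTotallyComplex K] (σ : K →+* ℂ) {x : K} (hx : x ≠ 0) :
    0 < Algebra.norm ℚ x := by
  classical
  let σ₁ : K →ₐ[ℚ] ℂ := σ.toRatAlgHom
  let σ₂ : K →ₐ[ℚ] ℂ := (ComplexEmbedding.conjugate σ).toRatAlgHom
  have hne : σ₁ ≠ σ₂ := by
    intro h
    refine IsTotallyComplex.complexEmbedding_not_isReal σ ?_
    rw [ComplexEmbedding.isReal_iff]
    ext y
    exact (DFunLike.congr_fun h y).symm
  have huniv : (Finset.univ : Finset (K →ₐ[ℚ] ℂ)) = {σ₁, σ₂} := by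
    symm
    refine Finset.eq_of_subset_of_card_le (Finset.subset_univ _) ?_
    rw [Finset.card_univ, AlgHom.card, Algebra.IsQuadraticExtension.finrank_eq_two,
      Finset.card_pair hne]
  have h := Algebra.norm_eq_prod_embeddings ℚ ℂ x
  rw [huniv, Finset.prod_pair hne] at h
  have h2 : σ₁ x * σ₂ x = ((Complex.normSq (σ x) : ℝ) : ℂ) := Complex.mul_conj (σ x)
  rw [h2] at h
  have h3 : ((Algebra.norm ℚ x : ℚ) : ℝ) = Complex.normSq (σ x) := by
    have : (((Algebra.norm ℚ x : ℚ) : ℝ) : ℂ) = ((Complex.normSq (σ x) : ℝ) : ℂ) := by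
      rw [← h]; simp
    exact_mod_cast this
  have h4 : 0 < Complex.normSq (σ x) := Complex.normSq_pos.mpr (by simpa using hx)
  rw [← h3] at h4
  exact_mod_cast h4

theorem intNorm_cast_eq_one {K : Type*} [Field K] [NumberField K] {u : ℕ} {α : 𝓞 K}
    (h : α - 1 ∈ Ideal.span {(u : 𝓞 K)}) : ((Algebra.norm ℤ α : ℤ) : ZMod u) = 1 := by
  classical
  obtain ⟨γ, hγ⟩ := Ideal.mem_span_singleton'.mp h
  have hα : α = 1 + u • γ := by
    rw [nsmul_eq_mul, mul_comm, hγ]; ring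
  rw [Algebra.norm_eq_matrix_det (RingOfIntegers.basis K), hα, map_add, map_one, map_nsmul]
  rw [← eq_intCast (Int.castRingHom (ZMod u)), RingHom.map_det]
  have : (Int.castRingHom (ZMod u)).mapMatrix
      (1 + u • Algebra.leftMulMatrix (RingOfIntegers.basis K) γ) = 1 := by
    rw [map_add, map_one, map_nsmul]
    ext i j
    simp
  rw [this, Matrix.det_one]

theorem isGroessencharakter_dirichletNorm {K : Type*} [Field K] [NumberField K]
    [Algebra.IsQuadraticExtension ℚ K] [IsTotallyComplex K] (σ : K →+* ℂ) {u : ℕ} [NeZero u]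
    (ψ : DirichletCharacter ℂ u) :
    IsGroessencharakter σ 0 0 (Ideal.span {(u : 𝓞 K)}) (dirichletNorm K ψ) := by
  refine ⟨?_, fun 𝔞 h𝔞 => ?_, fun α hα hm => ?_⟩
  · simpa [Ideal.span_singleton_eq_bot] using NeZero.ne u
  · rw [dirichletNorm_apply ψ h𝔞, ← isCoprime_span_natCast_iff h𝔞]
    have := ψ.apply_ne_zero_iff (Ideal.absNorm 𝔞 : ℤ)
    rw [Nat.isCoprime_iff_coprime] at this
    simpa using this
  · have hne : Ideal.span {α} ≠ ⊥ := by simpa [Ideal.span_singleton_eq_bot] using hα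
    rw [dirichletNorm_apply ψ hne, Ideal.absNorm_span_singleton]
    have hpos : 0 < Algebra.norm ℤ α := by
      have := norm_pos_of_imaginaryQuadratic σ (x := (α : K)) (by simpa using hα)
      rw [← Algebra.coe_norm_int] at this
      exact_mod_cast this
    have h1 : (((Algebra.norm ℤ α).natAbs : ℕ) : ZMod u) = 1 := by
      rw [← intNorm_cast_eq_one hm, ← Int.cast_natCast, Int.natAbs_of_nonneg hpos.le]
    rw [h1]
    simp

/-- The base change `ψ_{/K} = ψ ∘ Nm` to the imaginary quadratic field `K` of a Dirichlet character
`ψ`: the Hecke character whose value at each ideal `𝔞` prime to the modulus of `ψ` is `ψ(N 𝔞)`. -/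
def DirichletCharacter.heckeBaseChange {K : Type*} [Field K] [NumberField K]
    [Algebra.IsQuadraticExtension ℚ K] [IsTotallyComplex K] (σ : K →+* ℂ) {u : ℕ} [NeZero u]
    (ψ : DirichletCharacter ℂ u) : HeckeCharacter σ 0 0 :=
  (isGroessencharakter_dirichletNorm σ ψ).inducing

/-! ### Values of Hecke `L`-functions -/

/-- The Hecke `L`-function `L(ξ, s)` has the value `z` at `s₀`: the Dirichlet series
`∑ ξ(𝔟) N(𝔟) ^ (-s)` over the integral ideals, absolutely convergent on some right half-plane,
continues to a holomorphic function on a half-plane that contains `s₀`, whose value there is `z`.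
By the identity theorem there is at most one such `z`. -/
def HeckeCharacter.HasLValueAt {K : Type*} [Field K] [NumberField K] {σ : K →+* ℂ} {a b : ℤ}
    (ξ : HeckeCharacter σ a b) (s₀ z : ℂ) : Prop :=
  ∃ (L : ℂ → ℂ) (c x₀ : ℝ), c < s₀.re ∧ DifferentiableOn ℂ L {s : ℂ | c < s.re} ∧
    (∀ s : ℂ, x₀ < s.re →
      HasSum (fun 𝔟 : Ideal (𝓞 K) => ξ.toHom 𝔟 * (Ideal.absNorm 𝔟 : ℂ) ^ (-s)) (L s)) ∧
    L s₀ = z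

/-! ### Eisenstein series and the Maass–Shimura operator -/

/-- `σ_{k-1}^{ψ₁,ψ₂}(n) = ∑_{d ∣ n} ψ₁(n/d) ψ₂(d) d^{k-1}`. -/
def twistedSigma {u t : ℕ} (k : ℕ) (ψ₁ : DirichletCharacter ℂ u) (ψ₂ : DirichletCharacter ℂ t)
    (n : ℕ) : ℂ :=
  ∑ d ∈ n.divisors, ψ₁ ((n / d : ℕ) : ZMod u) * ψ₂ (d : ZMod t) * (d : ℂ) ^ (k - 1)

open Classical in
/-- The Eisenstein series `E_k^{ψ₁,ψ₂}`, as a function of `τ` in the upper half-plane. -/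
def twistedEisenstein {u t : ℕ} [NeZero t] (k : ℕ) (ψ₁ : DirichletCharacter ℂ u)
    (ψ₂ : DirichletCharacter ℂ t) (τ : ℂ) : ℂ :=
  (if ψ₁ = 1 then ψ₂.LFunction (1 - (k : ℂ)) / 2 else 0) +
    ∑' n : ℕ+, twistedSigma k ψ₁ ψ₂ n * Complex.exp (2 * Real.pi * I * (n : ℂ) * τ)

/-- The Wirtinger derivative `d/dτ = (d/dx - i d/dy) / 2`. -/
def wirtinger (f : ℂ → ℂ) (τ : ℂ) : ℂ :=
  (fderiv ℝ f τ 1 - I * fderiv ℝ f τ I) / 2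

/-- The Maass–Shimura operator `∂_k = (2πi)⁻¹ (d/dτ + k / (τ - τ̄))` in weight `k`. -/
def maassShimura (k : ℕ) (f : ℂ → ℂ) (τ : ℂ) : ℂ :=
  1 / (2 * Real.pi * I) * (wirtinger f τ + (k : ℂ) / (τ - (starRingEnd ℂ) τ) * f τ)

/-- The iterate `∂_k^j = ∂_{k+2(j-1)} ∘ ⋯ ∘ ∂_{k+2} ∘ ∂_k`. -/
def maassShimuraIter (k : ℕ) : ℕ → (ℂ → ℂ) → ℂ → ℂ
  | 0, f => f
  | j + 1, f => maassShimura (k + 2 * j) (maassShimuraIter k j f)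

/-! ### CM points -/

/-- The complex conjugate of an ideal of the imaginary quadratic field `K`. -/
def conjIdeal {K : Type*} [Field K] [NumberField K] (σ : K →+* ℂ) (𝔞 : Ideal (𝓞 K)) :
    Ideal (𝓞 K) :=
  Ideal.span {x : 𝓞 K | ∃ y ∈ 𝔞, σ x = (starRingEnd ℂ) (σ y)}

/-- An ideal is primitive if no integer other than `±1` divides it. -/
def IsPrimitiveIdeal {K : Type*} [Field K] [NumberField K] (𝔞 : Ideal (𝓞 K)) : Prop :=
  ∀ n : ℤ, Ideal.span {(n : 𝓞 K)} ∣ 𝔞 → IsUnit n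

/-- `τ = (b + √D) / (2A)` is the CM point `τ_𝔞`, where `𝔞 = ℤ (b + √D)/2 + ℤ A` and `A` is the norm
of `𝔞`; here `δ` is the square root `√D` of the discriminant.  (It is unique up to adding an
integer, from the choice of `b` modulo `2A`.) -/
def IsCMPoint {K : Type*} [Field K] [NumberField K] (σ : K →+* ℂ) (δ : 𝓞 K)
    (𝔞 : Ideal (𝓞 K)) (τ : ℂ) : Prop :=
  ∃ (b : ℤ) (β : 𝓞 K), 2 * β = (b : 𝓞 K) + δ ∧
    (∀ x : 𝓞 K, x ∈ 𝔞 ↔ ∃ m n : ℤ, x = m * β + n * (Ideal.absNorm 𝔞 : 𝓞 K)) ∧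
    τ = ((b : ℂ) + σ δ) / (2 * (Ideal.absNorm 𝔞 : ℂ))

end

/-! The `L`-series of `ξ = ψ₁_{/K} χ⁻¹` is cut up by ideal classes, and each piece is a lattice sum
that turns out to be an Eisenstein series at a CM point.

For a class `C` put `I = 𝔞𝔲` and `A = N(I)`. The basis of `𝔞𝔲𝔱` that defines `τ` also gives `I = ℤβ
+ ℤA` with `β = A·tτ`. A nonzero ideal `𝔟` satisfies `I𝔟 = (α)` for exactly one `C`, and `α = mβ +
nA = A(m·tτ + n)` is unique up to sign, because the units are `±1`
(`hasSum_ideals_of_hasSum_lattices`).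

The arithmetic core is the value of `ξ` at `𝔟`. The finite part of `χ` is `ψ₁` at `𝔲` times `ψ₂` at
`𝔱`, while `ψ₁ ∘ N` contributes `ψ₁` at both `𝔲` and `conj(𝔲)`. What remains of `ξ` is `ψ₁` at
`conj(𝔲)` and `ψ₂⁻¹` at `𝔱`, and its conductor is `conj(𝔲)𝔱` (`SplitFiniteType.conductor_eq`). Since
`conj(α) ≡ -m√D` modulo `𝔲`, while `α/A` is `n` at `𝔱` in the appropriate sense, one gets `ξ(𝔟) =
ψ₁(-√D) χ(conj I)⁻¹ ψ₁(m) ψ₂⁻¹(n)` times the infinity type of `α/A`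
(`SplitFiniteType.toHom_of_mul_eq_span`).

So the piece of `L(ξ, s)` on one class is a constant times `A^(-s) ∑ ψ₁(m) ψ₂⁻¹(n) w^(-k-j)
conj(w)^j |w|^(-2s)`, where `w = m·tτ + n`. At `s = 0`, summed over `n` and then over `m`, this is a
multiple of `∂^j E_k^{ψ₁,ψ₂}(τ)`. Two facts give this: the Lipschitz formula twisted by `ψ₂⁻¹`,
which produces the Gauss sum (`hasSum_dirichlet_mul_inv_zpow`), and the closed form of `∂^j (pτ +
q)^(-k)` (`maassShimuraIter_inv_pow`). The constant term is the row `m = 0`, by the functional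
equation of Dirichlet `L`-functions.

The analytic difficulty is weight `2`, where the lattice sum at `s = 0` is not absolutely
convergent. Summing over blocks of `ut × ut` lattice points helps: a nontrivial character makes the
coefficients of a block add up to zero, which gains one power of `|w|`. The block sums then converge
locally uniformly for `Re s > -1/4`, continue the series, and at `0` agree with the iterated sum
(`exists_continuation_twistedSummand`). -/

/-! ### Moving elements and ideals of a Dedekind domain -/

section Dedekind

variable {R : Type*} [CommRing R] [IsDedekindDomain R]

/-- An element prime to `I` is congruent modulo `I` to one which is prime to `J` as well. -/
theorem Ideal.exists_sub_mem_isCoprime_span {I J : Ideal R} (hJ : J ≠ ⊥) {x : R}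
    (hx : IsCoprime (Ideal.span {x}) I) :
    ∃ y : R, y ≠ 0 ∧ y - x ∈ I ∧ IsCoprime (Ideal.span {y}) I ∧
      IsCoprime (Ideal.span {y}) J := by
  classical
  suffices h : ∃ y : R, y - x ∈ I ∧ IsCoprime (Ideal.span {y}) I ∧
      IsCoprime (Ideal.span {y}) J by
    obtain ⟨y, h1, h2, h3⟩ := h
    rcases eq_or_ne y 0 with rfl | hy
    · have hI : I = ⊤ := by simpa [Ideal.isCoprime_iff_sup_eq] using h2
      have hJ : J = ⊤ := by simpa [Ideal.isCoprime_iff_sup_eq] using h3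
      exact ⟨1, one_ne_zero, by simp [hI], by simp [Ideal.isCoprime_iff_sup_eq],
        by simp [Ideal.isCoprime_iff_sup_eq]⟩
    · exact ⟨y, hy, h1, h2, h3⟩
  -- Primes containing `I` are taken care of by coprimality to `I`. At the finitely many other
  -- primes over `J` the element `s * x + i`, with `i + s = 1`, `i ∈ I` and `s` in their product, is
  -- `1`, while modulo `I` it is `x`.
  have hfin : {p : Ideal R | p.IsPrime ∧ J ≤ p ∧ ¬ I ≤ p}.Finite := by
    refine (Ideal.finite_factors hJ).image (fun v => v.asIdeal) |>.subset ?_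
    rintro p ⟨hp, hJp, -⟩
    have hpb : p ≠ ⊥ := fun h => hJ (le_bot_iff.mp (h ▸ hJp))
    exact ⟨⟨p, hp, hpb⟩, Ideal.dvd_iff_le.mpr hJp, rfl⟩
  set S := hfin.toFinset with hS
  have hmax : ∀ p ∈ S, p.IsMaximal := by
    intro p hp
    rw [hS, Set.Finite.mem_toFinset] at hp
    exact hp.1.isMaximal fun h => hJ (le_bot_iff.mp (h ▸ hp.2.1))
  have hcop : IsCoprime I (∏ p ∈ S, p) := by
    refine IsCoprime.prod_right fun p hp => ?_
    have hm := hmax p hp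
    rw [hS, Set.Finite.mem_toFinset] at hp
    rw [isCoprime_comm, Ideal.isCoprime_iff_sup_eq]
    by_contra hne
    have := hm.eq_of_le hne le_sup_left
    exact hp.2.2 (this ▸ le_sup_right)
  obtain ⟨i, hi, s, hs, his⟩ := Ideal.isCoprime_iff_exists.mp hcop
  have hyI : (s * x + i) - x ∈ I := by
    have : (s * x + i) - x = i * (1 - x) := by linear_combination x * his
    rw [this]; exact I.mul_mem_right _ hi
  have hcI : IsCoprime (Ideal.span {s * x + i}) I := by
    obtain ⟨a, ha, b, hb, hab⟩ := Ideal.isCoprime_iff_exists.mp hx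
    obtain ⟨r, rfl⟩ := Ideal.mem_span_singleton'.mp ha
    refine Ideal.isCoprime_iff_exists.mpr ⟨r * (s * x + i),
      Ideal.mem_span_singleton'.mpr ⟨r, rfl⟩, b - r * ((s * x + i) - x),
      I.sub_mem hb (I.mul_mem_left _ hyI), ?_⟩
    linear_combination hab
  refine ⟨s * x + i, hyI, hcI, ?_⟩
  rw [Ideal.isCoprime_iff_sup_eq]
  by_contra hne
  obtain ⟨p, hp, hle⟩ := Ideal.exists_le_maximal _ hne
  have hyp : s * x + i ∈ p := hle (Ideal.mem_sup_left (Ideal.mem_span_singleton_self _))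
  by_cases hIp : I ≤ p
  · refine hp.ne_top (top_le_iff.mp ?_)
    rw [← Ideal.isCoprime_iff_sup_eq.mp hcI]
    exact sup_le ((Ideal.span_singleton_le_iff_mem _).mpr hyp) hIp
  · have hpS : p ∈ S := by
      rw [hS, Set.Finite.mem_toFinset]
      exact ⟨hp.isPrime, le_sup_right.trans hle, hIp⟩
    have hsp : s ∈ p := (Ideal.dvd_iff_le.mp (Finset.dvd_prod_of_mem _ hpS)) hs
    have hip : i ∈ p := by
      have := p.sub_mem hyp (p.mul_mem_right x hsp)
      simpa using this
    exact hp.ne_top ((Ideal.eq_top_iff_one _).mpr (his ▸ p.add_mem hip hsp))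

/-- A nonzero ideal divides some element with a cofactor prime to `J`. -/
theorem Ideal.exists_mul_eq_span_singleton_isCoprime {B J : Ideal R} (hB : B ≠ ⊥) (hJ : J ≠ ⊥) :
    ∃ (x : R) (D : Ideal R), x ≠ 0 ∧ B * D = Ideal.span {x} ∧ IsCoprime D J := by
  rcases eq_or_ne J ⊤ with rfl | hJT
  · obtain ⟨x, hxB, hx⟩ := Submodule.exists_mem_ne_zero_of_ne_bot hB
    obtain ⟨D, hD⟩ : B ∣ Ideal.span {x} :=
      Ideal.dvd_iff_le.mpr ((Ideal.span_singleton_le_iff_mem _).mpr hxB)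
    exact ⟨x, D, hx, hD.symm, by simp [Ideal.isCoprime_iff_sup_eq]⟩
  -- Choose `x` with `BJ + (x) = B`; cancelling `B` leaves `J + D = 1`.
  obtain ⟨x, hx⟩ := IsDedekindDomain.exists_sup_span_eq (I := B * J) (J := B) Ideal.mul_le_left
    (mul_ne_zero hB hJ)
  obtain ⟨D, hD⟩ : B ∣ Ideal.span {x} := Ideal.dvd_iff_le.mpr (hx ▸ le_sup_right)
  have hDJ : IsCoprime D J := by
    rw [hD, ← Ideal.mul_sup] at hx
    rw [isCoprime_comm, Ideal.isCoprime_iff_sup_eq, ← Ideal.one_eq_top]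
    exact mul_left_cancel₀ hB (hx.trans (mul_one B).symm)
  refine ⟨x, D, ?_, hD.symm, hDJ⟩
  rintro rfl
  have hD0 : D = ⊥ := (mul_eq_zero.mp (hD.symm.trans (by simp))).resolve_left hB
  rw [hD0, Ideal.isCoprime_iff_sup_eq, bot_sup_eq] at hDJ
  exact hJT hDJ

/-- A nonzero ideal prime to `I` divides some element which is `1` modulo `I`, with a cofactor
prime to `I` and `J`. -/
theorem Ideal.exists_mul_eq_span_singleton_sub_one_mem {B I J : Ideal R} (hB : B ≠ ⊥)
    (hI : I ≠ ⊥) (hJ : J ≠ ⊥) (hBI : IsCoprime B I) :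
    ∃ (x : R) (D : Ideal R), x ≠ 0 ∧ B * D = Ideal.span {x} ∧ x - 1 ∈ I ∧ IsCoprime D I ∧
      IsCoprime D J := by
  obtain ⟨x, D, hx0, hxD, hD⟩ := Ideal.exists_mul_eq_span_singleton_isCoprime hB (mul_ne_zero hI hJ)
  have hDI : IsCoprime D I := (IsCoprime.mul_right_iff.mp hD).1
  have hDJ : IsCoprime D J := (IsCoprime.mul_right_iff.mp hD).2
  have hxI : IsCoprime (Ideal.span {x}) I := hxD ▸ IsCoprime.mul_left hBI hDI
  obtain ⟨a, ha, b, hb, hab⟩ := Ideal.isCoprime_iff_exists.mp hxI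
  obtain ⟨y, rfl⟩ := Ideal.mem_span_singleton'.mp ha
  have hyI : IsCoprime (Ideal.span {y}) I := Ideal.isCoprime_iff_exists.mpr
    ⟨y * x, Ideal.mem_span_singleton'.mpr ⟨x, mul_comm _ _⟩, b, hb, hab⟩
  -- `y` inverts `x` modulo `I`. Moving it to `z` prime to `J` makes `z * x ≡ 1` while the cofactor
  -- only acquires the harmless factor `(z)`.
  obtain ⟨z, hz0, hz, hzI, hzJ⟩ := Ideal.exists_sub_mem_isCoprime_span hJ hyI
  refine ⟨z * x, D * Ideal.span {z}, mul_ne_zero hz0 hx0, ?_, ?_, IsCoprime.mul_left hDI hzI, IsCoprime.mul_left hDJ hzJ⟩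
  · rw [← mul_assoc, hxD, Ideal.span_singleton_mul_span_singleton, mul_comm]
  · have : z * x - 1 = (z - y) * x - b := by linear_combination hab
    rw [this]
    exact I.sub_mem (I.mul_mem_right _ hz) hb

end Dedekind

/-! ### Reducing the modulus of a Größencharakter -/

section InfinityType

variable {K : Type*} [Field K]

/-- The value `σ α ^ a * conj (σ α) ^ b` of the infinity type. -/
noncomputable def infinityType (σ : K →+* ℂ) (a b : ℤ) (α : 𝓞 K) : ℂ :=
  σ α ^ a * (starRingEnd ℂ) (σ α) ^ b

theorem infinityType_mul (σ : K →+* ℂ) (a b : ℤ) (α β : 𝓞 K) :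
    infinityType σ a b (α * β) = infinityType σ a b α * infinityType σ a b β := by
  simp only [infinityType, map_mul, mul_zpow]
  ring

theorem infinityType_ne_zero (σ : K →+* ℂ) (a b : ℤ) {α : 𝓞 K} (hα : α ≠ 0) :
    infinityType σ a b α ≠ 0 := by
  have h : σ (α : K) ≠ 0 := by simpa using hα
  exact mul_ne_zero (zpow_ne_zero _ h) (zpow_ne_zero _ (by simpa using h))

theorem infinityType_one (σ : K →+* ℂ) (a b : ℤ) : infinityType σ a b (1 : 𝓞 K) = 1 := by
  simp [infinityType]

theorem infinityType_neg_neg (σ : K →+* ℂ) (a b : ℤ) (α : 𝓞 K) :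
    infinityType σ (-a) (-b) α = (infinityType σ a b α)⁻¹ := by
  simp [infinityType, zpow_neg, mul_comm]

end InfinityType

section Modulus

variable {K : Type*} [Field K] [NumberField K] {σ : K →+* ℂ} {a b : ℤ}

/-- A Größencharakter modulo `𝔠` whose values at the principal ideals `(α)`, `α ≡ 1` modulo a
divisor `𝔪` of `𝔠`, are given by its infinity type is induced from `𝔪`. -/
theorem IsGroessencharakter.exists_of_dvd {𝔠 𝔪 𝔫 : Ideal (𝓞 K)} {ξ : Ideal (𝓞 K) →*₀ ℂ}
    (h : IsGroessencharakter σ a b 𝔠 ξ) (hmc : 𝔪 ∣ 𝔠) (h𝔫 : 𝔫 ≠ ⊥)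
    (hcn : ∀ 𝔟 : Ideal (𝓞 K), IsCoprime 𝔟 𝔫 → IsCoprime 𝔟 𝔠)
    (hval : ∀ α : 𝓞 K, α ≠ 0 → IsCoprime (Ideal.span {α}) 𝔫 → α - 1 ∈ 𝔪 →
      ξ (Ideal.span {α}) = infinityType σ a b α) :
    ∃ ξ' : Ideal (𝓞 K) →*₀ ℂ, IsGroessencharakter σ a b 𝔪 ξ' ∧
      ∀ 𝔟 : Ideal (𝓞 K), IsCoprime 𝔟 𝔠 → ξ' 𝔟 = ξ 𝔟 := by
  classical
  obtain ⟨hc0, hc1, hc2⟩ := h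
  have hm0 : 𝔪 ≠ ⊥ := fun h0 => hc0 (by rw [h0] at hmc; exact zero_dvd_iff.mp hmc)
  have hne : ∀ {B D : Ideal (𝓞 K)} {x : 𝓞 K}, x ≠ 0 → B * D = Ideal.span {x} → D ≠ ⊥ := by
    rintro B D x hx hBD rfl
    apply hx
    rw [Ideal.mul_bot] at hBD
    exact Ideal.span_singleton_eq_bot.mp hBD.symm
  have hspan : ∀ {x : 𝓞 K}, x ≠ 0 → Ideal.span {x} ≠ (⊥ : Ideal (𝓞 K)) := fun hx h =>
    hx (Ideal.span_singleton_eq_bot.mp h)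
  have hξ0 : ∀ {D : Ideal (𝓞 K)}, D ≠ ⊥ → IsCoprime D 𝔫 → ξ D ≠ 0 := fun hD hDn =>
    (hc1 _ hD).mpr (hcn _ hDn)
  -- independence of the choice of the cofactor
  have key : ∀ (B D₁ D₂ : Ideal (𝓞 K)) (x y : 𝓞 K), B ≠ ⊥ → x ≠ 0 → y ≠ 0 →
      B * D₁ = Ideal.span {x} → B * D₂ = Ideal.span {y} → x - 1 ∈ 𝔪 → y - 1 ∈ 𝔪 →
      IsCoprime D₁ 𝔫 → IsCoprime D₂ 𝔫 →
      infinityType σ a b x * ξ D₂ = infinityType σ a b y * ξ D₁ := by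
    intro B D₁ D₂ x y hB hx hy hBx hBy hxm hym hD₁ hD₂
    have hD₁0 := hne hx hBx
    have hD₂0 := hne hy hBy
    have hD₁m : IsCoprime D₁ 𝔪 := IsCoprime.of_isCoprime_of_dvd_right (hcn _ hD₁) hmc
    -- A common `E` makes both `D₁E = (z)` and `D₂E = (w)` principal with generators `≡ 1` modulo
    -- `𝔪` and `xw = yz`, so `hval` compares `ξ D₁` with `ξ D₂`.
    obtain ⟨z, E, hz0, hDE, hzm, -, hEn⟩ :=
      Ideal.exists_mul_eq_span_singleton_sub_one_mem hD₁0 hm0 h𝔫 hD₁m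
    have hE0 := hne hz0 hDE
    have hmul : Ideal.span {x} * (D₂ * E) = Ideal.span {y * z} := by
      rw [← Ideal.span_singleton_mul_span_singleton, ← hBx, ← hBy, ← hDE]; ring
    obtain ⟨w, hw⟩ : x ∣ y * z := by
      exact Ideal.span_singleton_le_span_singleton.mp (hmul ▸ Ideal.mul_le_left)
    have hw0 : w ≠ 0 := by
      rintro rfl
      exact mul_ne_zero hy hz0 (by rw [hw, mul_zero])
    have hDEw : D₂ * E = Ideal.span {w} := by
      refine mul_left_cancel₀ (hspan hx) ?_
      rw [hmul, hw, Ideal.span_singleton_mul_span_singleton]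
    have hwm : w - 1 ∈ 𝔪 := by
      have : w - 1 = (y - 1) * z + (z - 1) - (x - 1) * w := by linear_combination -hw
      rw [this]
      exact 𝔪.sub_mem (𝔪.add_mem (𝔪.mul_mem_right _ hym) hzm) (𝔪.mul_mem_right _ hxm)
    have h1 := hval z hz0 (hDE ▸ IsCoprime.mul_left hD₁ hEn) hzm
    have h2 := hval w hw0 (hDEw ▸ IsCoprime.mul_left hD₂ hEn) hwm
    rw [← hDE, map_mul] at h1
    rw [← hDEw, map_mul] at h2
    have h3 : infinityType σ a b y * infinityType σ a b z =
        infinityType σ a b x * infinityType σ a b w := by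
      rw [← infinityType_mul, ← infinityType_mul, hw]
    refine mul_right_cancel₀ (hξ0 hE0 hEn) ?_
    rw [mul_assoc, mul_assoc, h1, h2, h3]
  have hex : ∀ B : Ideal (𝓞 K), ∃ p : 𝓞 K × Ideal (𝓞 K), B ≠ ⊥ → IsCoprime B 𝔪 →
      p.1 ≠ 0 ∧ B * p.2 = Ideal.span {p.1} ∧ p.1 - 1 ∈ 𝔪 ∧ IsCoprime p.2 𝔫 := by
    intro B
    by_cases hB : B ≠ ⊥ ∧ IsCoprime B 𝔪
    · obtain ⟨x, D, h1, h2, h3, -, h5⟩ :=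
        Ideal.exists_mul_eq_span_singleton_sub_one_mem hB.1 hm0 h𝔫 hB.2
      exact ⟨(x, D), fun _ _ => ⟨h1, h2, h3, h5⟩⟩
    · exact ⟨(0, ⊥), fun h1 h2 => (hB ⟨h1, h2⟩).elim⟩
  choose p hp using hex
  have hval' : ∀ (B D : Ideal (𝓞 K)) (x : 𝓞 K), B ≠ ⊥ → x ≠ 0 → B * D = Ideal.span {x} →
      x - 1 ∈ 𝔪 → IsCoprime D 𝔫 → IsCoprime B 𝔪 →
      infinityType σ a b (p B).1 * (ξ (p B).2)⁻¹ = infinityType σ a b x * (ξ D)⁻¹ := by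
    intro B D x hB hx hBD hxm hD hBm
    obtain ⟨h1, h2, h3, h4⟩ := hp B hB hBm
    have := key B D (p B).2 x (p B).1 hB hx h1 hBD h2 hxm h3 hD h4
    rw [← div_eq_mul_inv, ← div_eq_mul_inv, div_eq_div_iff (hξ0 (hne h1 h2) h4)
      (hξ0 (hne hx hBD) hD), this]
  have hcop1 : ∀ I : Ideal (𝓞 K), IsCoprime (1 : Ideal (𝓞 K)) I := fun I => isCoprime_one_left
  -- The value is forced: if `BD = (x)` with `x ≡ 1` modulo `𝔪`, then `ξ' B * ξ D` must be the
  -- infinity type of `x`.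
  let ξ' : Ideal (𝓞 K) →*₀ ℂ :=
    { toFun := fun B => if B ≠ ⊥ ∧ IsCoprime B 𝔪 then
        infinityType σ a b (p B).1 * (ξ (p B).2)⁻¹ else 0
      map_zero' := by simp
      map_one' := by
        rw [if_pos ⟨one_ne_zero, hcop1 𝔪⟩, hval' 1 1 1 one_ne_zero one_ne_zero (by simp) (by simp)
          (hcop1 𝔫) (hcop1 𝔪), infinityType_one, map_one, inv_one, mul_one]
      map_mul' := fun B B' => by
        by_cases hB : B ≠ ⊥ ∧ IsCoprime B 𝔪
        swap
        · have : ¬ (B * B' ≠ ⊥ ∧ IsCoprime (B * B') 𝔪) := fun h =>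
            hB ⟨left_ne_zero_of_mul h.1, (IsCoprime.mul_left_iff.mp h.2).1⟩
          rw [if_neg hB, if_neg this, zero_mul]
        by_cases hB' : B' ≠ ⊥ ∧ IsCoprime B' 𝔪
        swap
        · have : ¬ (B * B' ≠ ⊥ ∧ IsCoprime (B * B') 𝔪) := fun h =>
            hB' ⟨right_ne_zero_of_mul h.1, (IsCoprime.mul_left_iff.mp h.2).2⟩
          rw [if_neg hB', if_neg this, mul_zero]
        have hBB : B * B' ≠ ⊥ ∧ IsCoprime (B * B') 𝔪 :=
          ⟨mul_ne_zero hB.1 hB'.1, IsCoprime.mul_left hB.2 hB'.2⟩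
        obtain ⟨h1, h2, h3, h4⟩ := hp B hB.1 hB.2
        obtain ⟨h1', h2', h3', h4'⟩ := hp B' hB'.1 hB'.2
        rw [if_pos hB, if_pos hB', if_pos hBB,
          hval' (B * B') ((p B).2 * (p B').2) ((p B).1 * (p B').1) hBB.1 (mul_ne_zero h1 h1')
            (by rw [← Ideal.span_singleton_mul_span_singleton, ← h2, ← h2']; ring)
            (by
              have : (p B).1 * (p B').1 - 1 = ((p B).1 - 1) * (p B').1 + ((p B').1 - 1) := by ring
              rw [this]; exact 𝔪.add_mem (𝔪.mul_mem_right _ h3) h3')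
            (IsCoprime.mul_left h4 h4') hBB.2, infinityType_mul, map_mul, mul_inv]
        ring }
  have hξ' : ∀ B, B ≠ ⊥ → IsCoprime B 𝔪 →
      ξ' B = infinityType σ a b (p B).1 * (ξ (p B).2)⁻¹ := fun B h1 h2 => if_pos ⟨h1, h2⟩
  refine ⟨ξ', ⟨hm0, fun B hB => ?_, fun α hα hm => ?_⟩, fun B hBc => ?_⟩
  · by_cases hBm : IsCoprime B 𝔪
    · obtain ⟨h1, h2, h3, h4⟩ := hp B hB hBm
      rw [hξ' B hB hBm]
      exact ⟨fun _ => hBm, fun _ =>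
        mul_ne_zero (infinityType_ne_zero σ a b h1) (inv_ne_zero (hξ0 (hne h1 h2) h4))⟩
    · have : ξ' B = 0 := if_neg fun h => hBm h.2
      simp [this, hBm]
  · have hαm : IsCoprime (Ideal.span {α}) 𝔪 := Ideal.isCoprime_iff_exists.mpr
      ⟨α, Ideal.mem_span_singleton_self _, 1 - α, by simpa using 𝔪.neg_mem hm, by ring⟩
    rw [hξ' _ (hspan hα) hαm, hval' _ 1 α (hspan hα) hα (mul_one _) hm (hcop1 𝔫) hαm, map_one,
      inv_one, mul_one, infinityType]
  · have hBm : IsCoprime B 𝔪 := IsCoprime.of_isCoprime_of_dvd_right hBc hmc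
    by_cases hB : B = ⊥
    · rw [hB]; exact (map_zero ξ').trans (map_zero ξ).symm
    obtain ⟨x, D, h1, h2, h3, -, h5⟩ :=
      Ideal.exists_mul_eq_span_singleton_sub_one_mem hB hc0 h𝔫 hBc
    have hxm : x - 1 ∈ 𝔪 := Ideal.dvd_iff_le.mp hmc h3
    rw [hξ' B hB hBm, hval' B D x hB h1 h2 hxm h5 hBm]
    have h6 := hc2 x h1 h3
    rw [← h2, map_mul] at h6
    rw [← div_eq_mul_inv, div_eq_iff (hξ0 (hne h1 h2) h5), h6, infinityType]

end Modulus

/-- The ideal `(l)` is the intersection of two distinct maximal ideals, hence radical. -/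
theorem exists_mul_eq_of_sq_mem_span {R : Type*} [CommRing R] [IsDedekindDomain R] {v w : Ideal R}
    {l x : R} (hl : l ≠ 0) (hv : v.IsPrime) (hw : w.IsPrime) (hvw : v ≠ w)
    (hspl : Ideal.span {l} = v * w) (hx : x ^ 2 ∈ Ideal.span {l}) : ∃ y, y * l = x := by
  have hvw0 : v * w ≠ 0 := by
    rw [← hspl]
    exact fun h => hl (Ideal.span_singleton_eq_bot.mp h)
  rw [hspl] at hx
  have hxv : x ∈ v := hv.mem_of_pow_mem 2 (Ideal.mul_le_left hx)
  have hxw : x ∈ w := hw.mem_of_pow_mem 2 (Ideal.mul_le_right hx)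
  have hvm := hv.isMaximal (left_ne_zero_of_mul hvw0)
  have hwm := hw.isMaximal (right_ne_zero_of_mul hvw0)
  have hcop : IsCoprime v w := Ideal.isCoprime_iff_sup_eq.mpr (hvm.coprime_of_ne hwm hvw)
  have hxl : x ∈ Ideal.span {l} := by
    rw [hspl, Ideal.mul_eq_inf_of_isCoprime hcop]
    exact Submodule.mem_inf.mpr ⟨hxv, hxw⟩
  exact Ideal.mem_span_singleton'.mp hxl

/-! ### Complex conjugation on the ring of integers -/

section Conj

variable {K : Type*} [Field K] [NumberField K]

/-- The restriction of a complex embedding to the ring of integers. -/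
noncomputable def embeddingIntegers (σ : K →+* ℂ) : 𝓞 K →+* ℂ := σ.comp (algebraMap (𝓞 K) K)

omit [NumberField K] in
theorem embeddingIntegers_apply (σ : K →+* ℂ) (x : 𝓞 K) : embeddingIntegers σ x = σ x := rfl

/-- A quadratic extension is Galois, so the conjugate of `σ` is `σ` composed with an automorphism of
`K`. -/
theorem exists_ringEquiv_conj [Algebra.IsQuadraticExtension ℚ K] (σ : K →+* ℂ) :
    ∃ c : 𝓞 K ≃+* 𝓞 K, ∀ x : 𝓞 K, σ (c x) = (starRingEnd ℂ) (σ x) := by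
  obtain ⟨g, hg⟩ := ComplexEmbedding.exists_comp_symm_eq_of_comp_eq (k := ℚ) σ
    (ComplexEmbedding.conjugate σ) (Subsingleton.elim _ _)
  refine ⟨RingOfIntegers.mapRingEquiv g.symm, fun x => ?_⟩
  have := DFunLike.congr_fun hg (x : K)
  simpa using this

/-- The complex conjugation of the ring of integers of an imaginary quadratic field. -/
noncomputable def integersConj [Algebra.IsQuadraticExtension ℚ K] (σ : K →+* ℂ) : 𝓞 K ≃+* 𝓞 K :=
  (exists_ringEquiv_conj σ).choose

variable [Algebra.IsQuadraticExtension ℚ K] (σ : K →+* ℂ)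

theorem embedding_integersConj (x : 𝓞 K) :
    σ (integersConj σ x) = (starRingEnd ℂ) (σ x) :=
  (exists_ringEquiv_conj σ).choose_spec x

omit [NumberField K] [Algebra.IsQuadraticExtension ℚ K] in
theorem embedding_integers_injective {x y : 𝓞 K} (h : σ x = σ y) : x = y :=
  RingOfIntegers.ext (σ.injective h)

@[simp]
theorem integersConj_integersConj (x : 𝓞 K) : integersConj σ (integersConj σ x) = x :=
  embedding_integers_injective σ (by simp [embedding_integersConj])

theorem conjIdeal_eq_map (I : Ideal (𝓞 K)) : conjIdeal σ I = I.map (integersConj σ) := by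
  rw [conjIdeal, Ideal.map]
  congr 1
  ext x
  simp only [Set.mem_ofPred_eq, Set.mem_image, SetLike.mem_coe]
  refine exists_congr fun y => and_congr_right fun _ => ?_
  rw [← embedding_integersConj]
  exact ⟨fun h => (embedding_integers_injective σ h).symm, fun h => by rw [← h]⟩

theorem mem_conjIdeal {I : Ideal (𝓞 K)} {x : 𝓞 K} : x ∈ conjIdeal σ I ↔ integersConj σ x ∈ I := by
  rw [conjIdeal_eq_map]
  constructor
  · intro h
    obtain ⟨y, hy, rfl⟩ := (Ideal.mem_map_iff_of_surjective _ (integersConj σ).surjective).mp h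
    simpa using hy
  · intro h
    have := Ideal.mem_map_of_mem (integersConj σ) h
    simpa using this

theorem conjIdeal_conjIdeal (I : Ideal (𝓞 K)) : conjIdeal σ (conjIdeal σ I) = I := by
  ext x; simp [mem_conjIdeal]

theorem conjIdeal_mul (I J : Ideal (𝓞 K)) :
    conjIdeal σ (I * J) = conjIdeal σ I * conjIdeal σ J := by
  simp only [conjIdeal_eq_map, Ideal.map_mul]

theorem conjIdeal_span (x : 𝓞 K) :
    conjIdeal σ (Ideal.span {x}) = Ideal.span {integersConj σ x} := by
  simp [conjIdeal_eq_map, Ideal.map_span]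

theorem conjIdeal_ne_bot {I : Ideal (𝓞 K)} (hI : I ≠ ⊥) : conjIdeal σ I ≠ ⊥ := by
  intro h
  apply hI
  rw [← conjIdeal_conjIdeal σ I, h]
  simp [conjIdeal_eq_map]

theorem isCoprime_conjIdeal {I J : Ideal (𝓞 K)} (h : IsCoprime I J) :
    IsCoprime (conjIdeal σ I) (conjIdeal σ J) := by
  rw [Ideal.isCoprime_iff_exists] at h ⊢
  obtain ⟨i, hi, j, hj, hij⟩ := h
  exact ⟨integersConj σ i, by simpa [mem_conjIdeal] using hi, integersConj σ j,
    by simpa [mem_conjIdeal] using hj, by rw [← map_add, hij, map_one]⟩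

theorem absNorm_conjIdeal (I : Ideal (𝓞 K)) :
    Ideal.absNorm (conjIdeal σ I) = Ideal.absNorm I := by
  rw [Ideal.absNorm_apply, Ideal.absNorm_apply, Submodule.cardQuot_apply, Submodule.cardQuot_apply]
  exact (Nat.card_congr (Ideal.quotientEquiv I (conjIdeal σ I) (integersConj σ)
    (conjIdeal_eq_map σ I)).toEquiv).symm

theorem coe_intNorm_eq [IsTotallyComplex K] (x : 𝓞 K) :
    ((Algebra.norm ℤ x : ℤ) : ℂ) = σ x * (starRingEnd ℂ) (σ x) := by
  classical
  let σ₁ : K →ₐ[ℚ] ℂ := σ.toRatAlgHom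
  let σ₂ : K →ₐ[ℚ] ℂ := (ComplexEmbedding.conjugate σ).toRatAlgHom
  have hne : σ₁ ≠ σ₂ := by
    intro h
    refine IsTotallyComplex.complexEmbedding_not_isReal σ ?_
    rw [ComplexEmbedding.isReal_iff]
    ext y
    exact (DFunLike.congr_fun h y).symm
  have huniv : (Finset.univ : Finset (K →ₐ[ℚ] ℂ)) = {σ₁, σ₂} := by
    symm
    refine Finset.eq_of_subset_of_card_le (Finset.subset_univ _) ?_
    rw [Finset.card_univ, AlgHom.card, Algebra.IsQuadraticExtension.finrank_eq_two,
      Finset.card_pair hne]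
  have h := Algebra.norm_eq_prod_embeddings ℚ ℂ (x : K)
  rw [huniv, Finset.prod_pair hne, ← Algebra.coe_norm_int] at h
  have h' : ((Algebra.norm ℤ x : ℤ) : ℂ) = σ₁ x * σ₂ x := by simpa using h
  exact h'

theorem coe_absNorm_span_singleton [IsTotallyComplex K] (x : 𝓞 K) :
    (Ideal.absNorm (Ideal.span {x}) : 𝓞 K) = x * integersConj σ x := by
  refine embedding_integers_injective σ ?_
  have h := coe_intNorm_eq σ x
  have hpos : 0 ≤ Algebra.norm ℤ x := by
    have : (0 : ℝ) ≤ (Algebra.norm ℤ x : ℤ) := by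
      have h2 : (((Algebra.norm ℤ x : ℤ) : ℝ) : ℂ) = ((normSq (σ x) : ℝ) : ℂ) := by
        rw [← Complex.mul_conj, ← h]; simp
      rw [Complex.ofReal_inj.mp h2]
      exact normSq_nonneg _
    exact_mod_cast this
  have h3 : (((Algebra.norm ℤ x).natAbs : ℕ) : ℂ) = ((Algebra.norm ℤ x : ℤ) : ℂ) := by
    rw [← Int.cast_natCast, Int.natAbs_of_nonneg hpos]
  rw [Ideal.absNorm_span_singleton]
  change embeddingIntegers σ _ = embeddingIntegers σ _
  rw [map_mul, map_natCast, h3, h, embeddingIntegers_apply, embeddingIntegers_apply,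
    embedding_integersConj]

end Conj

/-! ### Ideals with cyclic quotient -/

section Cyclic

variable {K : Type*} [Field K] [NumberField K]

/-- The class of `1` generates the additive group of the quotient, so its order is the norm of `I`.
-/
theorem intCast_mem_iff_of_cyclic {I : Ideal (𝓞 K)} (h : ∀ x : 𝓞 K, ∃ n : ℤ, x - n ∈ I)
    (n : ℤ) : (n : 𝓞 K) ∈ I ↔ (Ideal.absNorm I : ℤ) ∣ n := by
  have hcard : addOrderOf (1 : 𝓞 K ⧸ I) = Ideal.absNorm I := by
    rw [Ideal.absNorm_apply, Submodule.cardQuot_apply]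
    refine addOrderOf_eq_card_of_forall_mem_zmultiples fun x => ?_
    obtain ⟨y, rfl⟩ := Ideal.Quotient.mk_surjective x
    obtain ⟨n, hn⟩ := h y
    refine AddSubgroup.mem_zmultiples_iff.mpr ⟨n, ?_⟩
    rw [(Ideal.Quotient.mk_eq_mk_iff_sub_mem _ _).mpr hn]
    simp
  rw [← hcard, addOrderOf_dvd_iff_zsmul_eq_zero, ← Ideal.Quotient.eq_zero_iff_mem]
  simp

omit [NumberField K] in
theorem cyclic_of_ringEquiv {I : Ideal (𝓞 K)} {n : ℕ} (e : (𝓞 K ⧸ I) ≃+* ZMod n) (x : 𝓞 K) :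
    ∃ m : ℤ, x - m ∈ I := by
  obtain ⟨m, hm⟩ := ZMod.intCast_surjective (e (Ideal.Quotient.mk I x))
  refine ⟨m, (Ideal.Quotient.mk_eq_mk_iff_sub_mem _ _).mp (e.injective ?_)⟩
  rw [← hm]; simp

theorem absNorm_of_ringEquiv {I : Ideal (𝓞 K)} {n : ℕ} (e : (𝓞 K ⧸ I) ≃+* ZMod n) :
    Ideal.absNorm I = n := by
  rw [Ideal.absNorm_apply, Submodule.cardQuot_apply, Nat.card_congr e.toEquiv, Nat.card_zmod]

omit [NumberField K] in
theorem ringEquiv_mk_eq_of_sub_mem {I : Ideal (𝓞 K)} {n : ℕ} (e : (𝓞 K ⧸ I) ≃+* ZMod n)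
    {x y : 𝓞 K} (h : x - y ∈ I) :
    e (Ideal.Quotient.mk I x) = e (Ideal.Quotient.mk I y) := by
  rw [(Ideal.Quotient.mk_eq_mk_iff_sub_mem _ _).mpr h]

omit [NumberField K] in
theorem isUnit_ringEquiv_mk_iff {I : Ideal (𝓞 K)} {n : ℕ} (e : (𝓞 K ⧸ I) ≃+* ZMod n) (x : 𝓞 K) :
    IsUnit (e (Ideal.Quotient.mk I x)) ↔ IsCoprime (Ideal.span {x}) I := by
  rw [MulEquiv.isUnit_map, isUnit_iff_exists_inv, Ideal.isCoprime_iff_exists]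
  constructor
  · rintro ⟨y, hy⟩
    obtain ⟨y, rfl⟩ := Ideal.Quotient.mk_surjective y
    rw [← map_mul, ← map_one (Ideal.Quotient.mk I), Ideal.Quotient.mk_eq_mk_iff_sub_mem] at hy
    exact ⟨y * x, Ideal.mem_span_singleton'.mpr ⟨y, rfl⟩, 1 - x * y,
      by simpa using I.neg_mem hy, by ring⟩
  · rintro ⟨a, ha, b, hb, hab⟩
    obtain ⟨y, rfl⟩ := Ideal.mem_span_singleton'.mp ha
    refine ⟨Ideal.Quotient.mk I y, ?_⟩
    rw [← map_mul, ← map_one (Ideal.Quotient.mk I), Ideal.Quotient.mk_eq_mk_iff_sub_mem]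
    have : x * y - 1 = -b := by linear_combination hab
    rw [this]; exact I.neg_mem hb

end Cyclic

/-! ### The lattice of a CM point -/

section Lattice

variable {K : Type*} [Field K] [NumberField K] {σ : K →+* ℂ} {δ β : 𝓞 K} {b : ℤ}

omit [NumberField K] in
theorem im_embedding_of_two_mul_eq (hβ : 2 * β = (b : 𝓞 K) + δ) : 2 * (σ β).im = (σ δ).im := by
  have h := congrArg (fun x : 𝓞 K => (embeddingIntegers σ x).im) hβ
  simp only [map_add, map_mul, map_ofNat, map_intCast, embeddingIntegers_apply] at h
  simpa [Complex.mul_im] using h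

/-- `ℤ β + ℤ` is free. -/
theorem intCast_add_mul_injective (hδim : 0 < (σ δ).im) (hβ : 2 * β = (b : 𝓞 K) + δ)
    {m n m' n' : ℤ} (h : (m * β + n : 𝓞 K) = m' * β + n') : m = m' ∧ n = n' := by
  have him := im_embedding_of_two_mul_eq (σ := σ) hβ
  have h1 := congrArg (fun x : 𝓞 K => (σ x).im) h
  simp only [map_add, map_mul, map_intCast, Complex.add_im, Complex.mul_im, Complex.intCast_im,
    Complex.intCast_re, zero_mul, add_zero] at h1
  have h2 : (m : ℝ) = m' := mul_right_cancel₀ (b := (σ β).im) (by linarith) (by simpa using h1)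
  have h3 : m = m' := by exact_mod_cast h2
  subst h3
  exact ⟨rfl, by exact_mod_cast (add_left_cancel h : (n : 𝓞 K) = n')⟩

/-- By freeness of `ℤβ + ℤ`, the rational integers in `J` are the multiples of `N(J)`. Hence `1` has
order `N(J)` in the quotient, which is all of it. -/
theorem cyclic_of_isCMPoint (hδim : 0 < (σ δ).im) (hβ : 2 * β = (b : 𝓞 K) + δ)
    {J : Ideal (𝓞 K)} (hJ : J ≠ ⊥)
    (hmem : ∀ x : 𝓞 K, x ∈ J ↔ ∃ m n : ℤ, x = m * β + n * (Ideal.absNorm J : 𝓞 K)) (x : 𝓞 K) :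
    ∃ n : ℤ, x - n ∈ J := by
  have hint : ∀ k : ℤ, (k : 𝓞 K) ∈ J → (Ideal.absNorm J : ℤ) ∣ k := by
    intro k hk
    obtain ⟨m, n, hmn⟩ := (hmem _).mp hk
    have := intCast_add_mul_injective (σ := σ) hδim hβ (m := 0) (n := k) (m' := m)
      (n' := n * (Ideal.absNorm J : ℤ)) (by push_cast; rw [← hmn]; ring)
    exact ⟨n, by rw [this.2]; ring⟩
  have hfin : Finite (𝓞 K ⧸ J) := Ideal.finiteQuotientOfFreeOfNeBot J hJ
  have hdvd : Ideal.absNorm J ∣ addOrderOf (1 : 𝓞 K ⧸ J) := by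
    have h0 : addOrderOf (1 : 𝓞 K ⧸ J) • (1 : 𝓞 K ⧸ J) = 0 := addOrderOf_nsmul_eq_zero _
    have h1 := hint (addOrderOf (1 : 𝓞 K ⧸ J) : ℕ) (by
      rw [← Ideal.Quotient.eq_zero_iff_mem]; simpa using h0)
    exact_mod_cast h1
  have hcard : Nat.card (AddSubgroup.zmultiples (1 : 𝓞 K ⧸ J)) = Nat.card (𝓞 K ⧸ J) := by
    rw [Nat.card_zmultiples]
    refine Nat.dvd_antisymm (addOrderOf_dvd_natCard _) ?_
    rw [Ideal.absNorm_apply, Submodule.cardQuot_apply] at hdvd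
    exact hdvd
  have htop := AddSubgroup.eq_top_of_card_eq _ hcard
  obtain ⟨n, hn⟩ := AddSubgroup.mem_zmultiples_iff.mp
    (htop ▸ AddSubgroup.mem_top (Ideal.Quotient.mk J x) :
      Ideal.Quotient.mk J x ∈ AddSubgroup.zmultiples (1 : 𝓞 K ⧸ J))
  refine ⟨n, (Ideal.Quotient.mk_eq_mk_iff_sub_mem _ _).mp ?_⟩
  rw [← hn]; simp

theorem exists_eq_intCast_add_mul (hδim : 0 < (σ δ).im) (hβ : 2 * β = (b : 𝓞 K) + δ)
    {J : Ideal (𝓞 K)} (hJ : J ≠ ⊥)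
    (hmem : ∀ x : 𝓞 K, x ∈ J ↔ ∃ m n : ℤ, x = m * β + n * (Ideal.absNorm J : 𝓞 K)) (x : 𝓞 K) :
    ∃ p q : ℤ, x = p + q * β := by
  obtain ⟨n, hn⟩ := cyclic_of_isCMPoint hδim hβ hJ hmem x
  obtain ⟨m, n', h⟩ := (hmem _).mp hn
  exact ⟨n + n' * Ideal.absNorm J, m, by push_cast; linear_combination h⟩

/-- A larger ideal keeps the basis element `β`; only the integer changes. This is how the CM point
of `𝔞𝔲𝔱` provides a basis of `𝔞𝔲`. -/
theorem mem_iff_of_isCMPoint_of_le (hδim : 0 < (σ δ).im) (hβ : 2 * β = (b : 𝓞 K) + δ)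
    {J : Ideal (𝓞 K)} (hJ : J ≠ ⊥)
    (hmem : ∀ x : 𝓞 K, x ∈ J ↔ ∃ m n : ℤ, x = m * β + n * (Ideal.absNorm J : 𝓞 K))
    {I : Ideal (𝓞 K)} (hJI : J ≤ I) (x : 𝓞 K) :
    x ∈ I ↔ ∃ m n : ℤ, x = m * β + n * (Ideal.absNorm I : 𝓞 K) := by
  have hβI : β ∈ I := hJI ((hmem β).mpr ⟨1, 0, by simp⟩)
  constructor
  · intro hx
    obtain ⟨p, q, rfl⟩ := exists_eq_intCast_add_mul hδim hβ hJ hmem x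
    have hp : (p : 𝓞 K) ∈ I := by simpa using I.sub_mem hx (I.mul_mem_left (q : 𝓞 K) hβI)
    obtain ⟨n, rfl⟩ := (intCast_mem_iff_of_cyclic (fun y => by
      obtain ⟨n, hn⟩ := cyclic_of_isCMPoint hδim hβ hJ hmem y
      exact ⟨n, hJI hn⟩) p).mp hp
    exact ⟨q, n, by push_cast; ring⟩
  · rintro ⟨m, n, rfl⟩
    exact I.add_mem (I.mul_mem_left _ hβI) (I.mul_mem_left _ (Ideal.absNorm_mem I))

/-- In an imaginary quadratic field of odd discriminant the different is prime to the primes above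
a split prime number. -/
theorem notMem_of_split (hδim : 0 < (σ δ).im) (hβ : 2 * β = (b : 𝓞 K) + δ)
    (hspan : ∀ x : 𝓞 K, ∃ p q : ℤ, x = p + q * β) {D : ℤ} (hodd : Odd D)
    (hδ : δ ^ 2 = (D : 𝓞 K)) {ℓ : ℕ} (hℓ : ℓ.Prime) {v w : Ideal (𝓞 K)} (hv : v.IsPrime)
    (hw : w.IsPrime) (hvw : v ≠ w) (hspl : Ideal.span {(ℓ : 𝓞 K)} = v * w) {p : Ideal (𝓞 K)}
    (hp : p.IsPrime) (hℓp : (ℓ : 𝓞 K) ∈ p) : δ ∉ p := by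
  intro hδp
  have hDp : (D : 𝓞 K) ∈ p := by rw [← hδ]; exact p.pow_mem_of_mem hδp 2 two_pos
  have hdvd : (ℓ : ℤ) ∣ D := by
    by_contra hnd
    have hcop : IsCoprime (ℓ : ℤ) D :=
      (Nat.prime_iff_prime_int.mp hℓ).coprime_iff_not_dvd.mpr hnd
    obtain ⟨r, s, hrs⟩ := hcop
    refine hp.ne_top ((Ideal.eq_top_iff_one _).mpr ?_)
    have : (r : 𝓞 K) * (ℓ : 𝓞 K) + s * (D : 𝓞 K) = 1 := by
      exact_mod_cast congrArg (Int.cast : ℤ → 𝓞 K) hrs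
    rw [← this]
    exact p.add_mem (p.mul_mem_left _ hℓp) (p.mul_mem_left _ hDp)
  have hℓ0 : (ℓ : 𝓞 K) ≠ 0 := Nat.cast_ne_zero.mpr hℓ.ne_zero
  obtain ⟨x, hx⟩ := exists_mul_eq_of_sq_mem_span hℓ0 hv hw hvw hspl (x := δ) (by
    obtain ⟨r, hr⟩ := hdvd
    rw [hδ, hr]
    exact Ideal.mem_span_singleton'.mpr ⟨r, by push_cast; ring⟩)
  obtain ⟨r, q, hrq⟩ := hspan x
  -- Compare the `β`-coefficients of `δ = ℓ(r + qβ)` and `δ = 2β - b`: they give `qℓ = 2`, so `ℓ =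
  -- 2`, against the oddness of `D`.
  have h2 := intCast_add_mul_injective (σ := σ) hδim hβ (m := q * ℓ) (n := r * ℓ + b) (m' := 2)
    (n' := 0) (by push_cast; rw [hrq] at hx; linear_combination hx - hβ)
  have hℓ2 : (ℓ : ℤ) ∣ 2 := ⟨q, by rw [← h2.1]; ring⟩
  have h3 : ℓ = 2 := (Nat.prime_dvd_prime_iff_eq hℓ Nat.prime_two).mp (by exact_mod_cast hℓ2)
  rw [h3] at hdvd
  exact (Int.not_even_iff_odd.mpr hodd) (even_iff_two_dvd.mpr hdvd)

/-- The units of an imaginary quadratic field of discriminant less than `-4` are `±1`. -/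
theorem eq_one_or_neg_one_of_isUnit [Algebra.IsQuadraticExtension ℚ K] [IsTotallyComplex K]
    (hδim : 0 < (σ δ).im) (hβ : 2 * β = (b : 𝓞 K) + δ)
    (hspan : ∀ x : 𝓞 K, ∃ p q : ℤ, x = p + q * β) {D : ℤ} (hD : D < -4)
    (hδ : δ ^ 2 = (D : 𝓞 K)) {x : 𝓞 K} (hx : IsUnit x) : x = 1 ∨ x = -1 := by
  obtain ⟨p, q, hpq⟩ := hspan x
  have hN : (Algebra.norm ℤ x).natAbs = 1 := by
    have := Int.isUnit_iff_natAbs_eq.mp (hx.map (Algebra.norm ℤ (S := 𝓞 K)))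
    exact this
  have hσ : (normSq (σ x) : ℝ) = 1 := by
    have h := coe_intNorm_eq σ x
    rw [Complex.mul_conj] at h
    have h' : ((Algebra.norm ℤ x : ℤ) : ℝ) = normSq (σ x) := by
      have : (((Algebra.norm ℤ x : ℤ) : ℝ) : ℂ) = ((normSq (σ x) : ℝ) : ℂ) := by rw [← h]; simp
      exact_mod_cast this
    rcases Int.natAbs_eq (Algebra.norm ℤ x) with h1 | h1
    · rw [← h', h1, hN]; simp
    · exfalso
      have := normSq_nonneg (σ x)
      rw [← h', h1, hN] at this
      norm_num at this
  have hδσ : (σ δ) ^ 2 = (D : ℂ) := by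
    have := congrArg (fun x : 𝓞 K => σ x) hδ
    simpa using this
  have hre := congrArg Complex.re hδσ
  have him := congrArg Complex.im hδσ
  simp only [pow_two, Complex.mul_re, Complex.mul_im, Complex.intCast_re, Complex.intCast_im]
    at hre him
  have hδre : (σ δ).re = 0 := by
    have : (σ δ).re * (σ δ).im = 0 := by linarith
    exact (mul_eq_zero.mp this).resolve_right hδim.ne'
  have hx2 : 2 * x = (2 * p + q * b : 𝓞 K) + q * δ := by
    rw [hpq]; linear_combination (q : 𝓞 K) * hβ
  have hx2σ : 2 * σ x = (2 * p + q * b : ℂ) + q * σ δ := by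
    have := congrArg (embeddingIntegers σ) hx2
    simp only [map_add, map_mul, map_ofNat, map_intCast, embeddingIntegers_apply] at this
    exact this
  have hR := congrArg Complex.re hx2σ
  have hI := congrArg Complex.im hx2σ
  simp [Complex.mul_re, Complex.mul_im, hδre] at hR hI
  rw [normSq_apply] at hσ
  -- This is `4 N(p + qβ) = 4`. As `-D > 4`, the coefficient `q` must vanish.
  have h4 : ((2 * p + q * b : ℤ) : ℝ) ^ 2 + (q : ℝ) ^ 2 * (-D) = 4 := by
    push_cast
    have e1 : (2 * p + q * b : ℝ) = 2 * (σ x).re := by linarith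
    have e2 : (-D : ℝ) = (σ δ).im * (σ δ).im := by rw [hδre] at hre; linarith
    rw [e1, e2]
    have : (q : ℝ) ^ 2 * ((σ δ).im * (σ δ).im) = (2 * (σ x).im) ^ 2 := by rw [hI]; ring
    rw [this]; linarith
  have h5 : (2 * p + q * b) ^ 2 + q ^ 2 * (-D) = 4 := by exact_mod_cast h4
  have hq : q = 0 := by
    by_contra hq
    have : 1 ≤ q ^ 2 := by
      have := Int.one_le_abs hq
      nlinarith [sq_abs q]
    nlinarith [sq_nonneg (2 * p + q * b)]
  subst hq
  have hp : p ^ 2 = 1 := by linarith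
  rw [hpq]
  have h6 : (p - 1) * (p + 1) = 0 := by linarith
  rcases mul_eq_zero.mp h6 with h | h
  · left; rw [sub_eq_zero.mp h]; simp
  · right; rw [eq_neg_of_add_eq_zero_left h]; simp

end Lattice

/-! ### The product of the base change of a Dirichlet character and an inverse Hecke character -/

section Twist

variable {K : Type*} [Field K] [NumberField K] {σ : K →+* ℂ} {a b a' b' : ℤ}

theorem IsGroessencharakter.inducing_conductor_dvd {𝔪 : Ideal (𝓞 K)} {χ : Ideal (𝓞 K) →*₀ ℂ}
    (h : IsGroessencharakter σ a b 𝔪 χ) : h.inducing.conductor ∣ 𝔪 :=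
  h.exists_primitive.choose_spec.1

theorem IsGroessencharakter.inducing_toHom {𝔪 : Ideal (𝓞 K)} {χ : Ideal (𝓞 K) →*₀ ℂ}
    (h : IsGroessencharakter σ a b 𝔪 χ) {𝔞 : Ideal (𝓞 K)} (h𝔞 : IsCoprime 𝔞 𝔪) :
    h.inducing.toHom 𝔞 = χ 𝔞 :=
  h.exists_primitive.choose_spec.2 𝔞 h𝔞

theorem HeckeCharacter.mul_toHom (χ : HeckeCharacter σ a b) (χ' : HeckeCharacter σ a' b')
    {𝔞 : Ideal (𝓞 K)} (h : IsCoprime 𝔞 χ.conductor) (h' : IsCoprime 𝔞 χ'.conductor) :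
    (χ.mul χ').toHom 𝔞 = χ.toHom 𝔞 * χ'.toHom 𝔞 :=
  (χ.isGroessencharakter.mul χ'.isGroessencharakter).inducing_toHom (IsCoprime.mul_right h h')

theorem HeckeCharacter.mul_conductor_dvd (χ : HeckeCharacter σ a b)
    (χ' : HeckeCharacter σ a' b') : (χ.mul χ').conductor ∣ χ.conductor * χ'.conductor :=
  (χ.isGroessencharakter.mul χ'.isGroessencharakter).inducing_conductor_dvd

theorem HeckeCharacter.inv_conductor_dvd (χ : HeckeCharacter σ a b) :
    χ.inv.conductor ∣ χ.conductor :=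
  χ.isGroessencharakter.inv.inducing_conductor_dvd

theorem HeckeCharacter.inv_toHom (χ : HeckeCharacter σ a b) {𝔞 : Ideal (𝓞 K)}
    (h : IsCoprime 𝔞 χ.conductor) : χ.inv.toHom 𝔞 = (χ.toHom 𝔞)⁻¹ :=
  χ.isGroessencharakter.inv.inducing_toHom h

theorem HeckeCharacter.toHom_ne_zero (χ : HeckeCharacter σ a b) {𝔞 : Ideal (𝓞 K)} (h0 : 𝔞 ≠ ⊥)
    (h : IsCoprime 𝔞 χ.conductor) : χ.toHom 𝔞 ≠ 0 :=
  (χ.isGroessencharakter.2.1 𝔞 h0).mpr h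

variable [Algebra.IsQuadraticExtension ℚ K] [IsTotallyComplex K]

/-- The twist `ψ_{/K} χ⁻¹` at the ideals prime to `u` and to the conductor of `χ`. -/
theorem heckeBaseChange_mul_inv_toHom {u : ℕ} [NeZero u] (ψ : DirichletCharacter ℂ u)
    (χ : HeckeCharacter σ a b) {𝔟 : Ideal (𝓞 K)} (h0 : 𝔟 ≠ ⊥)
    (hu : IsCoprime 𝔟 (Ideal.span {(u : 𝓞 K)})) (hχ : IsCoprime 𝔟 χ.conductor) :
    ((ψ.heckeBaseChange σ).mul χ.inv).toHom 𝔟 =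
      ψ (Ideal.absNorm 𝔟 : ZMod u) * (χ.toHom 𝔟)⁻¹ := by
  rw [HeckeCharacter.mul_toHom (ψ.heckeBaseChange σ) _
    (IsCoprime.of_isCoprime_of_dvd_right hu
      (isGroessencharakter_dirichletNorm σ ψ).inducing_conductor_dvd)
    (IsCoprime.of_isCoprime_of_dvd_right hχ χ.inv_conductor_dvd), χ.inv_toHom hχ,
    ← dirichletNorm_apply ψ h0]
  congr 1
  exact (isGroessencharakter_dirichletNorm σ ψ).inducing_toHom hu

omit [Algebra.IsQuadraticExtension ℚ K] [IsTotallyComplex K] in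
theorem span_natCast_le_of_ringEquiv {I : Ideal (𝓞 K)} {n : ℕ} (e : (𝓞 K ⧸ I) ≃+* ZMod n) :
    Ideal.span {(n : 𝓞 K)} ≤ I := by
  rw [Ideal.span_singleton_le_iff_mem, ← absNorm_of_ringEquiv e]
  exact Ideal.absNorm_mem I

omit [Algebra.IsQuadraticExtension ℚ K] [IsTotallyComplex K] in
theorem isCoprime_span_of_le {I J J' : Ideal (𝓞 K)} (h : IsCoprime I J) (hle : J ≤ J') :
    IsCoprime I J' :=
  IsCoprime.of_isCoprime_of_dvd_right h (Ideal.dvd_iff_le.mpr hle)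

omit [Algebra.IsQuadraticExtension ℚ K] [IsTotallyComplex K] in
/-- A Hecke character of finite type `(𝔲𝔱, ψ₁ψ₂)` at the principal ideals prime to `𝔲𝔱`. -/
theorem HeckeCharacter.IsOfFiniteType.toHom_span {u t : ℕ} {χ : HeckeCharacter σ a b}
    {𝔲 𝔱 : Ideal (𝓞 K)} {ψ₁ : DirichletCharacter ℂ u} {ψ₂ : DirichletCharacter ℂ t}
    (hχ : χ.IsOfFiniteType (𝔲 * 𝔱) (ψ₁.primitive_mul ψ₂))
    (e : (𝓞 K ⧸ 𝔲 * 𝔱) ≃+* ZMod (u * t)) (e𝔲 : (𝓞 K ⧸ 𝔲) ≃+* ZMod u)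
    (e𝔱 : (𝓞 K ⧸ 𝔱) ≃+* ZMod t) {α : 𝓞 K} (hα : α ≠ 0)
    (hcop : IsCoprime (Ideal.span {α}) (𝔲 * 𝔱)) :
    χ.toHom (Ideal.span {α}) = ψ₁ (e𝔲 (Ideal.Quotient.mk 𝔲 α)) *
      ψ₂ (e𝔱 (Ideal.Quotient.mk 𝔱 α)) * infinityType σ a b α := by
  obtain ⟨𝔑ε, eε, hdvd, -, hval⟩ := hχ
  -- Modulo `𝔲𝔱` every element is a rational integer `m`. Evaluating all three characters at the
  -- same `m`, prime to `ut`, avoids any compatibility between the chosen isomorphisms and any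
  -- coprimality of `𝔲` and `𝔱`.
  obtain ⟨m, hm⟩ := cyclic_of_ringEquiv e α
  have hmu : α - m ∈ 𝔲 := Ideal.mul_le_left hm
  have hmt : α - m ∈ 𝔱 := Ideal.mul_le_right hm
  have hmε : α - m ∈ 𝔑ε := Ideal.dvd_iff_le.mp hdvd hm
  have hunit : IsUnit (e (Ideal.Quotient.mk _ α)) := (isUnit_ringEquiv_mk_iff e α).mpr hcop
  rw [ringEquiv_mk_eq_of_sub_mem e hm, map_intCast, map_intCast] at hunit
  have hmcop : IsCoprime m ((u * t : ℕ) : ℤ) := by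
    rwa [isCoprime_comm, ← ZMod.coe_int_isUnit_iff_isCoprime]
  rw [hval α hα, ringEquiv_mk_eq_of_sub_mem eε hmε, ringEquiv_mk_eq_of_sub_mem e𝔲 hmu,
    ringEquiv_mk_eq_of_sub_mem e𝔱 hmt]
  simp only [map_intCast]
  rw [infinityType, ← mul_assoc]
  congr 2
  have hmu' : IsCoprime m (u : ℤ) := by
    push_cast at hmcop; exact (IsCoprime.mul_right_iff.mp hmcop).1
  have hmt' : IsCoprime m (t : ℤ) := by
    push_cast at hmcop; exact (IsCoprime.mul_right_iff.mp hmcop).2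
  have hml : IsCoprime m (Nat.lcm u t : ℕ) := by
    refine IsCoprime.of_isCoprime_of_dvd_right hmcop ?_
    exact_mod_cast Nat.lcm_dvd_mul u t
  rw [DirichletCharacter.mul_def, DirichletCharacter.primitiveCharacter_apply_of_isCoprime _ hml,
    DirichletCharacter.mul, MulChar.mul_apply, DirichletCharacter.changeLevel_eq_cast_of_dvd' _ _ hml,
    DirichletCharacter.changeLevel_eq_cast_of_dvd' _ _ hml]

omit [Algebra.IsQuadraticExtension ℚ K] [IsTotallyComplex K] in
/-- A primitive Dirichlet character of modulus `N(I)` is trivial on no proper divisor of `I`. -/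
theorem le_of_isPrimitive {n : ℕ} [NeZero n] {ψ : DirichletCharacter ℂ n} (hψ : ψ.IsPrimitive)
    {I 𝔠 : Ideal (𝓞 K)} (e : (𝓞 K ⧸ I) ≃+* ZMod n)
    (h : ∀ m : ℤ, IsCoprime m (n : ℤ) → (m : 𝓞 K) - 1 ∈ 𝔠 ⊔ I → ψ m = 1) : 𝔠 ≤ I := by
  have hI : Ideal.absNorm I = n := absNorm_of_ringEquiv e
  have hcyc : ∀ x : 𝓞 K, ∃ m : ℤ, x - m ∈ I := cyclic_of_ringEquiv e
  have hcyc' : ∀ x : 𝓞 K, ∃ m : ℤ, x - m ∈ 𝔠 ⊔ I := fun x =>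
    (hcyc x).imp fun m hm => Ideal.mem_sup_right hm
  -- The hypothesis says that `ψ` factors through level `d`, a divisor of `n`. Primitivity forces `d
  -- = n`, so `𝔠 ⊔ I` contains no more integers than `I`, and then no more elements.
  set d := Ideal.absNorm (𝔠 ⊔ I) with hd
  have hdn : d ∣ n := by
    have := (intCast_mem_iff_of_cyclic hcyc' (n : ℤ)).mp (Ideal.mem_sup_right (by
      rw [← hI]; exact_mod_cast Ideal.absNorm_mem I))
    exact_mod_cast this
  have hfac : ψ.FactorsThrough d := by
    rw [DirichletCharacter.factorsThrough_iff_ker_unitsMap hdn]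
    intro x hx
    rw [MonoidHom.mem_ker] at hx ⊢
    obtain ⟨m, hm⟩ := ZMod.intCast_surjective (x : ZMod n)
    have hx' : ((m : ℤ) : ZMod d) = 1 := by
      have := congrArg (Units.val) hx
      rw [ZMod.unitsMap_val, ← hm, ZMod.cast_intCast hdn] at this
      simpa using this
    have hm1 : (m : 𝓞 K) - 1 ∈ 𝔠 ⊔ I := by
      have := (intCast_mem_iff_of_cyclic hcyc' (m - 1)).mpr (by
        rw [← hd, ← ZMod.intCast_zmod_eq_zero_iff_dvd]
        · push_cast; rw [hx', sub_self])
      exact_mod_cast this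
    have hmcop : IsCoprime m (n : ℤ) := by
      rw [isCoprime_comm, ← ZMod.coe_int_isUnit_iff_isCoprime, hm]
      exact x.isUnit
    rw [Units.ext_iff, MulChar.coe_toUnitHom, ← hm, h m hmcop hm1, Units.val_one]
  have hnd : n ∣ d := by
    have h1 := DirichletCharacter.conductor_dvd_of_mem_conductorSet ψ hfac
    rwa [(DirichletCharacter.isPrimitive_def ψ).mp hψ] at h1
  refine fun x hx => ?_
  obtain ⟨m, hm⟩ := hcyc x
  have hm' : (m : 𝓞 K) ∈ 𝔠 ⊔ I := by
    have := (𝔠 ⊔ I).sub_mem (Ideal.mem_sup_left hx) (Ideal.mem_sup_right hm)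
    simpa using this
  have hdm := (intCast_mem_iff_of_cyclic hcyc' m).mp hm'
  have hmI : (m : 𝓞 K) ∈ I := (intCast_mem_iff_of_cyclic hcyc m).mpr
    ((by rw [hI]; exact_mod_cast hnd : (Ideal.absNorm I : ℤ) ∣ (d : ℤ)).trans hdm)
  simpa using I.add_mem hm hmI

end Twist

/-! ### The conductor and the values of `ψ₁_{/K} χ⁻¹` -/

theorem isCoprime_span_of_sub_one_mem {R : Type*} [CommRing R] {I : Ideal R} {x : R}
    (h : x - 1 ∈ I) : IsCoprime (Ideal.span {x}) I :=
  Ideal.isCoprime_iff_exists.mpr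
    ⟨x, Ideal.mem_span_singleton_self _, 1 - x, by simpa using I.neg_mem h, by ring⟩

section Values

variable {K : Type*} [Field K] [NumberField K] {σ : K →+* ℂ} {a b : ℤ}

/-- A Hecke character of finite type `(𝔲𝔱, ψ₁ψ₂)`, where `𝓞 K ⧸ 𝔲𝔱` is cyclic and `𝔲𝔱` is prime to
its conjugate. -/
structure SplitFiniteType {u t : ℕ} (χ : HeckeCharacter σ a b) (ψ₁ : DirichletCharacter ℂ u)
    (ψ₂ : DirichletCharacter ℂ t) (𝔲 𝔱 : Ideal (𝓞 K)) where
  /-- The isomorphism with the integers modulo `ut`. -/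
  e : (𝓞 K ⧸ 𝔲 * 𝔱) ≃+* ZMod (u * t)
  /-- The isomorphism with the integers modulo `u`. -/
  e𝔲 : (𝓞 K ⧸ 𝔲) ≃+* ZMod u
  /-- The isomorphism with the integers modulo `t`. -/
  e𝔱 : (𝓞 K ⧸ 𝔱) ≃+* ZMod t
  finiteType : χ.IsOfFiniteType (𝔲 * 𝔱) (ψ₁.primitive_mul ψ₂)
  coprime_conj : IsCoprime (conjIdeal σ (𝔲 * 𝔱)) (𝔲 * 𝔱)

namespace SplitFiniteType

variable {u t : ℕ} {χ : HeckeCharacter σ a b} {ψ₁ : DirichletCharacter ℂ u}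
  {ψ₂ : DirichletCharacter ℂ t} {𝔲 𝔱 : Ideal (𝓞 K)} (S : SplitFiniteType χ ψ₁ ψ₂ 𝔲 𝔱)
include S

theorem span_le : Ideal.span {((u * t : ℕ) : 𝓞 K)} ≤ 𝔲 * 𝔱 := span_natCast_le_of_ringEquiv S.e

theorem conductor_dvd : χ.conductor ∣ 𝔲 * 𝔱 := by
  obtain ⟨𝔑ε, -, hdvd, hc, -⟩ := S.finiteType
  rwa [hc]

theorem isCoprime_conductor {𝔟 : Ideal (𝓞 K)} (h : IsCoprime 𝔟 (𝔲 * 𝔱)) :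
    IsCoprime 𝔟 χ.conductor :=
  IsCoprime.of_isCoprime_of_dvd_right h S.conductor_dvd

variable [Algebra.IsQuadraticExtension ℚ K]

theorem coprime_conj_left : IsCoprime (conjIdeal σ 𝔲) 𝔱 := by
  have h := S.coprime_conj
  rw [conjIdeal_mul] at h
  exact (IsCoprime.mul_right_iff.mp (IsCoprime.mul_left_iff.mp h).1).2

theorem isCoprime_modulus {𝔟 : Ideal (𝓞 K)}
    (h : IsCoprime 𝔟 (Ideal.span {((u * t : ℕ) : 𝓞 K)})) :
    IsCoprime 𝔟 (conjIdeal σ 𝔲 * 𝔱) := by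
  have h1 := isCoprime_span_of_le h S.span_le
  refine IsCoprime.mul_right (isCoprime_span_of_le h ?_) (IsCoprime.mul_right_iff.mp h1).2
  rw [Ideal.span_singleton_le_iff_mem, mem_conjIdeal, map_natCast]
  exact Ideal.mul_le_left (S.span_le (Ideal.mem_span_singleton_self _))

/-- The finite part of `ψ₁_{/K} χ⁻¹`. -/
noncomputable def finitePart (γ : 𝓞 K) : ℂ :=
  ψ₁ (S.e𝔲 (Ideal.Quotient.mk 𝔲 (integersConj σ γ))) * (ψ₂ (S.e𝔱 (Ideal.Quotient.mk 𝔱 γ)))⁻¹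

theorem finitePart_eq {γ γ' : 𝓞 K} (h : γ - γ' ∈ conjIdeal σ 𝔲 * 𝔱) :
    S.finitePart γ = S.finitePart γ' := by
  have h1 : γ - γ' ∈ conjIdeal σ 𝔲 := Ideal.mul_le_left h
  have h2 : γ - γ' ∈ 𝔱 := Ideal.mul_le_right h
  rw [mem_conjIdeal, map_sub] at h1
  rw [finitePart, finitePart, ringEquiv_mk_eq_of_sub_mem S.e𝔲 h1,
    ringEquiv_mk_eq_of_sub_mem S.e𝔱 h2]

variable [IsTotallyComplex K] [NeZero u] [NeZero t]

omit [NeZero t] in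
theorem toHom_eq {𝔟 : Ideal (𝓞 K)} (h0 : 𝔟 ≠ ⊥)
    (h : IsCoprime 𝔟 (Ideal.span {((u * t : ℕ) : 𝓞 K)})) :
    ((ψ₁.heckeBaseChange σ).mul χ.inv).toHom 𝔟 =
      ψ₁ (Ideal.absNorm 𝔟 : ZMod u) * (χ.toHom 𝔟)⁻¹ := by
  refine heckeBaseChange_mul_inv_toHom ψ₁ χ h0 (isCoprime_span_of_le h ?_)
    (S.isCoprime_conductor (isCoprime_span_of_le h S.span_le))
  rw [Ideal.span_singleton_le_span_singleton]
  exact ⟨(t : 𝓞 K), by push_cast; ring⟩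

-- Modulo `𝔲` the norm of `γ` is `γ · conj(γ)`. Its factor `ψ₁(γ)` cancels against the one in
-- `χ((γ))` and leaves `ψ₁(conj γ)`.
omit [NeZero t] in
theorem toHom_span {γ : 𝓞 K} (h0 : γ ≠ 0)
    (h : IsCoprime (Ideal.span {γ}) (Ideal.span {((u * t : ℕ) : 𝓞 K)})) :
    ((ψ₁.heckeBaseChange σ).mul χ.inv).toHom (Ideal.span {γ}) =
      S.finitePart γ * infinityType σ (0 + -a) (0 + -b) γ := by
  have hN := isCoprime_span_of_le h S.span_le
  have h0' : Ideal.span {γ} ≠ ⊥ := fun h => h0 (Ideal.span_singleton_eq_bot.mp h)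
  have hnorm : ((Ideal.absNorm (Ideal.span {γ}) : ℕ) : ZMod u) =
      S.e𝔲 (Ideal.Quotient.mk 𝔲 γ) * S.e𝔲 (Ideal.Quotient.mk 𝔲 (integersConj σ γ)) := by
    rw [← map_mul, ← map_mul, ← coe_absNorm_span_singleton]
    simp
  have hu : ψ₁ (S.e𝔲 (Ideal.Quotient.mk 𝔲 γ)) ≠ 0 := by
    refine (((isUnit_ringEquiv_mk_iff S.e𝔲 γ).mpr
      (IsCoprime.mul_right_iff.mp hN).1).map ψ₁).ne_zero
  rw [S.toHom_eq h0' h, S.finiteType.toHom_span S.e S.e𝔲 S.e𝔱 h0 hN, hnorm, map_mul, zero_add,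
    zero_add, infinityType_neg_neg, finitePart, mul_inv, mul_inv]
  field_simp

omit [NeZero t] in
theorem isCoprime_toHom_conductor {𝔟 : Ideal (𝓞 K)}
    (h : IsCoprime 𝔟 (Ideal.span {((u * t : ℕ) : 𝓞 K)})) :
    IsCoprime 𝔟 ((ψ₁.heckeBaseChange σ).mul χ.inv).conductor := by
  refine IsCoprime.of_isCoprime_of_dvd_right ?_ (HeckeCharacter.mul_conductor_dvd _ _)
  refine IsCoprime.mul_right ?_ (IsCoprime.of_isCoprime_of_dvd_right
    (S.isCoprime_conductor (isCoprime_span_of_le h S.span_le)) χ.inv_conductor_dvd)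
  refine IsCoprime.of_isCoprime_of_dvd_right ?_
    (isGroessencharakter_dirichletNorm σ ψ₁).inducing_conductor_dvd
  refine isCoprime_span_of_le h ?_
  rw [Ideal.span_singleton_le_span_singleton]
  exact ⟨(t : 𝓞 K), by push_cast; ring⟩

omit S [Algebra.IsQuadraticExtension ℚ K] [IsTotallyComplex K] in
theorem span_natCast_mul_ne_bot : Ideal.span {((u * t : ℕ) : 𝓞 K)} ≠ ⊥ := by
  have : u * t ≠ 0 := mul_ne_zero (NeZero.ne u) (NeZero.ne t)
  rw [Ne, Ideal.span_singleton_eq_bot]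
  exact_mod_cast this

omit [NeZero t] in
theorem finitePart_eq_one {γ : 𝓞 K} (h0 : γ ≠ 0)
    (h : IsCoprime (Ideal.span {γ}) (Ideal.span {((u * t : ℕ) : 𝓞 K)}))
    (h1 : γ - 1 ∈ ((ψ₁.heckeBaseChange σ).mul χ.inv).conductor) : S.finitePart γ = 1 := by
  have h2 := ((ψ₁.heckeBaseChange σ).mul χ.inv).isGroessencharakter.2.2 γ h0 h1
  rw [S.toHom_span h0 h] at h2
  exact mul_right_cancel₀ (infinityType_ne_zero σ _ _ h0) (h2.trans (one_mul _).symm)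

/-- The finite part depends only on `γ` modulo `conj(𝔲)𝔱`, so `γ` may be moved to an element prime
to `ut`, where the finite part is read off from the character. -/
theorem finitePart_eq_one_of_mem {γ : 𝓞 K}
    (h : IsCoprime (Ideal.span {γ}) (conjIdeal σ 𝔲 * 𝔱))
    (h1 : γ - 1 ∈ ((ψ₁.heckeBaseChange σ).mul χ.inv).conductor) : S.finitePart γ = 1 := by
  set 𝔠 := ((ψ₁.heckeBaseChange σ).mul χ.inv).conductor with h𝔠
  have hc : IsCoprime (Ideal.span {γ}) 𝔠 := Ideal.isCoprime_iff_exists.mpr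
    ⟨γ, Ideal.mem_span_singleton_self _, 1 - γ, by simpa using 𝔠.neg_mem h1, by ring⟩
  obtain ⟨η, hη0, hη, -, hηN⟩ := Ideal.exists_sub_mem_isCoprime_span (span_natCast_mul_ne_bot (K := K) (u := u) (t := t))
    (IsCoprime.mul_right hc h)
  have hη1 : η - 1 ∈ 𝔠 := by
    have := 𝔠.add_mem (Ideal.mul_le_left hη) h1
    simpa using this
  rw [← S.finitePart_eq_one hη0 hηN hη1]
  refine S.finitePart_eq ?_
  have := (conjIdeal σ 𝔲 * 𝔱).neg_mem (Ideal.mul_le_right hη)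
  simpa using this

/-- The conductor of `ψ₁_{/K} χ⁻¹` is `conj(𝔲) 𝔱`. -/
theorem conductor_eq (hψ₁ : ψ₁.IsPrimitive) (hψ₂ : ψ₂.IsPrimitive) :
    ((ψ₁.heckeBaseChange σ).mul χ.inv).conductor = conjIdeal σ 𝔲 * 𝔱 := by
  set ξ := (ψ₁.heckeBaseChange σ).mul χ.inv with hξ
  set 𝔠 := ξ.conductor with h𝔠
  obtain ⟨p, hp, q, hq, hpq⟩ := Ideal.isCoprime_iff_exists.mp S.coprime_conj_left
  refine le_antisymm ?_ ?_
  · have h1 : 𝔠 ≤ 𝔱 := by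
      refine le_of_isPrimitive hψ₂ S.e𝔱 fun m hm hm1 => ?_
      -- With `m = 1 + c + s` and `p + q = 1`, the element `1 + p * c` is `1` modulo `𝔠` and modulo
      -- `conj(𝔲)` but `m` modulo `𝔱`, so its finite part isolates `ψ₂ m`.
      obtain ⟨c, hc, s, hs, hcs⟩ := Submodule.mem_sup.mp hm1
      have hu : (1 + p * c) - 1 ∈ conjIdeal σ 𝔲 := by
        rw [add_sub_cancel_left]; exact Ideal.mul_mem_right _ _ hp
      have ht : (1 + p * c) - (m : 𝓞 K) ∈ 𝔱 := by
        have : (1 + p * c) - (m : 𝓞 K) = -(q * c) - s := by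
          linear_combination hcs + c * hpq
        rw [this]
        exact 𝔱.sub_mem (𝔱.neg_mem (Ideal.mul_mem_right _ _ hq)) hs
      have hcop : IsCoprime (Ideal.span {1 + p * c}) 𝔱 := by
        rw [← isUnit_ringEquiv_mk_iff S.e𝔱, ringEquiv_mk_eq_of_sub_mem S.e𝔱 ht, map_intCast,
          map_intCast, ZMod.coe_int_isUnit_iff_isCoprime, isCoprime_comm]
        exact hm
      have hone := S.finitePart_eq_one_of_mem (γ := 1 + p * c)
        (IsCoprime.mul_right (isCoprime_span_of_sub_one_mem hu) hcop)
        (by rw [add_sub_cancel_left]; exact Ideal.mul_mem_left _ _ hc)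
      rw [finitePart, ringEquiv_mk_eq_of_sub_mem S.e𝔱 ht,
        ringEquiv_mk_eq_of_sub_mem S.e𝔲 (y := 1) (by
          rw [mem_conjIdeal, map_sub, map_one] at hu; exact hu)] at hone
      simpa using hone
    -- The conjugate argument, with `p` and `q` exchanged: `1 + q * conj(c)` isolates `ψ₁ m`.
    have h2 : conjIdeal σ 𝔠 ≤ 𝔲 := by
      refine le_of_isPrimitive hψ₁ S.e𝔲 fun m hm hm1 => ?_
      obtain ⟨c, hc, s, hs, hcs⟩ := Submodule.mem_sup.mp hm1
      rw [mem_conjIdeal] at hc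
      have ht : (1 + q * integersConj σ c) - 1 ∈ 𝔱 := by
        rw [add_sub_cancel_left]; exact Ideal.mul_mem_right _ _ hq
      have hu : integersConj σ (1 + q * integersConj σ c) - (m : 𝓞 K) ∈ 𝔲 := by
        have hpq' : integersConj σ p + integersConj σ q = 1 := by rw [← map_add, hpq, map_one]
        have : integersConj σ (1 + q * integersConj σ c) - (m : 𝓞 K) =
            -(integersConj σ p * c) - s := by
          rw [map_add, map_mul, map_one, integersConj_integersConj]
          linear_combination hcs + c * hpq'
        rw [this]
        exact 𝔲.sub_mem (𝔲.neg_mem (Ideal.mul_mem_right _ _ ((mem_conjIdeal σ).mp hp))) hs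
      have hcop : IsCoprime (Ideal.span {1 + q * integersConj σ c}) (conjIdeal σ 𝔲) := by
        have : IsCoprime (Ideal.span {integersConj σ (1 + q * integersConj σ c)}) 𝔲 := by
          rw [← isUnit_ringEquiv_mk_iff S.e𝔲, ringEquiv_mk_eq_of_sub_mem S.e𝔲 hu, map_intCast,
            map_intCast, ZMod.coe_int_isUnit_iff_isCoprime, isCoprime_comm]
          exact hm
        have := isCoprime_conjIdeal σ this
        rwa [conjIdeal_span, integersConj_integersConj] at this
      have hone := S.finitePart_eq_one_of_mem (γ := 1 + q * integersConj σ c)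
        (IsCoprime.mul_right hcop (isCoprime_span_of_sub_one_mem ht))
        (by rw [add_sub_cancel_left]; exact Ideal.mul_mem_left _ _ hc)
      rw [finitePart, ringEquiv_mk_eq_of_sub_mem S.e𝔲 hu,
        ringEquiv_mk_eq_of_sub_mem S.e𝔱 ht] at hone
      simpa using hone
    rw [Ideal.mul_eq_inf_of_isCoprime S.coprime_conj_left]
    refine le_inf (fun x hx => ?_) h1
    rw [mem_conjIdeal]
    exact h2 ((mem_conjIdeal σ).mpr (by simpa using hx))
  -- For the other inclusion, the finite part is trivial on all `α ≡ 1` modulo `𝔠 ⊔ conj(𝔲)𝔱`. The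
  -- character therefore descends to this modulus, which by primitivity equals `𝔠`.
  · have hdvd : 𝔠 ⊔ conjIdeal σ 𝔲 * 𝔱 ∣ 𝔠 := Ideal.dvd_iff_le.mpr le_sup_left
    obtain ⟨ξ', hξ', hag⟩ := ξ.isGroessencharakter.exists_of_dvd hdvd (span_natCast_mul_ne_bot (K := K) (u := u) (t := t))
      (fun 𝔟 h𝔟 => S.isCoprime_toHom_conductor h𝔟) (fun α hα hαN hα1 => by
        obtain ⟨c, hc, s, hs, hcs⟩ := Submodule.mem_sup.mp hα1
        have hfin : S.finitePart α = S.finitePart (1 + c) := S.finitePart_eq (by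
          have : α - (1 + c) = s := by linear_combination -hcs
          rw [this]; exact hs)
        have hcop : IsCoprime (Ideal.span {1 + c}) (conjIdeal σ 𝔲 * 𝔱) := by
          obtain ⟨x, hx, y, hy, hxy⟩ := Ideal.isCoprime_iff_exists.mp (S.isCoprime_modulus hαN)
          obtain ⟨z, rfl⟩ := Ideal.mem_span_singleton'.mp hx
          refine Ideal.isCoprime_iff_exists.mpr ⟨z * (1 + c), Ideal.mem_span_singleton'.mpr
            ⟨z, rfl⟩, y + z * s, Ideal.add_mem _ hy (Ideal.mul_mem_left _ _ hs), ?_⟩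
          linear_combination hxy + z * hcs
        rw [S.toHom_span hα hαN, hfin, S.finitePart_eq_one_of_mem hcop
          (by rw [add_sub_cancel_left]; exact hc), one_mul])
    have := ξ.primitive _ ξ' hdvd hξ' hag
    rw [← h𝔠] at this
    rw [← this]
    exact le_sup_right

end SplitFiniteType

end Values

/-! ### The values of `ψ₁_{/K} χ⁻¹` in terms of lattice coordinates -/

section LatticeValue

theorem mem_of_mul_mem_span_mul {R : Type*} [CommRing R] [IsDomain R] {A x : R} {I : Ideal R}
    (hA : A ≠ 0) (h : A * x ∈ Ideal.span {A} * I) : x ∈ I := by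
  obtain ⟨z, hz, hzx⟩ := Ideal.mem_span_singleton_mul.mp h
  rwa [← mul_left_cancel₀ hA hzx]

/-- Here `βx` lies in `(A)T`, so `A` can be cancelled. This reads congruences modulo `𝔱` off
identities containing `A`, although `A` need not be prime to `𝔱`. -/
theorem mem_of_mul_eq_mul {R : Type*} [CommRing R] [IsDomain R] {I J T : Ideal R} {A β : R}
    (hA0 : A ≠ 0) (hβ : β ∈ I * T) (hnorm : I * J = Ideal.span {A}) {m x y : R} (hx : x ∈ J)
    (hy : A * y = m * β * x) : y ∈ T := by
  refine mem_of_mul_mem_span_mul hA0 ?_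
  have h1 : Ideal.span {A} * T = (I * T) * J := by rw [← hnorm]; ring
  rw [hy, h1, mul_assoc m β x]
  exact Ideal.mul_mem_left _ _ (Ideal.mul_mem_mul hβ hx)

namespace SplitFiniteType

variable {K : Type*} [Field K] [NumberField K] {σ : K →+* ℂ} {a b : ℤ}
  {u t : ℕ} {χ : HeckeCharacter σ a b} {ψ₁ : DirichletCharacter ℂ u}
  {ψ₂ : DirichletCharacter ℂ t} {𝔲 𝔱 : Ideal (𝓞 K)} (S : SplitFiniteType χ ψ₁ ψ₂ 𝔲 𝔱)
  [Algebra.IsQuadraticExtension ℚ K] [IsTotallyComplex K] [NeZero u] [NeZero t]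
include S

-- Since `conj(β) = β - δ` and both `β` and `A` lie in `𝔲`, the conjugate of `α` retains only the
-- coordinate `m` modulo `𝔲`.
omit S [IsTotallyComplex K] [NeZero u] [NeZero t] in
theorem integersConj_sub_mem {δ β : 𝓞 K} (hδ : β - integersConj σ β = δ) {I : Ideal (𝓞 K)}
    (hI𝔲 : I ≤ 𝔲) (hβ : β ∈ I * 𝔱) {m n : ℤ} {α : 𝓞 K}
    (hα : α = m * β + n * (Ideal.absNorm I : 𝓞 K)) :
    integersConj σ α - (m : 𝓞 K) * (-δ) ∈ 𝔲 := by
  have hA𝔲 : (Ideal.absNorm I : 𝓞 K) ∈ 𝔲 := hI𝔲 (Ideal.absNorm_mem I)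
  have hβ𝔲 : β ∈ 𝔲 := hI𝔲 (Ideal.mul_le_left hβ)
  have : integersConj σ α - (m : 𝓞 K) * (-δ) = m * β + n * (Ideal.absNorm I : 𝓞 K) := by
    rw [hα, map_add, map_mul, map_mul, map_intCast, map_intCast, map_natCast]
    linear_combination (-(m : 𝓞 K)) * hδ
  rw [this]
  exact 𝔲.add_mem (Ideal.mul_mem_left _ _ hβ𝔲) (Ideal.mul_mem_left _ _ hA𝔲)

-- This settles the vanishing: if `𝔟` is not prime to the conductor, then `ψ₁(m) ψ₂(n) = 0` as well.
-- Primeness to `conj(𝔲)` comes from `conj(α) ≡ -mδ`, and primeness to `𝔱` from an element of `𝔟`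
-- congruent to `n`.
omit [IsTotallyComplex K] [NeZero u] [NeZero t] in
theorem isCoprime_of_isUnit {δ β : 𝓞 K}
    (hδ : β - integersConj σ β = δ) (hδ𝔲 : IsCoprime (Ideal.span {δ}) 𝔲) {I 𝔟 : Ideal (𝓞 K)}
    (hI : I ≠ ⊥) (hI𝔲 : I ≤ 𝔲) (hβ : β ∈ I * 𝔱)
    (hnorm : I * conjIdeal σ I = Ideal.span {(Ideal.absNorm I : 𝓞 K)})
    (hcop : IsCoprime (conjIdeal σ I) (𝔲 * 𝔱)) {m n : ℤ} {α : 𝓞 K}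
    (hα : α = m * β + n * (Ideal.absNorm I : 𝓞 K)) (h𝔟 : I * 𝔟 = Ideal.span {α})
    (hmu : IsUnit (m : ZMod u)) (hnu : IsUnit (n : ZMod t)) :
    IsCoprime 𝔟 (conjIdeal σ 𝔲 * 𝔱) := by
  set A : 𝓞 K := (Ideal.absNorm I : 𝓞 K) with hA
  have hA0 : A ≠ 0 := by
    rw [hA, Nat.cast_ne_zero, Ne, Ideal.absNorm_eq_zero_iff]; exact hI
  have hαc := integersConj_sub_mem hδ hI𝔲 hβ hα
  refine IsCoprime.mul_right ?_ ?_
  · have h1 : IsCoprime (Ideal.span {integersConj σ α}) 𝔲 := by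
      rw [← isUnit_ringEquiv_mk_iff S.e𝔲, ringEquiv_mk_eq_of_sub_mem S.e𝔲 hαc, map_mul, map_mul,
        map_intCast, map_intCast]
      refine hmu.mul ((isUnit_ringEquiv_mk_iff S.e𝔲 _).mpr ?_)
      rwa [Ideal.span_singleton_neg]
    have h2 := isCoprime_conjIdeal σ h1
    rw [conjIdeal_span, integersConj_integersConj, ← h𝔟] at h2
    exact (IsCoprime.mul_left_iff.mp h2).2
  · obtain ⟨x, hx, q, hq, hxq⟩ := Ideal.isCoprime_iff_exists.mp (IsCoprime.mul_right_iff.mp hcop).2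
    have h1 : α * x ∈ Ideal.span {A} * 𝔟 := by
      rw [← hnorm, mul_right_comm, h𝔟]
      exact Ideal.mul_mem_mul (Ideal.mem_span_singleton_self _) hx
    obtain ⟨y, hy, hAy⟩ := Ideal.mem_span_singleton_mul.mp h1
    have h2 : y - n * x ∈ 𝔱 := mem_of_mul_eq_mul hA0 hβ hnorm (m := (m : 𝓞 K)) hx (by linear_combination hAy + x * hα)
    have h3 : y - n ∈ 𝔱 := by
      have : y - n = (y - n * x) - n * q := by linear_combination (n : 𝓞 K) * hxq
      rw [this]
      exact 𝔱.sub_mem h2 (Ideal.mul_mem_left _ _ hq)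
    have h4 : IsCoprime (Ideal.span {y}) 𝔱 := by
      rw [← isUnit_ringEquiv_mk_iff S.e𝔱, ringEquiv_mk_eq_of_sub_mem S.e𝔱 h3, map_intCast,
        map_intCast]
      exact hnu
    exact IsCoprime.of_isCoprime_of_dvd_left h4
      (Ideal.dvd_iff_le.mpr ((Ideal.span_singleton_le_iff_mem _).mpr hy))

/-- `𝔟` may meet `ut` outside the conductor, so its value is found through a cofactor `𝔡` prime to
`ut` with `𝔟𝔡 = (γ)`, `γ ≡ 1`. From `Aγ = αη` one gets `nη ≡ γ ≡ 1` modulo `𝔱`. Taking norms gives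
`N(𝔡) conj(α) = η conj(γ)`, hence `η ≡ -N(𝔡) m δ` modulo `𝔲`. -/
theorem exists_cofactor {δ β : 𝓞 K}
    (hδ : β - integersConj σ β = δ) {I 𝔟 : Ideal (𝓞 K)}
    (hI : I ≠ ⊥) (hI𝔲 : I ≤ 𝔲) (hβ : β ∈ I * 𝔱)
    (hnorm : I * conjIdeal σ I = Ideal.span {(Ideal.absNorm I : 𝓞 K)})
    (hcop : IsCoprime (conjIdeal σ I) (𝔲 * 𝔱)) {m n : ℤ} {α : 𝓞 K} (hα0 : α ≠ 0)
    (hα : α = m * β + n * (Ideal.absNorm I : 𝓞 K)) (h𝔟 : I * 𝔟 = Ideal.span {α})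
    (h𝔟0 : 𝔟 ≠ ⊥) (hcop𝔟 : IsCoprime 𝔟 (conjIdeal σ 𝔲 * 𝔱)) :
    ∃ (γ η : 𝓞 K) (𝔡 : Ideal (𝓞 K)), γ ≠ 0 ∧ η ≠ 0 ∧ 𝔡 ≠ ⊥ ∧ γ - 1 ∈ conjIdeal σ 𝔲 * 𝔱 ∧
      𝔟 * 𝔡 = Ideal.span {γ} ∧ IsCoprime 𝔡 (Ideal.span {((u * t : ℕ) : 𝓞 K)}) ∧
      conjIdeal σ I * 𝔡 = Ideal.span {η} ∧ IsCoprime (Ideal.span {η}) (𝔲 * 𝔱) ∧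
      (Ideal.absNorm I : 𝓞 K) * γ = α * η ∧
      (n : ZMod t) * S.e𝔱 (Ideal.Quotient.mk 𝔱 η) = 1 ∧
      S.e𝔲 (Ideal.Quotient.mk 𝔲 η) =
        (Ideal.absNorm 𝔡 : ZMod u) * ((m : ZMod u) * S.e𝔲 (Ideal.Quotient.mk 𝔲 (-δ))) := by
  set A : 𝓞 K := (Ideal.absNorm I : 𝓞 K) with hA
  have hA0 : A ≠ 0 := by
    rw [hA, Nat.cast_ne_zero, Ne, Ideal.absNorm_eq_zero_iff]; exact hI
  have hαc := integersConj_sub_mem hδ hI𝔲 hβ hα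
  have hmod0 : conjIdeal σ 𝔲 * 𝔱 ≠ ⊥ := by
    intro h
    have h0 : ((u * t : ℕ) : 𝓞 K) ∈ conjIdeal σ 𝔲 * 𝔱 := by
      have h1 := S.span_le (Ideal.mem_span_singleton_self _)
      rw [Ideal.mul_eq_inf_of_isCoprime S.coprime_conj_left]
      exact Submodule.mem_inf.mpr ⟨(mem_conjIdeal σ).mpr (by
        rw [map_natCast]; exact Ideal.mul_le_left h1), Ideal.mul_le_right h1⟩
    rw [h] at h0
    exact span_natCast_mul_ne_bot (K := K) (u := u) (t := t)
      (le_bot_iff.mp ((Ideal.span_singleton_le_iff_mem _).mpr h0))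
  obtain ⟨γ, 𝔡, hγ0, h𝔡, hγ1, -, h𝔡N⟩ := Ideal.exists_mul_eq_span_singleton_sub_one_mem h𝔟0 hmod0
    (span_natCast_mul_ne_bot (K := K) (u := u) (t := t)) hcop𝔟
  have h𝔡0 : 𝔡 ≠ ⊥ := by
    rintro rfl
    rw [Ideal.mul_bot] at h𝔡
    exact hγ0 (Ideal.span_singleton_eq_bot.mp h𝔡.symm)
  have hspan : Ideal.span {A * γ} = Ideal.span {α} * (conjIdeal σ I * 𝔡) := by
    rw [← Ideal.span_singleton_mul_span_singleton, ← hnorm, ← h𝔡, ← h𝔟]; ring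
  obtain ⟨η, hη⟩ : α ∣ A * γ :=
    Ideal.span_singleton_le_span_singleton.mp (hspan ▸ Ideal.mul_le_left)
  have hη0 : η ≠ 0 := by
    rintro rfl
    exact mul_ne_zero hA0 hγ0 (by rw [hη, mul_zero])
  have hηspan : conjIdeal σ I * 𝔡 = Ideal.span {η} := by
    have hα' : Ideal.span {α} ≠ 0 := fun h => hα0 (Ideal.span_singleton_eq_bot.mp h)
    refine mul_left_cancel₀ hα' ?_
    rw [← hspan, hη, Ideal.span_singleton_mul_span_singleton]
  have h𝔡𝔑 : IsCoprime 𝔡 (𝔲 * 𝔱) := isCoprime_span_of_le h𝔡N S.span_le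
  have hηcop : IsCoprime (Ideal.span {η}) (𝔲 * 𝔱) := hηspan ▸ IsCoprime.mul_left hcop h𝔡𝔑
  have hηI : η ∈ conjIdeal σ I := by
    have : η ∈ conjIdeal σ I * 𝔡 := hηspan ▸ Ideal.mem_span_singleton_self η
    exact Ideal.mul_le_left this
  have hγ𝔱 : γ - 1 ∈ 𝔱 := Ideal.mul_le_right hγ1
  have hγ𝔲 : integersConj σ γ - 1 ∈ 𝔲 := by
    have := (mem_conjIdeal σ).mp (Ideal.mul_le_left hγ1)
    simpa using this
  -- the component at `𝔱`
  have ht : (n : ZMod t) * S.e𝔱 (Ideal.Quotient.mk 𝔱 η) = 1 := by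
    have h1 : γ - n * η ∈ 𝔱 := mem_of_mul_eq_mul hA0 hβ hnorm (m := (m : 𝓞 K)) hηI (by linear_combination hη + η * hα)
    have h2 : n * η - 1 ∈ 𝔱 := by
      have : n * η - 1 = (γ - 1) - (γ - n * η) := by ring
      rw [this]; exact 𝔱.sub_mem hγ𝔱 h1
    have h3 := ringEquiv_mk_eq_of_sub_mem S.e𝔱 h2
    simpa using h3
  -- the component at `𝔲`
  have hu : S.e𝔲 (Ideal.Quotient.mk 𝔲 η) =
      (Ideal.absNorm 𝔡 : ZMod u) * ((m : ZMod u) * S.e𝔲 (Ideal.Quotient.mk 𝔲 (-δ))) := by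
    have h1 : A * (Ideal.absNorm 𝔡 : 𝓞 K) = η * integersConj σ η := by
      rw [← coe_absNorm_span_singleton, ← hηspan, map_mul, absNorm_conjIdeal, Nat.cast_mul]
    have h2 : A * integersConj σ γ = integersConj σ α * integersConj σ η := by
      have := congrArg (integersConj σ) hη
      rwa [map_mul, map_mul, hA, map_natCast] at this
    have h3 : (Ideal.absNorm 𝔡 : 𝓞 K) * integersConj σ α = η * integersConj σ γ := by
      refine mul_left_cancel₀ hA0 ?_
      linear_combination integersConj σ α * h1 - η * h2
    have h4 : η - (Ideal.absNorm 𝔡 : 𝓞 K) * (m * (-δ)) ∈ 𝔲 := by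
      have : η - (Ideal.absNorm 𝔡 : 𝓞 K) * (m * (-δ)) =
          (Ideal.absNorm 𝔡 : 𝓞 K) * (integersConj σ α - m * (-δ)) -
            η * (integersConj σ γ - 1) := by linear_combination -h3
      rw [this]
      exact 𝔲.sub_mem (Ideal.mul_mem_left _ _ hαc) (Ideal.mul_mem_left _ _ hγ𝔲)
    rw [ringEquiv_mk_eq_of_sub_mem S.e𝔲 h4]
    simp
  exact ⟨γ, η, 𝔡, hγ0, hη0, h𝔡0, hγ1, h𝔡, h𝔡N, hηspan, hηcop, hη, ht, hu⟩

/-- With the cofactor `𝔡`, the value at `𝔟` is the infinity type of `γ` divided by `ψ₁(N 𝔡) χ(𝔡)⁻¹`,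
and `χ(𝔡)` is known from `conj(I)𝔡 = (η)`. The unknown `ψ₁(N 𝔡)` cancels against the one in `ψ₁(η)`.
-/
theorem toHom_of_mul_eq_span (hψ₁ : ψ₁.IsPrimitive) (hψ₂ : ψ₂.IsPrimitive) {δ β : 𝓞 K}
    (hδ : β - integersConj σ β = δ) (hδ𝔲 : IsCoprime (Ideal.span {δ}) 𝔲) {I 𝔟 : Ideal (𝓞 K)}
    (hI : I ≠ ⊥) (hI𝔲 : I ≤ 𝔲) (hβ : β ∈ I * 𝔱)
    (hnorm : I * conjIdeal σ I = Ideal.span {(Ideal.absNorm I : 𝓞 K)})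
    (hcop : IsCoprime (conjIdeal σ I) (𝔲 * 𝔱)) {m n : ℤ} {α : 𝓞 K} (hα0 : α ≠ 0)
    (hα : α = m * β + n * (Ideal.absNorm I : 𝓞 K)) (h𝔟 : I * 𝔟 = Ideal.span {α}) :
    ((ψ₁.heckeBaseChange σ).mul χ.inv).toHom 𝔟 =
      ψ₁ (S.e𝔲 (Ideal.Quotient.mk 𝔲 (-δ))) * (χ.toHom (conjIdeal σ I))⁻¹ *
        (ψ₁ m * (ψ₂ n)⁻¹) * (infinityType σ (0 + -a) (0 + -b) α *
          (infinityType σ (0 + -a) (0 + -b) (Ideal.absNorm I : 𝓞 K))⁻¹) := by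
  set ξ := (ψ₁.heckeBaseChange σ).mul χ.inv with hξ
  have hcond : ξ.conductor = conjIdeal σ 𝔲 * 𝔱 := S.conductor_eq hψ₁ hψ₂
  have hA0 : (Ideal.absNorm I : 𝓞 K) ≠ 0 := by
    rw [Nat.cast_ne_zero, Ne, Ideal.absNorm_eq_zero_iff]; exact hI
  have h𝔟0 : 𝔟 ≠ ⊥ := by
    rintro rfl
    rw [Ideal.mul_bot] at h𝔟
    exact hα0 (Ideal.span_singleton_eq_bot.mp h𝔟.symm)
  by_cases hcop𝔟 : IsCoprime 𝔟 (conjIdeal σ 𝔲 * 𝔱)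
  swap
  · have h0 : ξ.toHom 𝔟 = 0 := by
      by_contra h
      exact hcop𝔟 (hcond ▸ (ξ.isGroessencharakter.2.1 𝔟 h𝔟0).mp h)
    rw [h0]
    by_contra hne
    have hne' := Ne.symm hne
    have hψm : ψ₁ m ≠ 0 := fun h => hne' (by rw [h]; ring)
    have hψn : ψ₂ n ≠ 0 := fun h => hne' (by rw [h]; simp)
    have hmu : IsUnit (m : ZMod u) := by
      by_contra h; exact hψm (ψ₁.map_nonunit h)
    have hnu : IsUnit (n : ZMod t) := by
      by_contra h; exact hψn (ψ₂.map_nonunit h)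
    exact hcop𝔟 (S.isCoprime_of_isUnit hδ hδ𝔲 hI hI𝔲 hβ hnorm hcop hα h𝔟 hmu hnu)
  obtain ⟨γ, η, 𝔡, hγ0, hη0, h𝔡0, hγ1, h𝔡, h𝔡N, hηspan, hηcop, hη, ht, hu⟩ :=
    S.exists_cofactor hδ hI hI𝔲 hβ hnorm hcop hα0 hα h𝔟 h𝔟0 hcop𝔟
  have hξγ : ξ.toHom 𝔟 * ξ.toHom 𝔡 = infinityType σ (0 + -a) (0 + -b) γ := by
    rw [← map_mul, h𝔡]
    exact ξ.isGroessencharakter.2.2 γ hγ0 (hcond ▸ hγ1)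
  have hξ𝔡 : ξ.toHom 𝔡 = ψ₁ (Ideal.absNorm 𝔡 : ZMod u) * (χ.toHom 𝔡)⁻¹ := S.toHom_eq h𝔡0 h𝔡N
  have hξ𝔡0 : ξ.toHom 𝔡 ≠ 0 := ξ.toHom_ne_zero h𝔡0 (S.isCoprime_toHom_conductor h𝔡N)
  have hχη : χ.toHom (conjIdeal σ I) * χ.toHom 𝔡 = ψ₁ (S.e𝔲 (Ideal.Quotient.mk 𝔲 η)) *
      ψ₂ (S.e𝔱 (Ideal.Quotient.mk 𝔱 η)) * infinityType σ a b η := by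
    rw [← map_mul, hηspan]
    exact S.finiteType.toHom_span S.e S.e𝔲 S.e𝔱 hη0 hηcop
  have hχI : χ.toHom (conjIdeal σ I) ≠ 0 :=
    χ.toHom_ne_zero (conjIdeal_ne_bot σ hI) (S.isCoprime_conductor hcop)
  have hψn : ψ₂ n * ψ₂ (S.e𝔱 (Ideal.Quotient.mk 𝔱 η)) = 1 := by
    rw [← map_mul, ht, map_one]
  have hψη : ψ₂ (S.e𝔱 (Ideal.Quotient.mk 𝔱 η)) = (ψ₂ n)⁻¹ :=
    eq_inv_of_mul_eq_one_right hψn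
  have hinf := congrArg (infinityType σ (0 + -a) (0 + -b)) hη
  rw [infinityType_mul, infinityType_mul] at hinf
  have hinfη : infinityType σ (0 + -a) (0 + -b) η = (infinityType σ a b η)⁻¹ := by
    rw [zero_add, zero_add, infinityType_neg_neg]
  have hA1 := infinityType_ne_zero σ (0 + -a) (0 + -b) hA0
  have hη1 := infinityType_ne_zero σ a b hη0
  have hNd : ψ₁ (Ideal.absNorm 𝔡 : ZMod u) ≠ 0 := left_ne_zero_of_mul (hξ𝔡 ▸ hξ𝔡0)
  have hχ𝔡 : χ.toHom 𝔡 ≠ 0 := fun h0 => right_ne_zero_of_mul (hξ𝔡 ▸ hξ𝔡0) (by rw [h0, inv_zero])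
  rw [hu, map_mul, map_mul, hψη] at hχη
  rw [hinfη] at hinf
  refine mul_right_cancel₀ hξ𝔡0 ?_
  rw [hξγ, hξ𝔡]
  have e1 : infinityType σ (0 + -a) (0 + -b) γ = infinityType σ (0 + -a) (0 + -b) α *
      (infinityType σ a b η)⁻¹ * (infinityType σ (0 + -a) (0 + -b) (Ideal.absNorm I : 𝓞 K))⁻¹ := by
    rw [← hinf]; field_simp
  have e2 : χ.toHom 𝔡 = ψ₁ (Ideal.absNorm 𝔡 : ZMod u) * (ψ₁ m *
      ψ₁ (S.e𝔲 (Ideal.Quotient.mk 𝔲 (-δ)))) * (ψ₂ n)⁻¹ * infinityType σ a b η *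
      (χ.toHom (conjIdeal σ I))⁻¹ := by
    rw [← hχη]; field_simp
  have hr : (ψ₁ m * ψ₁ (S.e𝔲 (Ideal.Quotient.mk 𝔲 (-δ)))) * (ψ₂ n)⁻¹ ≠ 0 := by
    intro h
    apply hχ𝔡
    rw [e2]
    linear_combination (ψ₁ (Ideal.absNorm 𝔡 : ZMod u) * infinityType σ a b η *
      (χ.toHom (conjIdeal σ I))⁻¹) * h
  rw [e1, e2]
  have h1 := left_ne_zero_of_mul (left_ne_zero_of_mul hr)
  have h2 := right_ne_zero_of_mul (left_ne_zero_of_mul hr)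
  have h3 : ψ₂ n ≠ 0 := fun h0 => right_ne_zero_of_mul hr (by rw [h0, inv_zero])
  field_simp

end SplitFiniteType

end LatticeValue

/-! ### Sums over ideals as sums over lattices -/

/-- Meant for the map from nonzero lattice vectors to ideals, whose fibres are pairs of opposite
vectors. -/
theorem hasSum_div_two_of_fiber {P B : Type*} {Φ : P → B}
    (hΦ : ∀ b, ∃ p q, p ≠ q ∧ ∀ x, Φ x = b ↔ x = p ∨ x = q) {h : B → ℂ} {S : ℂ}
    (hS : HasSum (fun p => h (Φ p)) S) : HasSum h (S / 2) := by
  classical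
  have h1 := (Equiv.sigmaFiberEquiv Φ).hasSum_iff.mpr hS
  have h2 : ∀ b, HasSum (fun c : {x // Φ x = b} =>
      ((fun p => h (Φ p)) ∘ (Equiv.sigmaFiberEquiv Φ)) ⟨b, c⟩) (2 * h b) := by
    intro b
    obtain ⟨p, q, hpq, hx⟩ := hΦ b
    have hp : Φ p = b := (hx p).mpr (Or.inl rfl)
    have hq : Φ q = b := (hx q).mpr (Or.inr rfl)
    have huniv : ∀ c : {x // Φ x = b}, c ∉ ({⟨p, hp⟩, ⟨q, hq⟩} : Finset {x // Φ x = b}) →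
        h b = 0 := by
      intro c hc
      exfalso
      rcases (hx c.1).mp c.2 with h' | h'
      · exact hc (by simp [Subtype.ext_iff, h'])
      · exact hc (by simp [Subtype.ext_iff, h'])
    have h3 : (fun c : {x // Φ x = b} => ((fun p => h (Φ p)) ∘ (Equiv.sigmaFiberEquiv Φ)) ⟨b, c⟩) =
        fun _ => h b := by
      funext c
      simp [Equiv.sigmaFiberEquiv, c.2]
    rw [h3]
    have h4 := hasSum_sum_of_ne_finset_zero (L := SummationFilter.unconditional _) (f := fun _ : {x // Φ x = b} => h b) huniv
    rwa [Finset.sum_pair (by simpa [Subtype.ext_iff] using hpq), ← two_mul] at h4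
  have h5 := h1.sigma h2
  simpa [mul_div_cancel_left₀] using h5.div_const 2

section Lattices

variable {K : Type*} [Field K] [NumberField K]

/-- Representatives `I` of the ideal classes together with lattice bases: the ideals `𝔟 ≠ 0`
correspond to the pairs of opposite nonzero lattice vectors `α`, by `I 𝔟 = (α)`. -/
theorem hasSum_ideals_of_hasSum_lattices {I : ClassGroup (𝓞 K) → nonZeroDivisors (Ideal (𝓞 K))}
    (hI : Function.Bijective fun C => ClassGroup.mk0 (I C)) {β A : ClassGroup (𝓞 K) → 𝓞 K}
    (hmem : ∀ C x, x ∈ (I C : Ideal (𝓞 K)) ↔ ∃ m n : ℤ, x = m * β C + n * A C)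
    (hinj : ∀ C (m n m' n' : ℤ), (m * β C + n * A C : 𝓞 K) = m' * β C + n' * A C →
      m = m' ∧ n = n')
    (hunit : ∀ x : 𝓞 K, IsUnit x → x = 1 ∨ x = -1) {h : Ideal (𝓞 K) → ℂ} (h0 : h ⊥ = 0)
    {g : ClassGroup (𝓞 K) → ℤ × ℤ → ℂ} (hg0 : ∀ C, g C 0 = 0)
    (hg : ∀ C (v : ℤ × ℤ) (𝔟 : Ideal (𝓞 K)), v ≠ 0 →
      (I C : Ideal (𝓞 K)) * 𝔟 = Ideal.span {v.1 * β C + v.2 * A C} → g C v = h 𝔟) {S : ℂ}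
    (hS : HasSum (fun p : ClassGroup (𝓞 K) × (ℤ × ℤ) => g p.1 p.2) S) : HasSum h (S / 2) := by
  classical
  set α : ClassGroup (𝓞 K) × (ℤ × ℤ) → 𝓞 K := fun p => p.2.1 * β p.1 + p.2.2 * A p.1 with hα
  have hα0 : ∀ p, p.2 ≠ 0 → α p ≠ 0 := by
    intro p hp h
    obtain ⟨h1, h2⟩ := hinj p.1 p.2.1 p.2.2 0 0 (by simpa [hα] using h)
    exact hp (Prod.ext h1 h2)
  have hI0 : ∀ C, (I C : Ideal (𝓞 K)) ≠ ⊥ := fun C => mem_nonZeroDivisors_iff_ne_zero.mp (I C).2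
  have hex : ∀ p : {p : ClassGroup (𝓞 K) × (ℤ × ℤ) // p.2 ≠ 0}, ∃ 𝔟 : {𝔟 : Ideal (𝓞 K) // 𝔟 ≠ ⊥},
      (I p.1.1 : Ideal (𝓞 K)) * 𝔟 = Ideal.span {α p.1} := by
    intro p
    obtain ⟨𝔟, h𝔟⟩ : (I p.1.1 : Ideal (𝓞 K)) ∣ Ideal.span {α p.1} := by
      rw [Ideal.dvd_iff_le, Ideal.span_singleton_le_iff_mem, hmem]
      exact ⟨_, _, rfl⟩
    refine ⟨⟨𝔟, ?_⟩, h𝔟.symm⟩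
    rintro rfl
    rw [Ideal.mul_bot] at h𝔟
    exact hα0 _ p.2 (Ideal.span_singleton_eq_bot.mp h𝔟)
  choose Φ hΦ using hex
  have hfib : ∀ b, ∃ p q, p ≠ q ∧ ∀ x, Φ x = b ↔ x = p ∨ x = q := by
    intro b
    have hb : b.1 ∈ nonZeroDivisors (Ideal (𝓞 K)) := mem_nonZeroDivisors_iff_ne_zero.mpr b.2
    -- Only the representative in the class inverse to that of `𝔟` makes `I 𝔟` principal, and its
    -- generator is determined up to the units `±1`: exactly two preimages.
    obtain ⟨C, hC⟩ := hI.2 (ClassGroup.mk0 ⟨b.1, hb⟩)⁻¹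
    have hprin : ∀ C', Submodule.IsPrincipal ((I C' : Ideal (𝓞 K)) * b.1) ↔ C' = C := by
      intro C'
      have h1 := ClassGroup.mk0_eq_one_iff (I := (I C' : Ideal (𝓞 K)) * b.1)
        (mul_mem (I C').2 hb)
      rw [← h1]
      have h2 : ClassGroup.mk0 ⟨(I C' : Ideal (𝓞 K)) * b.1, mul_mem (I C').2 hb⟩ =
          ClassGroup.mk0 (I C') * ClassGroup.mk0 ⟨b.1, hb⟩ := by
        rw [← map_mul]; rfl
      rw [h2, mul_eq_one_iff_eq_inv, ← hC]
      exact hI.1.eq_iff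
    obtain ⟨x, hx⟩ := ((hprin C).mpr rfl).principal
    have hxI : x ∈ (I C : Ideal (𝓞 K)) := by
      have : x ∈ (I C : Ideal (𝓞 K)) * b.1 := by rw [hx]; exact Ideal.mem_span_singleton_self x
      exact Ideal.mul_le_left this
    obtain ⟨m, n, hmn⟩ := (hmem C x).mp hxI
    have hx0 : x ≠ 0 := by
      rintro rfl
      have : (I C : Ideal (𝓞 K)) * b.1 = ⊥ := by rw [hx]; simp
      exact mul_ne_zero (hI0 C) b.2 this
    have hv0 : ((m, n) : ℤ × ℤ) ≠ 0 := by
      intro h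
      rw [Prod.mk_eq_zero] at h
      exact hx0 (by rw [hmn, h.1, h.2]; simp)
    have hv0' : ((-m, -n) : ℤ × ℤ) ≠ 0 := fun h => hv0 (by
      rw [Prod.mk_eq_zero] at h ⊢
      exact ⟨neg_eq_zero.mp h.1, neg_eq_zero.mp h.2⟩)
    refine ⟨⟨(C, (m, n)), hv0⟩, ⟨(C, (-m, -n)), hv0'⟩, fun h => hv0 ?_, fun y => ?_⟩
    · have h' := congrArg (fun p => p.1.2) h
      simp only [Prod.mk.injEq] at h'
      exact Prod.ext (by simpa using self_eq_neg.mp h'.1) (by simpa using self_eq_neg.mp h'.2)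
    · have hΦy : Φ y = b ↔ (I y.1.1 : Ideal (𝓞 K)) * b.1 = Ideal.span {α y.1} := by
        constructor
        · rintro rfl; exact hΦ y
        · intro h
          exact Subtype.ext (mul_left_cancel₀ (hI0 y.1.1) ((hΦ y).trans h.symm))
      rw [hΦy]
      constructor
      · intro h
        obtain ⟨⟨C', v⟩, hv⟩ := y
        have hC' : C' = C := (hprin C').mp ⟨⟨α (C', v), h⟩⟩
        subst hC'
        have h2 : Ideal.span {x} = Ideal.span {α (C', v)} := hx.symm.trans h
        obtain ⟨w, hw⟩ := Ideal.span_singleton_eq_span_singleton.mp h2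
        rcases hunit _ w.isUnit with h3 | h3
        · left
          rw [h3, mul_one, hmn] at hw
          obtain ⟨e1, e2⟩ := hinj _ _ _ _ _ hw
          exact Subtype.ext (Prod.ext rfl (Prod.ext e1.symm e2.symm))
        · right
          rw [h3, hmn] at hw
          obtain ⟨e1, e2⟩ := hinj C' (-m) (-n) v.1 v.2 (by push_cast; linear_combination hw)
          exact Subtype.ext (Prod.ext rfl (Prod.ext e1.symm e2.symm))
      · rintro (rfl | rfl)
        · rw [hx, hmn]
        · have : α (C, (-m, -n)) = -x := by rw [hmn]; simp only [hα]; push_cast; ring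
          rw [hx]
          change _ = Ideal.span {α (C, (-m, -n))}
          rw [this, Ideal.span_singleton_neg]
  have hS' : HasSum (fun p : {p : ClassGroup (𝓞 K) × (ℤ × ℤ) // p.2 ≠ 0} => h (Φ p).1) S := by
    have h1 := (hasSum_subtype_iff_of_support_subset
      (f := fun p : ClassGroup (𝓞 K) × (ℤ × ℤ) => g p.1 p.2) (s := {p | p.2 ≠ 0}) (by
        intro p hp hp0
        exact hp (by simp only; rw [hp0, hg0]))).mpr hS
    convert! h1 using 1
    funext p
    exact (hg p.1.1 p.1.2 _ p.2 (hΦ p)).symm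
  have h2 := hasSum_div_two_of_fiber (h := fun b : {𝔟 : Ideal (𝓞 K) // 𝔟 ≠ ⊥} => h b.1) hfib hS'
  refine (hasSum_subtype_iff_of_support_subset (s := {𝔟 : Ideal (𝓞 K) | 𝔟 ≠ ⊥}) ?_).mp h2
  intro 𝔟 h𝔟 h𝔟0
  exact h𝔟 (by rw [h𝔟0, h0])

end Lattices

/-! ### Ideals with a CM point -/

section CM

variable {K : Type*} [Field K] [NumberField K] [Algebra.IsQuadraticExtension ℚ K]
  {σ : K →+* ℂ} {δ β : 𝓞 K} {b : ℤ}

theorem integersConj_eq_neg (hδim : 0 < (σ δ).im) {D : ℤ} (hδ : δ ^ 2 = (D : 𝓞 K)) :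
    integersConj σ δ = -δ := by
  have h : integersConj σ δ ^ 2 = δ ^ 2 := by rw [← map_pow, hδ, map_intCast]
  rcases sq_eq_sq_iff_eq_or_eq_neg.mp h with h | h
  · exfalso
    have h1 := embedding_integersConj σ δ
    rw [h] at h1
    have h2 := congrArg Complex.im h1
    rw [Complex.conj_im] at h2
    linarith
  · exact h

theorem sub_integersConj_eq (hδim : 0 < (σ δ).im) {D : ℤ} (hδ : δ ^ 2 = (D : 𝓞 K))
    (hβ : 2 * β = (b : 𝓞 K) + δ) : β - integersConj σ β = δ := by
  have h := congrArg (integersConj σ) hβ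
  rw [map_mul, map_add, map_intCast, integersConj_eq_neg hδim hδ, map_ofNat] at h
  exact mul_left_cancel₀ (two_ne_zero (α := 𝓞 K)) (by linear_combination hβ - h)

/-- The norm of `β` is an integer in `I`, hence a multiple of `A`, so products of basis elements lie
in `(A)`. Both ideals have norm `A²`, and inclusion becomes equality. -/
theorem mul_conjIdeal_eq [IsTotallyComplex K] {I : Ideal (𝓞 K)} (hI : I ≠ ⊥)
    (hcyc : ∀ x : 𝓞 K, ∃ n : ℤ, x - n ∈ I)
    (hmem : ∀ x : 𝓞 K, x ∈ I ↔ ∃ m n : ℤ, x = m * β + n * (Ideal.absNorm I : 𝓞 K)) :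
    I * conjIdeal σ I = Ideal.span {(Ideal.absNorm I : 𝓞 K)} := by
  set A := Ideal.absNorm I with hA
  have hβ : β ∈ I := (hmem β).mpr ⟨1, 0, by simp⟩
  have hA0 : A ≠ 0 := by rw [hA, Ne, Ideal.absNorm_eq_zero_iff]; exact hI
  obtain ⟨r, hr⟩ : ∃ r : ℤ, β * integersConj σ β = r * (A : 𝓞 K) := by
    have h1 : ((Ideal.absNorm (Ideal.span {β}) : ℤ) : 𝓞 K) ∈ I := by
      rw [Int.cast_natCast, coe_absNorm_span_singleton σ]
      exact Ideal.mul_mem_right _ _ hβ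
    obtain ⟨r, hr⟩ := (intCast_mem_iff_of_cyclic hcyc _).mp h1
    refine ⟨r, ?_⟩
    rw [← coe_absNorm_span_singleton]
    have := congrArg (Int.cast : ℤ → 𝓞 K) hr
    push_cast at this
    rw [this, mul_comm]
  have hle : I * conjIdeal σ I ≤ Ideal.span {(A : 𝓞 K)} := by
    rw [Ideal.mul_le]
    intro x hx y hy
    rw [mem_conjIdeal] at hy
    obtain ⟨m, n, rfl⟩ := (hmem x).mp hx
    obtain ⟨m', n', hy'⟩ := (hmem _).mp hy
    have hy2 : y = m' * integersConj σ β + n' * (A : 𝓞 K) := by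
      rw [← integersConj_integersConj σ y, hy']; simp
    refine Ideal.mem_span_singleton'.mpr
      ⟨m * m' * r + m * n' * β + n * m' * integersConj σ β + n * n' * A, ?_⟩
    rw [hy2]
    linear_combination (-(m * m' : 𝓞 K)) * hr
  obtain ⟨X, hX⟩ := Ideal.dvd_iff_le.mpr hle
  have hAA : Ideal.absNorm (Ideal.span {(A : 𝓞 K)}) = A * A := by
    have := coe_absNorm_span_singleton σ (A : 𝓞 K)
    rw [map_natCast] at this
    exact_mod_cast this
  have hX1 : Ideal.absNorm X = 1 := by
    have h := congrArg Ideal.absNorm hX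
    rw [map_mul, map_mul, absNorm_conjIdeal, ← hA, hAA] at h
    exact (Nat.eq_of_mul_eq_mul_left (Nat.pos_of_ne_zero (mul_ne_zero hA0 hA0))
      (by rw [mul_one]; exact h)).symm
  rw [hX, Ideal.absNorm_eq_one_iff.mp hX1, Ideal.mul_top]

omit [Algebra.IsQuadraticExtension ℚ K] in
theorem isCoprime_span_delta (hδim : 0 < (σ δ).im) (hβ : 2 * β = (b : 𝓞 K) + δ)
    (hspan : ∀ x : 𝓞 K, ∃ p q : ℤ, x = p + q * β) {D : ℤ} (hodd : Odd D)
    (hδ : δ ^ 2 = (D : 𝓞 K)) {N : ℕ} (hN : N ≠ 0)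
    (hsplit : ∀ ℓ : ℕ, ℓ.Prime → ℓ ∣ N → ∃ v w : Ideal (𝓞 K),
      v.IsPrime ∧ w.IsPrime ∧ v ≠ w ∧ Ideal.span {(ℓ : 𝓞 K)} = v * w) :
    IsCoprime (Ideal.span {δ}) (Ideal.span {(N : 𝓞 K)}) := by
  rw [Ideal.isCoprime_iff_sup_eq]
  by_contra hne
  obtain ⟨p, hp, hle⟩ := Ideal.exists_le_maximal _ hne
  have hδp : δ ∈ p := hle (Ideal.mem_sup_left (Ideal.mem_span_singleton_self _))
  have hNp : (N : 𝓞 K) ∈ p := hle (Ideal.mem_sup_right (Ideal.mem_span_singleton_self _))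
  have hprime := hp.isPrime
  obtain ⟨ℓ, hℓ, hℓN, hℓp⟩ : ∃ ℓ : ℕ, ℓ.Prime ∧ ℓ ∣ N ∧ (ℓ : 𝓞 K) ∈ p := by
    have h1 : ∏ ℓ ∈ N.primeFactors, (ℓ : 𝓞 K) ^ N.factorization ℓ ∈ p := by
      have h2 := congrArg (Nat.cast : ℕ → 𝓞 K) (Nat.prod_factorization_pow_eq_self hN)
      rw [Nat.prod_factorization_eq_prod_primeFactors] at h2
      push_cast at h2
      rw [h2]; exact hNp
    obtain ⟨ℓ, hℓ, hℓp⟩ := (hprime.prod_mem_iff).mp h1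
    exact ⟨ℓ, Nat.prime_of_mem_primeFactors hℓ, Nat.dvd_of_mem_primeFactors hℓ,
      hprime.mem_of_pow_mem _ hℓp⟩
  obtain ⟨v, w, hv, hw, hvw, hspl⟩ := hsplit ℓ hℓ hℓN
  exact notMem_of_split hδim hβ hspan hodd hδ hℓ hv hw hvw hspl hprime hℓp hδp

/-- The sum of `I` and its conjugate contains `β - conj(β) = δ` and `N`, which are coprime. -/
theorem isCoprime_conjIdeal_self {I : Ideal (𝓞 K)} (hβ : β - integersConj σ β = δ) (hβI : β ∈ I)
    {N : 𝓞 K} (hN : N ∈ I) (hδ : IsCoprime (Ideal.span {δ}) (Ideal.span {N})) :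
    IsCoprime (conjIdeal σ I) I := by
  rw [Ideal.isCoprime_iff_sup_eq] at hδ ⊢
  rw [eq_top_iff, ← hδ]
  refine sup_le ?_ ?_ <;> rw [Ideal.span_singleton_le_iff_mem]
  · rw [← hβ]
    exact Ideal.sub_mem _ (Ideal.mem_sup_right hβI)
      (Ideal.mem_sup_left ((mem_conjIdeal σ).mpr (by simpa using hβI)))
  · exact Ideal.mem_sup_right hN

end CM

/-! ### The Maass–Shimura operators -/

section MaassShimura

/-- `f` is real differentiable at `τ` with Wirtinger derivative `w`. -/
def HasWirtingerAt (f : ℂ → ℂ) (w τ : ℂ) : Prop :=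
  ∃ f' : ℂ →L[ℝ] ℂ, HasFDerivAt f f' τ ∧ (f' 1 - I * f' I) / 2 = w

theorem HasWirtingerAt.wirtinger_eq {f : ℂ → ℂ} {w τ : ℂ} (h : HasWirtingerAt f w τ) :
    wirtinger f τ = w := by
  obtain ⟨f', hf, rfl⟩ := h
  rw [wirtinger, hf.fderiv]

theorem HasWirtingerAt.congr {f g : ℂ → ℂ} {w τ : ℂ} (h : HasWirtingerAt f w τ)
    (hfg : g =ᶠ[nhds τ] f) : HasWirtingerAt g w τ := by
  obtain ⟨f', hf, rfl⟩ := h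
  exact ⟨f', hf.congr_of_eventuallyEq hfg, rfl⟩

theorem HasDerivAt.hasWirtingerAt {f : ℂ → ℂ} {w τ : ℂ} (h : HasDerivAt f w τ) :
    HasWirtingerAt f w τ := by
  refine ⟨_, h.hasFDerivAt.restrictScalars ℝ, ?_⟩
  simp
  linear_combination (-w / 2) * I_sq

theorem HasWirtingerAt.mul {f g : ℂ → ℂ} {w v τ : ℂ} (hf : HasWirtingerAt f w τ)
    (hg : HasWirtingerAt g v τ) : HasWirtingerAt (fun z => f z * g z) (w * g τ + f τ * v) τ := by
  obtain ⟨f', hf, rfl⟩ := hf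
  obtain ⟨g', hg, rfl⟩ := hg
  refine ⟨_, hf.mul hg, ?_⟩
  simp
  ring

theorem HasWirtingerAt.const_mul {f : ℂ → ℂ} {w τ : ℂ} (hf : HasWirtingerAt f w τ) (c : ℂ) :
    HasWirtingerAt (fun z => c * f z) (c * w) τ := by
  simpa using (hasDerivAt_const τ c).hasWirtingerAt.mul hf

theorem HasWirtingerAt.sum {ι : Type*} {s : Finset ι} {f : ι → ℂ → ℂ} {w : ι → ℂ} {τ : ℂ}
    (h : ∀ i ∈ s, HasWirtingerAt (f i) (w i) τ) :
    HasWirtingerAt (fun z => ∑ i ∈ s, f i z) (∑ i ∈ s, w i) τ := by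
  choose! f' hf hw using h
  refine ⟨_, HasFDerivAt.fun_sum hf, ?_⟩
  rw [← Finset.sum_congr rfl hw, _root_.sum_apply, _root_.sum_apply,
    Finset.mul_sum, ← Finset.sum_sub_distrib, Finset.sum_div]

theorem HasWirtingerAt.zpow {f : ℂ → ℂ} {w τ : ℂ} (hf : HasWirtingerAt f w τ) (h0 : f τ ≠ 0)
    (n : ℤ) : HasWirtingerAt (fun z => f z ^ n) (n * f τ ^ (n - 1) * w) τ := by
  obtain ⟨f', hf, rfl⟩ := hf
  refine ⟨_, (hasDerivAt_zpow n (f τ) (Or.inl h0)).comp_hasFDerivAt τ hf, ?_⟩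
  simp
  ring

theorem hasWirtingerAt_conj (τ : ℂ) : HasWirtingerAt (fun z => (starRingEnd ℂ) z) 0 τ := by
  refine ⟨conjCLE.toContinuousLinearMap, conjCLE.toContinuousLinearMap.hasFDerivAt, ?_⟩
  simp

theorem HasWirtingerAt.sub {f g : ℂ → ℂ} {w v τ : ℂ} (hf : HasWirtingerAt f w τ)
    (hg : HasWirtingerAt g v τ) : HasWirtingerAt (fun z => f z - g z) (w - v) τ := by
  obtain ⟨f', hf, rfl⟩ := hf
  obtain ⟨g', hg, rfl⟩ := hg
  refine ⟨_, hf.sub hg, ?_⟩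
  simp
  ring

theorem hasWirtingerAt_sub_conj (τ : ℂ) :
    HasWirtingerAt (fun z => z - (starRingEnd ℂ) z) 1 τ := by
  simpa using (hasDerivAt_id τ).hasWirtingerAt.sub (hasWirtingerAt_conj τ)

theorem sub_conj_ne_zero {τ : ℂ} (hτ : 0 < τ.im) : τ - (starRingEnd ℂ) τ ≠ 0 := by
  intro h
  have := congrArg Complex.im h
  simp at this
  linarith

theorem eventually_im_pos {τ : ℂ} (hτ : 0 < τ.im) : ∀ᶠ z in nhds τ, 0 < z.im :=
  (isOpen_lt continuous_const continuous_im).mem_nhds hτ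

/-- If `f` agrees with `∂_k^j F` on the upper half-plane then its image under `∂_{k+2j}` agrees with
`∂_k^{j+1} F`. -/
theorem maassShimuraIter_succ_eq {k j : ℕ} {F f : ℂ → ℂ}
    (h : ∀ z : ℂ, 0 < z.im → maassShimuraIter k j F z = f z) {τ w : ℂ} (hτ : 0 < τ.im)
    (hf : HasWirtingerAt f w τ) :
    maassShimuraIter k (j + 1) F τ =
      1 / (2 * Real.pi * I) * (w + (k + 2 * j) / (τ - (starRingEnd ℂ) τ) * f τ) := by
  have h1 : maassShimuraIter k j F =ᶠ[nhds τ] f := (eventually_im_pos hτ).mono h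
  rw [maassShimuraIter, maassShimura, (hf.congr h1).wirtinger_eq, h τ hτ]
  push_cast
  rfl

/-- The coefficients of `∂_k^j` on holomorphic functions. -/
noncomputable def maassShimuraCoeff (k : ℕ) : ℕ → ℕ → ℂ
  | 0, i => if i = 0 then 1 else 0
  | j + 1, i => 1 / (2 * Real.pi * I) * ((k + j + i) * maassShimuraCoeff k j i +
      if i = 0 then 0 else maassShimuraCoeff k j (i - 1))

theorem maassShimuraCoeff_eq_zero (k : ℕ) {j i : ℕ} (h : j < i) : maassShimuraCoeff k j i = 0 := by
  induction j generalizing i with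
  | zero => simp [maassShimuraCoeff, Nat.pos_iff_ne_zero.mp h]
  | succ j ih =>
    rw [maassShimuraCoeff, ih (by omega), if_neg (by omega), ih (by omega)]
    simp

/-- On holomorphic functions `∂^j` is a combination of derivatives and powers of `τ - τ̄` with
coefficients that do not depend on the function. An identity found for `(pτ + q)^(-k)` thus
transfers to sums of such functions. -/
theorem maassShimuraIter_eq_sum (k : ℕ) {g : ℕ → ℂ → ℂ}
    (hg : ∀ i (z : ℂ), 0 < z.im → HasDerivAt (g i) (g (i + 1) z) z) (j : ℕ) {τ : ℂ}
    (hτ : 0 < τ.im) : maassShimuraIter k j (g 0) τ = ∑ i ∈ Finset.range (j + 1),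
      maassShimuraCoeff k j i * ((τ - (starRingEnd ℂ) τ) ^ ((i : ℤ) - j) * g i τ) := by
  induction j generalizing τ with
  | zero => simp [maassShimuraIter, maassShimuraCoeff]
  | succ j ih =>
    have hy := sub_conj_ne_zero hτ
    set y := τ - (starRingEnd ℂ) τ with hydef
    have hW := HasWirtingerAt.sum (s := Finset.range (j + 1))
      (f := fun i z => maassShimuraCoeff k j i *
        ((z - (starRingEnd ℂ) z) ^ ((i : ℤ) - j) * g i z)) (τ := τ) (fun i _ =>
        (((hasWirtingerAt_sub_conj τ).zpow hy _).mul (hg i τ hτ).hasWirtingerAt).const_mul _)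
    rw [maassShimuraIter_succ_eq (fun z hz => ih hz) hτ hW]
    simp only [maassShimuraCoeff, ← hydef]
    rw [Finset.mul_sum, ← Finset.sum_add_distrib, Finset.mul_sum]
    -- The two terms of the recursion are separated: in the first the top coefficient vanishes, the
    -- second is shifted by one index.
    have h1 : ∑ i ∈ Finset.range (j + 1 + 1), 1 / (2 * Real.pi * I) *
        ((k + j + i) * maassShimuraCoeff k j i +
          if i = 0 then 0 else maassShimuraCoeff k j (i - 1)) *
        (y ^ ((i : ℤ) - (j + 1 : ℕ)) * g i τ) =
        ∑ i ∈ Finset.range (j + 1), (1 / (2 * Real.pi * I) * ((k + j + i) * maassShimuraCoeff k j i *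
          (y ^ ((i : ℤ) - (j + 1 : ℕ)) * g i τ))) +
        ∑ i ∈ Finset.range (j + 1), (1 / (2 * Real.pi * I) * (maassShimuraCoeff k j i *
          (y ^ ((i : ℤ) - j) * g (i + 1) τ))) := by
      have h2 : ∑ i ∈ Finset.range (j + 1 + 1), (1 / (2 * Real.pi * I) *
          ((k + j + i) * maassShimuraCoeff k j i * (y ^ ((i : ℤ) - (j + 1 : ℕ)) * g i τ))) =
          ∑ i ∈ Finset.range (j + 1), (1 / (2 * Real.pi * I) * ((k + j + i) *
            maassShimuraCoeff k j i * (y ^ ((i : ℤ) - (j + 1 : ℕ)) * g i τ))) := by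
        rw [Finset.sum_range_succ, maassShimuraCoeff_eq_zero k (Nat.lt_succ_self j)]
        simp
      have h3 : ∑ i ∈ Finset.range (j + 1 + 1), (1 / (2 * Real.pi * I) *
          ((if i = 0 then 0 else maassShimuraCoeff k j (i - 1)) *
            (y ^ ((i : ℤ) - (j + 1 : ℕ)) * g i τ))) =
          ∑ i ∈ Finset.range (j + 1), (1 / (2 * Real.pi * I) * (maassShimuraCoeff k j i *
          (y ^ ((i : ℤ) - j) * g (i + 1) τ))) := by
        rw [Finset.sum_range_succ']
        simp
      rw [← h2, ← h3, ← Finset.sum_add_distrib]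
      exact Finset.sum_congr rfl fun i _ => by ring
    rw [h1, ← Finset.sum_add_distrib]
    refine Finset.sum_congr rfl fun i _ => ?_
    have e1 : y ^ ((i : ℤ) - (j + 1 : ℕ)) = y ^ ((i : ℤ) - j) / y := by
      rw [div_eq_mul_inv, ← zpow_sub_one₀ hy]; congr 1; push_cast; ring
    have e2 : y ^ ((i : ℤ) - j - 1) = y ^ ((i : ℤ) - j) / y := by
      rw [zpow_sub_one₀ hy, div_eq_mul_inv]
    rw [e1, e2]
    push_cast
    field_simp
    ring

/-- The action of `∂_k^j` on `(p τ + q)^{-k}`. -/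
theorem maassShimuraIter_inv_pow (k j : ℕ) {p q : ℝ} (hpq : ∀ z : ℂ, 0 < z.im → p * z + q ≠ 0)
    {τ : ℂ} (hτ : 0 < τ.im) :
    maassShimuraIter k j (fun z => (p * z + q) ^ (-(k : ℤ))) τ =
      k.ascFactorial j / (2 * Real.pi * I) ^ j * ((τ - (starRingEnd ℂ) τ) ^ (-(j : ℤ)) *
        ((p * τ + q) ^ (-((k : ℤ) + j)) * (p * (starRingEnd ℂ) τ + q) ^ j)) := by
  induction j generalizing τ with
  | zero => simp [maassShimuraIter]
  | succ j ih =>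
    have hy := sub_conj_ne_zero hτ
    have hW0 := hpq τ hτ
    have hd : HasDerivAt (fun z : ℂ => p * z + q) p τ := by
      simpa using ((hasDerivAt_id τ).const_mul (p : ℂ)).add_const (q : ℂ)
    have hc : HasWirtingerAt (fun z : ℂ => (p * (starRingEnd ℂ) z + q) ^ j) 0 τ := by
      obtain ⟨f', hf, hw⟩ := hasWirtingerAt_conj τ
      have h1 : HasDerivAt (fun w : ℂ => (p * w + q) ^ j)
          (j * (p * (starRingEnd ℂ) τ + q) ^ (j - 1) * p) ((starRingEnd ℂ) τ) := by
        have h2 : HasDerivAt (fun z : ℂ => p * z + q) p ((starRingEnd ℂ) τ) := by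
          simpa using ((hasDerivAt_id ((starRingEnd ℂ) τ)).const_mul (p : ℂ)).add_const (q : ℂ)
        exact h2.fun_pow j
      refine ⟨_, h1.comp_hasFDerivAt τ hf, ?_⟩
      simp only [_root_.smul_apply, smul_eq_mul]
      linear_combination (j * (p * (starRingEnd ℂ) τ + q) ^ (j - 1) * p) * hw
    have hW := (((hasWirtingerAt_sub_conj τ).zpow hy (-(j : ℤ))).mul
      ((hd.hasWirtingerAt.zpow hW0 (-((k : ℤ) + j))).mul hc)).const_mul
        (k.ascFactorial j / (2 * Real.pi * I) ^ j)
    rw [maassShimuraIter_succ_eq (fun z hz => ih hz) hτ hW, Nat.ascFactorial_succ]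
    set y := τ - (starRingEnd ℂ) τ with hydef
    -- Eliminating `τ̄` through `pτ̄ + q = W - p y` leaves an algebraic identity in `W` and `y`.
    have hcj : (p * (starRingEnd ℂ) τ + q : ℂ) = (p * τ + q) - p * y := by rw [hydef]; ring
    rw [hcj]
    set W := (p * τ + q : ℂ) with hWdef
    have e1 : y ^ (-(j : ℤ) - 1) = y ^ (-(j : ℤ)) / y := by
      rw [zpow_sub_one₀ hy, div_eq_mul_inv]
    have e2 : y ^ (-((j + 1 : ℕ) : ℤ)) = y ^ (-(j : ℤ)) / y := by
      rw [div_eq_mul_inv, ← zpow_sub_one₀ hy]; congr 1; push_cast; ring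
    have e3 : W ^ (-((k : ℤ) + j) - 1) = W ^ (-((k : ℤ) + j)) / W := by
      rw [zpow_sub_one₀ hW0, div_eq_mul_inv]
    have e4 : W ^ (-((k : ℤ) + (j + 1 : ℕ))) = W ^ (-((k : ℤ) + j)) / W := by
      rw [div_eq_mul_inv, ← zpow_sub_one₀ hW0]; congr 1; push_cast; ring
    rw [e1, e2, e3, e4]
    have hpi : (2 * Real.pi * I : ℂ) ≠ 0 := two_pi_I_ne_zero
    push_cast
    field_simp
    ring

/-- The `i`-th derivative of `(p τ + q)^{-k}`. -/
theorem hasDerivAt_inv_pow_iter (k i : ℕ) {p q : ℝ} {τ : ℂ} (hτ : p * τ + q ≠ 0) :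
    HasDerivAt (fun z : ℂ => (-p : ℂ) ^ i * k.ascFactorial i * (p * z + q) ^ (-((k : ℤ) + i)))
      ((-p : ℂ) ^ (i + 1) * k.ascFactorial (i + 1) *
        (p * τ + q) ^ (-((k : ℤ) + (i + 1 : ℕ)))) τ := by
  have hd : HasDerivAt (fun z : ℂ => p * z + q) p τ := by
    simpa using ((hasDerivAt_id τ).const_mul (p : ℂ)).add_const (q : ℂ)
  have h := ((hasDerivAt_zpow (-((k : ℤ) + i)) _ (Or.inl hτ)).comp τ hd).const_mul
    ((-p : ℂ) ^ i * k.ascFactorial i)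
  convert! h using 1
  have e : -((k : ℤ) + (i + 1 : ℕ)) = -((k : ℤ) + i) - 1 := by push_cast; ring
  rw [e, Nat.ascFactorial_succ]
  push_cast
  ring

/-- Compute `∂^j (pτ + q)^(-k)` in two ways: by the general expansion in derivatives and in closed
form. -/
theorem sum_maassShimuraCoeff_mul_inv_pow {k : ℕ} (hk : 0 < k) (j : ℕ) (p q : ℤ) {τ : ℂ}
    (hτ : 0 < τ.im) :
    ∑ i ∈ Finset.range (j + 1), maassShimuraCoeff k j i * ((τ - (starRingEnd ℂ) τ) ^ ((i : ℤ) - j) *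
      ((-p : ℂ) ^ i * k.ascFactorial i * (p * τ + q) ^ (-((k : ℤ) + i)))) =
      k.ascFactorial j / (2 * Real.pi * I) ^ j * ((τ - (starRingEnd ℂ) τ) ^ (-(j : ℤ)) *
        ((p * τ + q) ^ (-((k : ℤ) + j)) * (p * (starRingEnd ℂ) τ + q) ^ j)) := by
  -- The zero lattice vector is harmless: a negative power of `0` is `0`, so both sides vanish.
  by_cases hpq : p = 0 ∧ q = 0
  · obtain ⟨rfl, rfl⟩ := hpq
    have h : ∀ i : ℕ, ((((0 : ℤ) : ℂ) * τ + ((0 : ℤ) : ℂ)) ^ (-((k : ℤ) + i))) = 0 := fun i => by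
      simp only [Int.cast_zero, zero_mul, add_zero]
      exact zero_zpow _ (by omega)
    simp only [h]
    simp
  · have hne : ∀ z : ℂ, 0 < z.im → (((p : ℝ) : ℂ) * z + ((q : ℝ) : ℂ)) ≠ 0 := by
      intro z hz h
      have him := congrArg Complex.im h
      simp [hz.ne'] at him
      subst him
      simp at h
      exact hpq ⟨rfl, h⟩
    have h1 := maassShimuraIter_eq_sum k (g := fun i z => (-((p : ℝ) : ℂ)) ^ i * k.ascFactorial i *
      (((p : ℝ) : ℂ) * z + ((q : ℝ) : ℂ)) ^ (-((k : ℤ) + i)))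
      (fun i z hz => hasDerivAt_inv_pow_iter k i (hne z hz)) j hτ
    have h2 := maassShimuraIter_inv_pow k j hne hτ
    simp only [pow_zero, Nat.ascFactorial_zero, Nat.cast_one, one_mul, Nat.cast_zero, add_zero] at h1
    rw [h2] at h1
    simpa using h1.symm

end MaassShimura

/-! ### Twisted Lipschitz formula -/

section Lipschitz

theorem hasSum_int_of_residues {t : ℕ} [NeZero t] {f : ℤ → ℂ} (hf : Summable f) {g : ZMod t → ℂ}
    (hg : ∀ d : ZMod t, HasSum (fun a : ℤ => f (a * t + d.val)) (g d)) :
    HasSum f (∑ d, g d) := by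
  have h1 : HasSum (fun p : Fin t × ℤ => f (p.2 * t + p.1)) (∑' n, f n) := by
    have := ((Equiv.prodComm _ _).trans (Int.divModEquiv t).symm).hasSum_iff.mpr hf.hasSum
    exact this
  have h2 := h1.prod_fiberwise (g := fun d : Fin t => g ((d : ℕ) : ZMod t)) (fun d => by
    have := hg ((d : ℕ) : ZMod t)
    rwa [ZMod.val_cast_of_lt d.2] at this)
  have h3 := h2.unique (hasSum_fintype _)
  have h4 : ∑ d : Fin t, g ((d : ℕ) : ZMod t) = ∑ d, g d := by
    obtain ⟨t, rfl⟩ := Nat.exists_eq_succ_of_ne_zero (NeZero.ne t)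
    refine Finset.sum_congr rfl fun d _ => ?_
    congr 1
    exact Fin.cast_val_eq_self d
  rw [← h4, ← h3]
  exact hf.hasSum

theorem summable_inv_zpow_add_int (z : ℂ) {κ : ℕ} (hκ : 2 ≤ κ) :
    Summable fun n : ℤ => (z + n) ^ (-(κ : ℤ)) := by
  have := EisensteinSeries.linear_right_summable z 1 (k := κ) (by exact_mod_cast hκ)
  simpa [zpow_neg] using this

theorem norm_cexp_two_pi_mul (z : ℂ) (n : ℕ) :
    ‖cexp (2 * Real.pi * I * n * z)‖ = Real.exp (-2 * Real.pi * z.im) ^ n := by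
  rw [Complex.norm_exp, ← Real.exp_nat_mul]
  congr 1
  simp
  ring

theorem summable_pow_mul_exp {y : ℝ} (hy : 0 < y) (N : ℕ) :
    Summable fun n : ℕ+ => ((n : ℕ) : ℝ) ^ N * Real.exp (-2 * Real.pi * y) ^ (n : ℕ) := by
  have h : ‖Real.exp (-2 * Real.pi * y)‖ < 1 := by
    rw [Real.norm_eq_abs, Real.abs_exp, Real.exp_lt_one_iff]
    have := mul_pos Real.pi_pos hy
    linarith
  exact (summable_pow_mul_geometric_of_norm_lt_one N h).comp_injective PNat.coe_injective

theorem summable_mul_pow_mul_exp {y : ℝ} (hy : 0 < y) (N : ℕ) :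
    Summable fun p : ℕ+ × ℕ+ =>
      ((p.1 * p.2 : ℕ) : ℝ) ^ N * Real.exp (-2 * Real.pi * y) ^ (p.1 * p.2 : ℕ) := by
  set ρ := Real.exp (-2 * Real.pi * y)
  have hρ0 : 0 < ρ := Real.exp_pos _
  have hρ1 : ρ ≤ 1 := by
    rw [Real.exp_le_one_iff]
    have := mul_pos Real.pi_pos hy
    linarith
  have hs := summable_pow_mul_exp hy N
  have := (hs.mul_of_nonneg hs (fun n => by positivity) (fun n => by positivity)).mul_right ρ⁻¹
  refine Summable.of_nonneg_of_le (fun p => by positivity) (fun p => ?_) this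
  obtain ⟨m, r⟩ := p
  -- This is `(m - 1)(r - 1) ≥ 0`; it bounds the double series by a product of two single ones, at
  -- the price of a factor `ρ⁻¹`.
  have hle : (m : ℕ) + r ≤ m * r + 1 := by
    have hm := m.pos
    have hr := r.pos
    nlinarith [Nat.mul_le_mul hm hr]
  have : ρ ^ (m * r : ℕ) ≤ ρ ^ ((m : ℕ) + r) * ρ⁻¹ := by
    rw [le_mul_inv_iff₀ hρ0, ← pow_succ]
    exact pow_le_pow_of_le_one hρ0.le hρ1 hle
  calc ((m * r : ℕ) : ℝ) ^ N * ρ ^ (m * r : ℕ)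
      ≤ ((m * r : ℕ) : ℝ) ^ N * (ρ ^ ((m : ℕ) + r) * ρ⁻¹) := by gcongr
    _ = _ := by push_cast; simp only [pow_add, mul_pow]; ring

/-- The Lipschitz formula, twisted by a primitive Dirichlet character. -/
theorem hasSum_dirichlet_mul_inv_zpow {t : ℕ} [NeZero t] {ψ : DirichletCharacter ℂ t}
    (hψ : ψ.IsPrimitive) {κ : ℕ} (hκ : 2 ≤ κ) {z : ℂ} (hz : 0 < z.im) :
    HasSum (fun n : ℤ => ψ⁻¹ (n : ZMod t) * (t * z + n) ^ (-(κ : ℤ)))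
      ((t : ℂ) ^ (-(κ : ℤ)) * ((-2 * Real.pi * I) ^ κ / (κ - 1).factorial) *
        gaussSum ψ⁻¹ (ZMod.stdAddChar (N := t)) *
        ∑' r : ℕ+, ψ ((r : ℕ) : ZMod t) * (((r : ℕ) : ℂ) ^ (κ - 1) *
          cexp (2 * Real.pi * I * (r : ℕ) * z))) := by
  have ht0 : (t : ℂ) ≠ 0 := Nat.cast_ne_zero.mpr (NeZero.ne t)
  have hsum : Summable fun n : ℤ => ψ⁻¹ (n : ZMod t) * (t * z + n) ^ (-(κ : ℤ)) := by
    refine Summable.of_norm_bounded (summable_inv_zpow_add_int (t * z) hκ).norm fun n => ?_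
    rw [norm_mul]
    exact mul_le_of_le_one_left (norm_nonneg _) (ψ⁻¹.norm_le_one _)
  obtain ⟨l, rfl⟩ : ∃ l, κ = l + 1 := ⟨κ - 1, by omega⟩
  have hz' : ∀ d : ZMod t, 0 < (z + d.val / t).im := fun d => by
    have : ((d.val : ℂ) / t) = ((d.val / t : ℝ) : ℂ) := by push_cast; rfl
    rw [this, add_im, ofReal_im, add_zero]
    exact hz
  -- For `n = at + d` one has `tz + n = t (z + d/t + a)`, so each residue class gives an ordinary
  -- Lipschitz sum at `z + d/t`.
  have key : ∀ d : ZMod t, HasSum (fun a : ℤ => (z + d.val / t + a) ^ (-((l + 1 : ℕ) : ℤ)))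
      (((-2 * Real.pi * I) ^ (l + 1) / l.factorial) *
        ∑' r : ℕ+, ((r : ℕ) : ℂ) ^ l * cexp (2 * Real.pi * I * (r : ℕ) * (z + d.val / t))) := by
    intro d
    have h := EisensteinSeries.qExpansion_identity_pnat (k := l) (by omega)
      (⟨z + d.val / t, hz' d⟩ : UpperHalfPlane)
    have h1 := (summable_inv_zpow_add_int (z + d.val / t) hκ).hasSum
    convert! h1 using 1
    simp only [zpow_neg, zpow_natCast]
    rw [show ∑' n : ℤ, ((z + d.val / t + n) ^ (l + 1))⁻¹ = ∑' n : ℤ, 1 / ((z + d.val / t + n) ^ (l + 1))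
      by simp only [one_div]]
    refine Eq.trans ?_ h.symm
    congr 1
    refine tsum_congr fun r => ?_
    rw [← Complex.exp_nat_mul]
    congr 2
    change _ = _ * (2 * Real.pi * I * (z + d.val / t))
    ring
  have hs : ∀ d : ZMod t, Summable fun r : ℕ+ =>
      ((r : ℕ) : ℂ) ^ l * cexp (2 * Real.pi * I * (r : ℕ) * (z + d.val / t)) := by
    intro d
    refine Summable.of_norm ((summable_pow_mul_exp (hz' d) l).congr fun r => ?_)
    rw [norm_mul, norm_cexp_two_pi_mul]
    simp
  have := hasSum_int_of_residues hsum (g := fun d : ZMod t => ψ⁻¹ d * (t : ℂ) ^ (-((l + 1 : ℕ) : ℤ)) *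
      (((-2 * Real.pi * I) ^ (l + 1) / l.factorial) *
        ∑' r : ℕ+, ((r : ℕ) : ℂ) ^ l * cexp (2 * Real.pi * I * (r : ℕ) * (z + d.val / t)))) (fun d => by
      have h := (key d).mul_left (ψ⁻¹ d * (t : ℂ) ^ (-((l + 1 : ℕ) : ℤ)))
      convert! h using 2 with a
      rw [mul_assoc, ← mul_zpow]
      congr 2
      · simp
      · push_cast
        field_simp
        ring)
  convert! this using 1
  -- The weights `ψ⁻¹(d)` on `e^(2πi rd/t)` add up to `ψ(r)` times the Gauss sum. By primitivity
  -- this also holds when `r` is not prime to `t`.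
  have h5 : ∀ r : ℕ+, ψ ((r : ℕ) : ZMod t) * gaussSum ψ⁻¹ (ZMod.stdAddChar (N := t)) *
        (((r : ℕ) : ℂ) ^ l * cexp (2 * Real.pi * I * (r : ℕ) * z)) =
      ∑ d : ZMod t, ψ⁻¹ d * (((r : ℕ) : ℂ) ^ l * cexp (2 * Real.pi * I * (r : ℕ) * (z + d.val / t))) := by
    intro r
    have hprim : (ψ⁻¹).IsPrimitive := by
      rw [DirichletCharacter.isPrimitive_def] at hψ ⊢
      rw [DirichletCharacter.conductor_inv, hψ]
    have hg := gaussSum_mulShift_of_isPrimitive (ZMod.stdAddChar (N := t)) hprim ((r : ℕ) : ZMod t)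
    rw [inv_inv] at hg
    rw [← hg, gaussSum, Finset.sum_mul]
    refine Finset.sum_congr rfl fun d _ => ?_
    rw [AddChar.mulShift_apply]
    have h6 : ((r : ℕ) : ZMod t) * d = (((r : ℕ) * d.val : ℤ) : ZMod t) := by
      push_cast
      rw [ZMod.natCast_zmod_val]
    rw [h6, ZMod.stdAddChar_coe, mul_assoc, mul_left_comm (cexp _), ← Complex.exp_add]
    congr 3
    push_cast
    ring
  have h6 : ∑ d : ZMod t, ψ⁻¹ d * ∑' r : ℕ+, ((r : ℕ) : ℂ) ^ l *
        cexp (2 * Real.pi * I * (r : ℕ) * (z + d.val / t)) =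
      gaussSum ψ⁻¹ (ZMod.stdAddChar (N := t)) * ∑' r : ℕ+, ψ ((r : ℕ) : ZMod t) *
        (((r : ℕ) : ℂ) ^ l * cexp (2 * Real.pi * I * (r : ℕ) * z)) := by
    rw [← tsum_mul_left]
    simp_rw [← tsum_mul_left]
    rw [← Summable.tsum_finsetSum fun d _ => (hs d).mul_left _]
    refine tsum_congr fun r => ?_
    rw [← h5]
    ring
  rw [mul_assoc, Nat.add_sub_cancel, ← h6, Finset.mul_sum]
  refine Finset.sum_congr rfl fun d _ => ?_
  ring

end Lipschitz

/-! ### The Fourier expansion of the rows of an Eisenstein series -/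

section EisensteinRows

theorem hasSum_int_of_even_of_pnat {f : ℤ → ℂ} (hf : ∀ n, f (-n) = f n) {a : ℂ}
    (h : HasSum (fun n : ℕ+ => f (n : ℕ)) a) : HasSum f (f 0 + 2 * a) := by
  have h1 : HasSum (fun n : ℕ => f ((n : ℤ) + 1)) a := by
    rw [← Equiv.pnatEquivNat.hasSum_iff]
    convert! h using 1
    funext n
    simp only [Function.comp, Equiv.pnatEquivNat_apply]
    congr 1
    have := PNat.natPred_add_one n
    exact_mod_cast this
  have h2 : HasSum (fun n : ℕ => f (n : ℤ)) (f 0 + a) := by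
    have := (hasSum_nat_add_iff (f := fun n : ℕ => f (n : ℤ)) 1).mp (by simpa using h1)
    simpa [add_comm] using this
  have h3 := HasSum.of_nat_of_neg_add_one h2 (by simpa only [hf] using h1)
  convert! h3 using 1
  ring

theorem DirichletCharacter.IsPrimitive.inv {N : ℕ} {ψ : DirichletCharacter ℂ N}
    (h : ψ.IsPrimitive) : (ψ⁻¹).IsPrimitive := by
  rw [DirichletCharacter.isPrimitive_def] at h ⊢
  rw [DirichletCharacter.conductor_inv, h]

theorem ZMod.LFunction_const_mul {N : ℕ} [NeZero N] (c : ℂ) (Φ : ZMod N → ℂ) (s : ℂ) :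
    ZMod.LFunction (fun x => c * Φ x) s = c * ZMod.LFunction Φ s := by
  simp only [ZMod.LFunction, mul_assoc, ← Finset.mul_sum]
  ring

theorem DirichletCharacter.inv_neg_one {N : ℕ} (ψ : DirichletCharacter ℂ N) :
    ψ⁻¹ (-1) = ψ (-1) := by
  rw [MulChar.inv_apply_eq_inv', inv_eq_iff_eq_inv]
  rcases ψ.even_or_odd with h | h
  · rw [DirichletCharacter.Even] at h; simp [h]
  · rw [DirichletCharacter.Odd] at h; norm_num [h]

/-- The functional equation of Dirichlet `L`-functions at positive integers. -/
theorem two_mul_LFunction_inv_natCast {t : ℕ} [NeZero t] {ψ : DirichletCharacter ℂ t}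
    (hψ : ψ.IsPrimitive) {k : ℕ} (hk : 2 ≤ k) (hpar : ψ (-1) = (-1) ^ k) :
    2 * ψ⁻¹.LFunction k = (t : ℂ) ^ (-(k : ℤ)) * ((-2 * Real.pi * I) ^ k / (k - 1).factorial) *
      gaussSum ψ⁻¹ (ZMod.stdAddChar (N := t)) * ψ.LFunction (1 - k) := by
  have ht0 : (t : ℂ) ≠ 0 := Nat.cast_ne_zero.mpr (NeZero.ne t)
  have hπ : (Real.pi : ℂ) ≠ 0 := by exact_mod_cast Real.pi_ne_zero
  have hfour := hψ.inv.fourierTransform_eq_inv_mul_gaussSum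
  rw [inv_inv] at hfour
  -- The functional equation is applied to the Fourier transform of `ψ⁻¹`, a multiple of `ψ` by
  -- primitivity; transforming again returns `ψ⁻¹`. The parity of `ψ` makes its two exponential
  -- terms equal.
  have h := ZMod.LFunction_one_sub (ZMod.dft ⇑(ψ⁻¹)) (s := k)
    (fun n h => by
      have h' : ((k + n : ℕ) : ℂ) = 0 := by push_cast; rw [h]; ring
      rw [Nat.cast_eq_zero] at h'
      omega) (Or.inr (by exact_mod_cast (by omega : k ≠ 1)))
  have e1 : (ZMod.dft ⇑(ψ⁻¹)) =
      fun x => (ψ (-1) * gaussSum ψ⁻¹ (ZMod.stdAddChar (N := t))) * ψ x := by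
    funext x
    rw [hfour, ← neg_one_mul x, map_mul]
    ring
  have e2 : ZMod.dft (ZMod.dft ⇑(ψ⁻¹)) = fun x => ((t : ℂ) * ψ (-1)) * ψ⁻¹ x := by
    rw [ZMod.dft_dft]
    funext x
    rw [← neg_one_mul x, map_mul, DirichletCharacter.inv_neg_one]
    simp
    ring
  have e3 : ZMod.dft (fun x => ZMod.dft ⇑(ψ⁻¹) (-x)) = fun x => (t : ℂ) * ψ⁻¹ x := by
    rw [ZMod.dft_comp_neg, ZMod.dft_dft]
    funext x
    simp
  rw [e2, e3, e1, ZMod.LFunction_const_mul, ZMod.LFunction_const_mul,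
    ZMod.LFunction_const_mul, hpar] at h
  have hexp1 : cexp (Real.pi * I * k / 2) = I ^ k := by
    have : I ^ k = cexp (Real.pi / 2 * I) ^ k := by rw [Complex.exp_pi_div_two_mul_I]
    rw [this, ← Complex.exp_nat_mul]
    congr 1
    ring
  have hexp2 : cexp (-Real.pi * I * k / 2) = (-I) ^ k := by
    have : (-I) ^ k = cexp (-Real.pi / 2 * I) ^ k := by rw [Complex.exp_neg_pi_div_two_mul_I]
    rw [this, ← Complex.exp_nat_mul]
    congr 1
    ring
  have hgamma : Complex.Gamma k = (k - 1).factorial := by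
    rw [← Complex.Gamma_nat_eq_factorial, Nat.cast_sub (by omega)]
    simp
  have hpow1 : (t : ℂ) ^ ((k : ℂ) - 1) = (t : ℂ) ^ k / t := by
    rw [Complex.cpow_sub _ _ ht0, cpow_natCast, cpow_one]
  have hpow2 : (2 * (Real.pi : ℂ)) ^ (-(k : ℂ)) = ((2 * (Real.pi : ℂ)) ^ k)⁻¹ := by
    rw [cpow_neg, cpow_natCast]
  rw [hexp1, hexp2, hgamma, hpow1, hpow2] at h
  have hfac : ((k - 1).factorial : ℂ) ≠ 0 := Nat.cast_ne_zero.mpr (Nat.factorial_ne_zero _)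
  change _ = _ * ZMod.LFunction ψ (1 - k)
  change 2 * ZMod.LFunction ⇑(ψ⁻¹) k = _
  generalize ZMod.LFunction ψ (1 - k) = X at *
  generalize ZMod.LFunction ⇑(ψ⁻¹) k = Y at *
  generalize gaussSum ψ⁻¹ (ZMod.stdAddChar (N := t)) = g at *
  have hI : (-I : ℂ) ^ k = (-1) ^ k * I ^ k := by rw [← mul_pow]; simp
  have hI2 : I ^ k * I ^ k = (-1 : ℂ) ^ k := by rw [← mul_pow, I_mul_I]
  have hm : (-1 : ℂ) ^ k * (-1 : ℂ) ^ k = 1 := by rw [← mul_pow]; simp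
  rw [hI] at h
  have hC : (-2 * (Real.pi : ℂ) * I) ^ k = (-1) ^ k * I ^ k * (2 * Real.pi) ^ k := by
    rw [← mul_pow, ← mul_pow]; congr 1; ring
  rw [hC, zpow_neg, zpow_natCast]
  have htk : (t : ℂ) ^ k ≠ 0 := pow_ne_zero _ ht0
  have hpk : (2 * (Real.pi : ℂ)) ^ k ≠ 0 := pow_ne_zero _ (by simp)
  field_simp at h ⊢
  linear_combination -((-1 : ℂ) ^ k * I ^ k) * h -
    ((-1) ^ k * (2 * Y * t ^ k * (k - 1).factorial)) * hI2 -
    2 * Y * t ^ k * (k - 1).factorial * hm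

/-- This becomes the row `m = 0` of the lattice sum when `u = 1`. The summand is even, so the sum
over `ℤ` is twice `L(ψ⁻¹, k)`. -/
theorem hasSum_dirichlet_mul_zpow_int {t : ℕ} [NeZero t] {ψ : DirichletCharacter ℂ t}
    (hψ : ψ.IsPrimitive) {k : ℕ} (hk : 2 ≤ k) (hpar : ψ (-1) = (-1) ^ k) :
    HasSum (fun n : ℤ => ψ⁻¹ (n : ZMod t) * (n : ℂ) ^ (-(k : ℤ)))
      ((t : ℂ) ^ (-(k : ℤ)) * ((-2 * Real.pi * I) ^ k / (k - 1).factorial) *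
      gaussSum ψ⁻¹ (ZMod.stdAddChar (N := t)) * ψ.LFunction (1 - k)) := by
  rw [← two_mul_LFunction_inv_natCast hψ hk hpar]
  have hre : 1 < ((k : ℂ)).re := by simpa using (by omega : 1 < k)
  have h1 := (ZMod.LSeriesSummable_of_one_lt_re ⇑(ψ⁻¹) hre).LSeriesHasSum
  have hL : ψ⁻¹.LFunction k = LSeries (fun n => ψ⁻¹ (n : ZMod t)) k :=
    DirichletCharacter.LFunction_eq_LSeries ψ⁻¹ hre
  rw [← hL, LSeriesHasSum] at h1
  have h0 : ψ⁻¹ ((0 : ℤ) : ZMod t) * ((0 : ℤ) : ℂ) ^ (-(k : ℤ)) = 0 := by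
    simp [show k ≠ 0 by omega]
  have h2 : HasSum (fun n : ℕ+ => ψ⁻¹ (((n : ℕ) : ℤ) : ZMod t) * (((n : ℕ) : ℤ) : ℂ) ^ (-(k : ℤ)))
      (ψ⁻¹.LFunction k) := by
    have := (hasSum_nat_add_iff (f := LSeries.term (fun n => ψ⁻¹ (n : ZMod t)) (k : ℂ)) 1
      (g := ψ⁻¹.LFunction k)).mpr (by simpa using h1)
    rw [← Equiv.pnatEquivNat.symm.hasSum_iff]
    convert! this using 1
    funext n
    rw [LSeries.term_of_ne_zero (by omega)]
    simp [zpow_neg, div_eq_mul_inv]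
  have := hasSum_int_of_even_of_pnat (f := fun n : ℤ => ψ⁻¹ (n : ZMod t) * (n : ℂ) ^ (-(k : ℤ)))
    (fun n => by
      have : ψ⁻¹ ((-n : ℤ) : ZMod t) = (-1) ^ k * ψ⁻¹ (n : ZMod t) := by
        rw [← hpar, ← DirichletCharacter.inv_neg_one, ← map_mul]; simp
      have h4 : ((-1 : ℂ) ^ k)⁻¹ = (-1) ^ k := by rw [← inv_pow]; norm_num
      have h5 : (-1 : ℂ) ^ k * (-1) ^ k = 1 := by rw [← mul_pow]; simp
      rw [this, Int.cast_neg, ← neg_one_mul (n : ℂ), mul_zpow, zpow_neg (-1 : ℂ), zpow_natCast, h4]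
      linear_combination (ψ⁻¹ (n : ZMod t) * (n : ℂ) ^ (-(k : ℤ))) * h5) h2
  rw [h0, zero_add] at this
  exact this

end EisensteinRows

/-! ### Derivatives of Eisenstein series as iterated lattice sums -/

section EisensteinRows

variable {u t : ℕ} [NeZero u] [NeZero t] {ψ₁ : DirichletCharacter ℂ u} {ψ₂ : DirichletCharacter ℂ t}

omit [NeZero u] [NeZero t] in
theorem norm_twistedSigma_le (k : ℕ) (ψ₁ : DirichletCharacter ℂ u) (ψ₂ : DirichletCharacter ℂ t)
    (n : ℕ) : ‖twistedSigma k ψ₁ ψ₂ n‖ ≤ (n : ℝ) ^ (k - 1 + 1) := by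
  have h : ∀ d ∈ n.divisors, ‖ψ₁ ((n / d : ℕ) : ZMod u) * ψ₂ (d : ZMod t) * (d : ℂ) ^ (k - 1)‖ ≤
      (n : ℝ) ^ (k - 1) := fun d hd => by
    rw [norm_mul, norm_mul, norm_pow, Complex.norm_natCast]
    calc _ ≤ 1 * 1 * (n : ℝ) ^ (k - 1) := by
          gcongr
          · exact ψ₁.norm_le_one _
          · exact ψ₂.norm_le_one _
          · exact Nat.divisor_le hd
      _ = _ := by ring
  calc _ ≤ ∑ d ∈ n.divisors, (n : ℝ) ^ (k - 1) := norm_sum_le_of_le _ h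
    _ = n.divisors.card * (n : ℝ) ^ (k - 1) := by simp
    _ ≤ n * (n : ℝ) ^ (k - 1) := by
      gcongr
      exact_mod_cast Nat.card_divisors_le_self n
    _ = _ := by ring

open Classical in
/-- The constant term of `E_k^{ψ₁,ψ₂}`. -/
noncomputable def twistedEisensteinConst (k : ℕ) (ψ₁ : DirichletCharacter ℂ u)
    (ψ₂ : DirichletCharacter ℂ t) : ℂ :=
  if ψ₁ = 1 then ψ₂.LFunction (1 - (k : ℂ)) / 2 else 0

/-- The `i`-th derivative of `E_k^{ψ₁,ψ₂}`, by its Fourier expansion. -/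
noncomputable def twistedEisensteinDeriv (k : ℕ) (ψ₁ : DirichletCharacter ℂ u)
    (ψ₂ : DirichletCharacter ℂ t) (i : ℕ) (τ : ℂ) : ℂ :=
  (if i = 0 then twistedEisensteinConst k ψ₁ ψ₂ else 0) +
    ∑' n : ℕ+, (2 * Real.pi * I * (n : ℕ)) ^ i * (twistedSigma k ψ₁ ψ₂ n *
      cexp (2 * Real.pi * I * (n : ℕ) * τ))

theorem twistedEisensteinDeriv_zero (k : ℕ) (ψ₁ : DirichletCharacter ℂ u)
    (ψ₂ : DirichletCharacter ℂ t) :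
    twistedEisensteinDeriv k ψ₁ ψ₂ 0 = twistedEisenstein k ψ₁ ψ₂ := by
  funext τ
  simp [twistedEisensteinDeriv, twistedEisenstein, twistedEisensteinConst]

theorem norm_two_pi_I_mul_pow (n i : ℕ) :
    ‖(2 * Real.pi * I * (n : ℂ)) ^ i‖ = (2 * Real.pi) ^ i * (n : ℝ) ^ i := by
  simp [mul_pow, abs_of_pos Real.pi_pos]

theorem hasDerivAt_twistedEisensteinDeriv (k : ℕ) (ψ₁ : DirichletCharacter ℂ u)
    (ψ₂ : DirichletCharacter ℂ t) (i : ℕ) {z : ℂ} (hz : 0 < z.im) :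
    HasDerivAt (twistedEisensteinDeriv k ψ₁ ψ₂ i) (twistedEisensteinDeriv k ψ₁ ψ₂ (i + 1) z) z := by
  -- Termwise differentiation is justified on the half-plane above `Im z / 2`, where these bounds
  -- are uniform.
  have hbound : ∀ (l : ℕ) (n : ℕ+) (y : ℂ), z.im / 2 < y.im →
      ‖(2 * Real.pi * I * (n : ℕ)) ^ l * (twistedSigma k ψ₁ ψ₂ n *
        cexp (2 * Real.pi * I * (n : ℕ) * y))‖ ≤ (2 * Real.pi) ^ l * (((n : ℕ) : ℝ) ^ (l + (k - 1 + 1)) *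
          Real.exp (-2 * Real.pi * (z.im / 2)) ^ (n : ℕ)) := by
    intro l n y hy
    rw [norm_mul, norm_mul, norm_two_pi_I_mul_pow, norm_cexp_two_pi_mul, pow_add]
    have h1 := norm_twistedSigma_le k ψ₁ ψ₂ n
    have h2 : Real.exp (-2 * Real.pi * y.im) ≤ Real.exp (-2 * Real.pi * (z.im / 2)) := by
      rw [Real.exp_le_exp]
      have := mul_le_mul_of_nonneg_left hy.le Real.pi_pos.le
      linarith
    calc _ ≤ (2 * Real.pi) ^ l * ((n : ℕ) : ℝ) ^ l * (((n : ℕ) : ℝ) ^ (k - 1 + 1) *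
          Real.exp (-2 * Real.pi * (z.im / 2)) ^ (n : ℕ)) := by gcongr
      _ = _ := by ring
  have hsum : ∀ l, Summable fun n : ℕ+ => (2 * Real.pi) ^ l * (((n : ℕ) : ℝ) ^ (l + (k - 1 + 1)) *
          Real.exp (-2 * Real.pi * (z.im / 2)) ^ (n : ℕ)) :=
    fun l => (summable_pow_mul_exp (half_pos hz) _).mul_left _
  have hzmem : z ∈ {w : ℂ | z.im / 2 < w.im} := by
    change z.im / 2 < z.im
    linarith
  have h := hasDerivAt_tsum_of_isPreconnected (hsum (i + 1))
    (t := {w : ℂ | z.im / 2 < w.im}) (isOpen_lt continuous_const continuous_im)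
    (convex_halfSpace_im_gt _).isPreconnected
    (g := fun (n : ℕ+) τ => (2 * Real.pi * I * (n : ℕ)) ^ i * (twistedSigma k ψ₁ ψ₂ n *
      cexp (2 * Real.pi * I * (n : ℕ) * τ)))
    (g' := fun (n : ℕ+) τ => (2 * Real.pi * I * (n : ℕ)) ^ (i + 1) * (twistedSigma k ψ₁ ψ₂ n *
      cexp (2 * Real.pi * I * (n : ℕ) * τ)))
    (fun n y _ => by
      have h1 := ((hasDerivAt_id y).const_mul (2 * Real.pi * I * (n : ℕ))).cexp.const_mul
        ((2 * Real.pi * I * (n : ℕ)) ^ i * twistedSigma k ψ₁ ψ₂ n)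
      simp only [id, mul_one] at h1
      convert! h1 using 1
      · funext τ; ring
      · ring)
    (fun n y hy => hbound _ n y hy) hzmem
    (Summable.of_norm_bounded (hsum i) fun n => hbound i n z hzmem) hzmem
  have h2 := h.const_add (if i = 0 then twistedEisensteinConst k ψ₁ ψ₂ else 0)
  unfold twistedEisensteinDeriv
  simpa using h2

/-- The constant relating `E_k^{ψ₁,ψ₂}` to a sum over a lattice. -/
noncomputable def eisensteinFactor (k : ℕ) (ψ₂ : DirichletCharacter ℂ t) : ℂ :=
  (t : ℂ) ^ (-(k : ℤ)) * ((-2 * Real.pi * I) ^ k / (k - 1).factorial) *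
    gaussSum ψ₂⁻¹ (ZMod.stdAddChar (N := t))

-- The absolutely convergent double series over `(m, r)` is regrouped by `n = mr`.
omit [NeZero u] [NeZero t] in
theorem hasSum_pnat_pnat_eisenstein (k : ℕ) (ψ₁ : DirichletCharacter ℂ u)
    (ψ₂ : DirichletCharacter ℂ t) (i : ℕ) {τ : ℂ} (hτ : 0 < τ.im) :
    HasSum (fun m : ℕ+ => ∑' r : ℕ+, (2 * Real.pi * I * (m * r : ℕ)) ^ i *
      (ψ₁ ((m : ℕ) : ZMod u) * ψ₂ ((r : ℕ) : ZMod t) * ((r : ℕ) : ℂ) ^ (k - 1) *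
        cexp (2 * Real.pi * I * (m * r : ℕ) * τ)))
      (∑' n : ℕ+, (2 * Real.pi * I * (n : ℕ)) ^ i * (twistedSigma k ψ₁ ψ₂ n *
      cexp (2 * Real.pi * I * (n : ℕ) * τ))) := by
  set h : ℕ+ × ℕ+ → ℂ := fun p => (2 * Real.pi * I * (p.1 * p.2 : ℕ)) ^ i *
      (ψ₁ ((p.1 : ℕ) : ZMod u) * ψ₂ ((p.2 : ℕ) : ZMod t) * ((p.2 : ℕ) : ℂ) ^ (k - 1) *
        cexp (2 * Real.pi * I * (p.1 * p.2 : ℕ) * τ)) with hh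
  have hs : Summable h := by
    refine Summable.of_norm_bounded
      ((summable_mul_pow_mul_exp hτ (i + (k - 1))).mul_left ((2 * Real.pi) ^ i)) fun p => ?_
    rw [hh]
    rw [norm_mul, norm_mul, norm_mul, norm_mul, norm_two_pi_I_mul_pow, norm_cexp_two_pi_mul,
      norm_pow, pow_add, Complex.norm_natCast]
    have h1 : ((p.2 : ℕ) : ℝ) ≤ (p.1 * p.2 : ℕ) := by
      exact_mod_cast Nat.le_mul_of_pos_left _ p.1.pos
    calc _ ≤ (2 * Real.pi) ^ i * ((p.1 * p.2 : ℕ) : ℝ) ^ i * (1 * 1 *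
          ((p.1 * p.2 : ℕ) : ℝ) ^ (k - 1) *
          Real.exp (-2 * Real.pi * τ.im) ^ (p.1 * p.2 : ℕ)) := by
          gcongr
          · exact ψ₁.norm_le_one _
          · exact ψ₂.norm_le_one _
      _ = _ := by ring
  have h1 := hs.hasSum.prod_fiberwise (fun m => (hs.prod_factor m).hasSum)
  convert! h1 using 1
  rw [← sigmaAntidiagonalEquivProd.tsum_eq]
  refine Eq.trans ?_ (sigmaAntidiagonalEquivProd.summable_iff.mpr hs).tsum_sigma.symm
  refine tsum_congr fun n => ?_
  rw [tsum_fintype, twistedSigma]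
  have h2 : ∀ x : (n : ℕ).divisorsAntidiagonal, h (sigmaAntidiagonalEquivProd ⟨n, x⟩) =
      (fun y : ℕ × ℕ => (2 * Real.pi * I * (n : ℕ)) ^ i *
      (ψ₁ ((y.1 : ℕ) : ZMod u) * ψ₂ ((y.2 : ℕ) : ZMod t) * ((y.2 : ℕ) : ℂ) ^ (k - 1) *
        cexp (2 * Real.pi * I * (n : ℕ) * τ))) x.1 := by
    rintro ⟨y, hy⟩
    have := (Nat.mem_divisorsAntidiagonal.mp hy).1
    simp only [hh, sigmaAntidiagonalEquivProd, divisorsAntidiagonalFactors, Equiv.coe_fn_mk,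
      PNat.mk_coe, this]
  refine Eq.trans ?_ (Finset.sum_congr rfl fun x _ => h2 x).symm
  rw [Finset.univ_eq_attach, Finset.sum_attach _
    (fun y : ℕ × ℕ => (2 * Real.pi * I * (n : ℕ)) ^ i *
      (ψ₁ ((y.1 : ℕ) : ZMod u) * ψ₂ ((y.2 : ℕ) : ZMod t) * ((y.2 : ℕ) : ℂ) ^ (k - 1) *
        cexp (2 * Real.pi * I * (n : ℕ) * τ)))]
  rw [Nat.sum_divisorsAntidiagonal' (f := fun a b => (2 * Real.pi * I * (n : ℕ)) ^ i *
      (ψ₁ (a : ZMod u) * ψ₂ (b : ZMod t) * (b : ℂ) ^ (k - 1) *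
        cexp (2 * Real.pi * I * (n : ℕ) * τ))), Finset.sum_mul, Finset.mul_sum]

/-- A term of the `i`-th derivative of an Eisenstein series, as a sum over a lattice. -/
noncomputable def eisensteinTerm (k : ℕ) (ψ₁ : DirichletCharacter ℂ u)
    (ψ₂ : DirichletCharacter ℂ t) (τ : ℂ) (i : ℕ) (m n : ℤ) : ℂ :=
  ψ₁ (m : ZMod u) * ψ₂⁻¹ (n : ZMod t) * ((-((m * t : ℤ) : ℂ)) ^ i * k.ascFactorial i *
    (((m * t : ℤ) : ℂ) * τ + n) ^ (-((k : ℤ) + i)))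

-- By the parity condition opposite vectors contribute equally, so the rows `m` and `-m` agree and
-- account for the factor `2`.
omit [NeZero u] [NeZero t] in
theorem eisensteinTerm_neg {k : ℕ} (hpar : ψ₁ (-1) * ψ₂ (-1) = (-1) ^ k) (τ : ℂ) (i : ℕ)
    (m n : ℤ) : eisensteinTerm k ψ₁ ψ₂ τ i (-m) (-n) = eisensteinTerm k ψ₁ ψ₂ τ i m n := by
  have h1 : ψ₁ ((-m : ℤ) : ZMod u) = ψ₁ (-1) * ψ₁ (m : ZMod u) := by rw [← map_mul]; simp
  have h2 : ψ₂⁻¹ ((-n : ℤ) : ZMod t) = ψ₂ (-1) * ψ₂⁻¹ (n : ZMod t) := by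
    rw [← DirichletCharacter.inv_neg_one, ← map_mul]; simp
  rw [eisensteinTerm, eisensteinTerm, h1, h2]
  have h3 : ((-m * t : ℤ) : ℂ) * τ + ((-n : ℤ) : ℂ) = -1 * (((m * t : ℤ) : ℂ) * τ + n) := by
    push_cast; ring
  have h4 : ((-1 : ℂ) ^ (-((k : ℤ) + i))) = (-1) ^ (k + i) := by
    rw [zpow_neg, ← Nat.cast_add, zpow_natCast, ← inv_pow]; norm_num
  have h5 : -((-m * t : ℤ) : ℂ) = -1 * (-((m * t : ℤ) : ℂ)) := by push_cast; ring
  have h6 : ((-1 : ℂ) ^ (k + i)) * (-1) ^ (k + i) = 1 := by rw [← mul_pow]; simp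
  rw [h3, mul_zpow, h4, h5, mul_pow]
  generalize (((m * t : ℤ) : ℂ) * τ + n) ^ (-((k : ℤ) + i)) = W
  generalize (-((m * t : ℤ) : ℂ)) ^ i = V
  rw [pow_add] at h6 ⊢
  linear_combination (ψ₁ (m : ZMod u) * ψ₂⁻¹ (n : ZMod t) * (V * k.ascFactorial i * W)) * h6 +
    ((-1) ^ i * V * k.ascFactorial i * W * ψ₁ (m : ZMod u) * ψ₂⁻¹ (n : ZMod t) * ((-1) ^ k * (-1) ^ i)) * hpar

-- The twisted Lipschitz formula with exponent `k + i` at the point `mτ`. The factor `(-mt)^i` from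
-- differentiation turns its constant into the one for `k` times `(2πi mr)^i`.
omit [NeZero u] in
theorem hasSum_eisensteinTerm_pnat {k : ℕ} (hk : 2 ≤ k) (hψ₂ : ψ₂.IsPrimitive)
    (ψ₁ : DirichletCharacter ℂ u) {τ : ℂ} (hτ : 0 < τ.im) (i : ℕ) (m : ℕ+) :
    HasSum (fun n : ℤ => eisensteinTerm k ψ₁ ψ₂ τ i (m : ℕ) n)
      (eisensteinFactor k ψ₂ * ∑' r : ℕ+, (2 * Real.pi * I * (m * r : ℕ)) ^ i *
      (ψ₁ ((m : ℕ) : ZMod u) * ψ₂ ((r : ℕ) : ZMod t) * ((r : ℕ) : ℂ) ^ (k - 1) *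
        cexp (2 * Real.pi * I * (m * r : ℕ) * τ))) := by
  have ht0 : (t : ℂ) ≠ 0 := Nat.cast_ne_zero.mpr (NeZero.ne t)
  have hmτ : 0 < (((m : ℕ) : ℂ) * τ).im := by
    simpa using mul_pos (by exact_mod_cast m.pos : (0 : ℝ) < (m : ℕ)) hτ
  have h := (hasSum_dirichlet_mul_inv_zpow hψ₂ (κ := k + i) (by omega) hmτ).mul_left
    (ψ₁ ((m : ℕ) : ZMod u) * ((-(((m : ℕ) * t : ℤ) : ℂ)) ^ i * k.ascFactorial i))
  convert! h using 1
  · funext n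
    rw [eisensteinTerm]
    push_cast
    rw [show (t : ℂ) * (((m : ℕ) : ℂ) * τ) = (m : ℕ) * t * τ by ring]
    ring
  · have hfac : (((k + i - 1).factorial : ℕ) : ℂ) = (k - 1).factorial * k.ascFactorial i := by
      rw [← Nat.cast_mul, Nat.factorial_mul_ascFactorial' _ _ (by omega)]
    have hf1 : (((k - 1).factorial : ℕ) : ℂ) ≠ 0 := Nat.cast_ne_zero.mpr (Nat.factorial_ne_zero _)
    have hf2 : ((k.ascFactorial i : ℕ) : ℂ) ≠ 0 := by
      refine Nat.cast_ne_zero.mpr fun h0 => ?_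
      rw [h0, Nat.cast_zero, mul_zero] at hfac
      exact Nat.cast_ne_zero.mpr (Nat.factorial_ne_zero _) hfac
    rw [eisensteinFactor, hfac, ← tsum_mul_left, ← tsum_mul_left, ← tsum_mul_left]
    refine tsum_congr fun r => ?_
    rw [show 2 * Real.pi * I * ((r : ℕ) : ℂ) * (((m : ℕ) : ℂ) * τ) =
      2 * Real.pi * I * (m * r : ℕ) * τ by push_cast; ring]
    have e1 : k + i - 1 = (k - 1) + i := by omega
    have e2 : (t : ℂ) ^ (-((k + i : ℕ) : ℤ)) = (t : ℂ) ^ (-(k : ℤ)) * ((t : ℂ) ^ i)⁻¹ := by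
      rw [Nat.cast_add, neg_add, zpow_add₀ ht0, zpow_neg _ (i : ℤ), zpow_natCast]
    have key : (-(((m : ℕ) * t : ℤ) : ℂ)) ^ i * (-2 * Real.pi * I) ^ i * ((r : ℕ) : ℂ) ^ i =
        (t : ℂ) ^ i * (2 * Real.pi * I * (m * r : ℕ)) ^ i := by
      rw [← mul_pow, ← mul_pow, ← mul_pow]
      congr 1
      push_cast
      ring
    rw [e1, e2, pow_add, pow_add]
    generalize (-(((m : ℕ) * t : ℤ) : ℂ)) ^ i = V at *
    generalize (2 * Real.pi * I * ((m * r : ℕ) : ℂ)) ^ i = Y at *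
    generalize (-2 * Real.pi * I) ^ i = U at *
    have hti : (t : ℂ) ^ i ≠ 0 := pow_ne_zero _ ht0
    have hY : Y = V * U * ((r : ℕ) : ℂ) ^ i * ((t : ℂ) ^ i)⁻¹ := by
      rw [key]; field_simp
    rw [hY]
    field_simp

/-- The row `m = 0` carries `ψ₁(0)`, nonzero only if `u = 1`, and does not depend on `τ`, so it
disappears for `i > 0`. The surviving row is the constant term, by the functional equation. -/
theorem hasSum_eisensteinTerm_zero {k : ℕ} (hk : 2 ≤ k) (hψ₁ : ψ₁.IsPrimitive)
    (hψ₂ : ψ₂.IsPrimitive) (hpar : ψ₁ (-1) * ψ₂ (-1) = (-1) ^ k) (τ : ℂ) (i : ℕ) :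
    HasSum (fun n : ℤ => eisensteinTerm k ψ₁ ψ₂ τ i 0 n)
      (2 * eisensteinFactor k ψ₂ * (if i = 0 then twistedEisensteinConst k ψ₁ ψ₂ else 0)) := by
  rcases eq_or_ne i 0 with rfl | hi
  · rcases eq_or_ne u 1 with rfl | hu
    · have h1 : ψ₁ = 1 := Subsingleton.elim _ _
      subst h1
      have hpar' : ψ₂ (-1) = (-1) ^ k := by
        rw [← hpar, Subsingleton.elim (-1 : ZMod 1) 1, map_one, one_mul]
      have h := hasSum_dirichlet_mul_zpow_int hψ₂ hk hpar'
      convert! h using 1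
      · funext n
        simp [eisensteinTerm, Subsingleton.elim (0 : ZMod 1) 1]
      · simp [twistedEisensteinConst, eisensteinFactor]
        ring
    · have h1 : ψ₁ ≠ 1 := by
        rintro rfl
        rw [DirichletCharacter.isPrimitive_def, DirichletCharacter.conductor_one]
          at hψ₁
        exact hu hψ₁.symm
      have h0 : ψ₁ 0 = 0 := ψ₁.map_zero' hu
      have : ∀ n : ℤ, eisensteinTerm k ψ₁ ψ₂ τ 0 0 n = 0 := fun n => by
        simp [eisensteinTerm, h0]
      simp [this, twistedEisensteinConst, h1, hasSum_zero]
  · have : ∀ n : ℤ, eisensteinTerm k ψ₁ ψ₂ τ i 0 n = 0 := fun n => by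
      simp [eisensteinTerm, hi]
    simp [this, hi, hasSum_zero]

/-- The derivatives of the Eisenstein series as iterated sums over a lattice. -/
theorem exists_hasSum_eisensteinTerm {k : ℕ} (hk : 2 ≤ k) (hψ₁ : ψ₁.IsPrimitive)
    (hψ₂ : ψ₂.IsPrimitive) (hpar : ψ₁ (-1) * ψ₂ (-1) = (-1) ^ k) {τ : ℂ} (hτ : 0 < τ.im) (i : ℕ) :
    ∃ R : ℤ → ℂ, (∀ m, HasSum (fun n : ℤ => eisensteinTerm k ψ₁ ψ₂ τ i m n) (R m)) ∧
      HasSum R (2 * eisensteinFactor k ψ₂ * twistedEisensteinDeriv k ψ₁ ψ₂ i τ) := by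
  have hpos := hasSum_eisensteinTerm_pnat hk hψ₂ ψ₁ hτ i
  have hzero := hasSum_eisensteinTerm_zero hk hψ₁ hψ₂ hpar τ i
  have hneg : ∀ m : ℤ, ∀ a, HasSum (fun n : ℤ => eisensteinTerm k ψ₁ ψ₂ τ i m n) a →
      HasSum (fun n : ℤ => eisensteinTerm k ψ₁ ψ₂ τ i (-m) n) a := fun m a h => by
    rw [← (Equiv.neg ℤ).hasSum_iff]
    convert! h using 1
    funext n
    exact eisensteinTerm_neg hpar τ i m n
  have hsum : ∀ m : ℤ, Summable fun n : ℤ => eisensteinTerm k ψ₁ ψ₂ τ i m n := fun m => by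
    rcases lt_trichotomy m 0 with h | rfl | h
    · have := (hneg _ _ (hpos ⟨(-m).toNat, by omega⟩)).summable
      rw [PNat.mk_coe, Int.toNat_of_nonneg (by omega), neg_neg] at this
      exact this
    · exact hzero.summable
    · have := (hpos ⟨m.toNat, by omega⟩).summable
      rw [PNat.mk_coe, Int.toNat_of_nonneg (by omega)] at this
      exact this
  refine ⟨fun m => ∑' n : ℤ, eisensteinTerm k ψ₁ ψ₂ τ i m n, fun m => (hsum m).hasSum, ?_⟩
  have h := hasSum_int_of_even_of_pnat
    (f := fun m => ∑' n : ℤ, eisensteinTerm k ψ₁ ψ₂ τ i m n)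
    (fun m => (hneg m _ (hsum m).hasSum).tsum_eq)
    (a := eisensteinFactor k ψ₂ * ∑' n : ℕ+, (2 * Real.pi * I * (n : ℕ)) ^ i *
      (twistedSigma k ψ₁ ψ₂ n * cexp (2 * Real.pi * I * (n : ℕ) * τ))) (by
      convert! (hasSum_pnat_pnat_eisenstein k ψ₁ ψ₂ i hτ).mul_left (eisensteinFactor k ψ₂) using 1
      funext m
      exact (hpos m).tsum_eq)
  convert! h using 1
  rw [hzero.tsum_eq, twistedEisensteinDeriv]
  ring

/-- `∂^j E_k^{ψ₁,ψ₂}` as an iterated sum over a lattice. -/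
theorem exists_hasSum_maassShimuraIter {k : ℕ} (hk : 2 ≤ k) (hψ₁ : ψ₁.IsPrimitive)
    (hψ₂ : ψ₂.IsPrimitive) (hpar : ψ₁ (-1) * ψ₂ (-1) = (-1) ^ k) {τ : ℂ} (hτ : 0 < τ.im) (j : ℕ) :
    ∃ R : ℤ → ℂ, (∀ m : ℤ, HasSum (fun n : ℤ => ψ₁ (m : ZMod u) * ψ₂⁻¹ (n : ZMod t) *
        ((((m * t : ℤ) : ℂ) * τ + n) ^ (-((k : ℤ) + j)) *
          (((m * t : ℤ) : ℂ) * (starRingEnd ℂ) τ + n) ^ j)) (R m)) ∧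
      HasSum R (2 * eisensteinFactor k ψ₂ * (2 * Real.pi * I) ^ j / k.ascFactorial j *
        (τ - (starRingEnd ℂ) τ) ^ j * maassShimuraIter k j (twistedEisenstein k ψ₁ ψ₂) τ) := by
  -- Every derivative already is an iterated sum, so the finite combination that gives `∂^j` can be
  -- taken inside: nothing is differentiated under a conditionally convergent sum.
  choose R hR hRs using exists_hasSum_eisensteinTerm hk hψ₁ hψ₂ hpar hτ
  have hy : τ - (starRingEnd ℂ) τ ≠ 0 := sub_conj_ne_zero hτ
  have hasc : ((k.ascFactorial j : ℕ) : ℂ) ≠ 0 := by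
    rw [Nat.cast_ne_zero]
    obtain ⟨l, rfl⟩ : ∃ l, k = l + 1 := ⟨k - 1, by omega⟩
    exact (Nat.ascFactorial_pos l j).ne'
  have hπ : (2 * Real.pi * I : ℂ) ≠ 0 := Complex.two_pi_I_ne_zero
  -- `A` is the inverse of the constant in the closed form of `∂^j (pτ + q)^(-k)`.
  set A : ℂ := (2 * Real.pi * I) ^ j / k.ascFactorial j * (τ - (starRingEnd ℂ) τ) ^ j with hA
  refine ⟨fun m => A * ∑ i ∈ Finset.range (j + 1), maassShimuraCoeff k j i *
    ((τ - (starRingEnd ℂ) τ) ^ ((i : ℤ) - j) * R i m), fun m => ?_, ?_⟩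
  · have h := (hasSum_sum fun i (_ : i ∈ Finset.range (j + 1)) =>
      ((hR i m).mul_left ((τ - (starRingEnd ℂ) τ) ^ ((i : ℤ) - j))).mul_left
        (maassShimuraCoeff k j i)).mul_left A
    convert! h using 1
    funext n
    have h1 := sum_maassShimuraCoeff_mul_inv_pow (k := k) (by omega) j (m * t) n hτ
    have h2 : ∑ i ∈ Finset.range (j + 1), maassShimuraCoeff k j i *
        ((τ - (starRingEnd ℂ) τ) ^ ((i : ℤ) - j) * eisensteinTerm k ψ₁ ψ₂ τ i m n) =
        ψ₁ (m : ZMod u) * ψ₂⁻¹ (n : ZMod t) * (k.ascFactorial j / (2 * Real.pi * I) ^ j *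
          ((τ - (starRingEnd ℂ) τ) ^ (-(j : ℤ)) *
          ((((m * t : ℤ) : ℂ) * τ + n) ^ (-((k : ℤ) + j)) *
          (((m * t : ℤ) : ℂ) * (starRingEnd ℂ) τ + n) ^ j))) := by
      rw [← h1, Finset.mul_sum]
      refine Finset.sum_congr rfl fun i _ => ?_
      rw [eisensteinTerm]
      ring
    rw [h2, hA, zpow_neg _ (j : ℤ), zpow_natCast _ j]
    field_simp
  · have h := (hasSum_sum fun i (_ : i ∈ Finset.range (j + 1)) =>
      ((hRs i).mul_left ((τ - (starRingEnd ℂ) τ) ^ ((i : ℤ) - j))).mul_left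
        (maassShimuraCoeff k j i)).mul_left A
    convert! h using 1
    rw [← twistedEisensteinDeriv_zero, maassShimuraIter_eq_sum k
      (fun i z hz => hasDerivAt_twistedEisensteinDeriv k ψ₁ ψ₂ i hz) j hτ, Finset.mul_sum,
      Finset.mul_sum]
    refine Finset.sum_congr rfl fun i _ => ?_
    rw [hA]
    ring

end EisensteinRows

/-! ### Conditionally convergent lattice sums -/

section LatticeSums

/-- The summand `w^(-k-j) w̄^j |w|^(-2s)` of a Hecke `L`-series. -/
noncomputable def heckeSummand (k j : ℕ) (s w : ℂ) : ℂ :=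
  w ^ (-((k : ℤ) + j)) * (starRingEnd ℂ) w ^ j * ((normSq w : ℝ) : ℂ) ^ (-s)

theorem norm_heckeSummand (k j : ℕ) (s : ℂ) {w : ℂ} (hw : w ≠ 0) :
    ‖heckeSummand k j s w‖ = ‖w‖ ^ (-(k : ℝ) - 2 * s.re) := by
  have h : 0 < ‖w‖ := norm_pos_iff.mpr hw
  rw [heckeSummand, norm_mul, norm_mul, norm_zpow, norm_pow, RCLike.norm_conj,
    norm_cpow_eq_rpow_re_of_pos (normSq_pos.mpr hw), normSq_eq_norm_sq, ← Real.rpow_natCast,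
    ← Real.rpow_natCast, ← Real.rpow_mul h.le, ← Real.rpow_intCast, ← Real.rpow_add h,
    ← Real.rpow_add h]
  congr 1
  push_cast
  simp
  ring

theorem heckeSummand_zero {k : ℕ} (hk : k ≠ 0) (j : ℕ) (s : ℂ) : heckeSummand k j s 0 = 0 := by
  rw [heckeSummand, zero_zpow _ (by omega)]
  simp

/-- The exponent is `-k - 2 Re s ≤ -3 + 1/2 = -5/2`, and `5/2 > 2` is enough for summability over a
plane lattice. -/
theorem norm_heckeSummand_le {k : ℕ} (hk : 3 ≤ k) (j : ℕ) {s w : ℂ} (hs : -(1 / 4) < s.re)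
    (hw : 1 ≤ ‖w‖) : ‖heckeSummand k j s w‖ ≤ ‖w‖ ^ (-(5 / 2) : ℝ) := by
  have hw0 : w ≠ 0 := by
    rintro rfl
    norm_num at hw
  rw [norm_heckeSummand k j s hw0]
  refine Real.rpow_le_rpow_of_exponent_le hw ?_
  have : (3 : ℝ) ≤ k := by exact_mod_cast hk
  linarith

theorem hasDerivAt_heckeSummand_line (k j : ℕ) (s : ℂ) {w d : ℂ} {θ : ℝ} (h : w + θ * d ≠ 0) :
    HasDerivAt (fun x : ℝ => heckeSummand k j s (w + x * d))
      ((-((k : ℂ) + j) * (d / (w + θ * d)) +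
        j * ((starRingEnd ℂ) d / (starRingEnd ℂ) (w + θ * d)) +
        (-s) * (d / (w + θ * d) + (starRingEnd ℂ) d / (starRingEnd ℂ) (w + θ * d))) *
          heckeSummand k j s (w + θ * d)) θ := by
  set v := w + θ * d with hv
  have hvc : (starRingEnd ℂ) v = (starRingEnd ℂ) w + θ * (starRingEnd ℂ) d := by simp [hv]
  have hvc0 : (starRingEnd ℂ) v ≠ 0 := by simpa using h
  have h1 : HasDerivAt (fun x : ℂ => w + x * d) d (θ : ℂ) := by
    simpa using ((hasDerivAt_id (θ : ℂ)).mul_const d).const_add w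
  have h2 : HasDerivAt (fun x : ℂ => (starRingEnd ℂ) w + x * (starRingEnd ℂ) d)
      ((starRingEnd ℂ) d) (θ : ℂ) := by
    simpa using ((hasDerivAt_id (θ : ℂ)).mul_const ((starRingEnd ℂ) d)).const_add
      ((starRingEnd ℂ) w)
  have h3 := (hasDerivAt_zpow (-((k : ℤ) + j)) v (Or.inl h)).comp (θ : ℂ) h1
  have h4 := h2.fun_pow j
  have h5 := h1.fun_mul h2
  have hN : v * (starRingEnd ℂ) v = ((normSq v : ℝ) : ℂ) := Complex.mul_conj v
  have hslit : v * (starRingEnd ℂ) v ∈ slitPlane := by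
    rw [hN]
    exact Complex.ofReal_mem_slitPlane.mpr (normSq_pos.mpr h)
  have h6 := h5.cpow_const (c := -s) (by rw [← hv, ← hvc]; exact hslit)
  have h7 := ((h3.mul h4).mul h6).comp_ofReal
  convert! h7 using 1
  · funext x
    simp only [Pi.mul_apply, Function.comp, heckeSummand]
    have : (starRingEnd ℂ) w + x * (starRingEnd ℂ) d = (starRingEnd ℂ) (w + x * d) := by simp
    rw [this, Complex.mul_conj]
  · simp only [Pi.mul_apply, Function.comp, heckeSummand]
    rw [← hv, ← hvc, hN, cpow_sub _ _ (by rw [← hN]; exact mul_ne_zero h hvc0), cpow_one, ← hN,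
      zpow_sub_one₀ h]
    have hj : (j : ℂ) * (starRingEnd ℂ) v ^ (j - 1) = j * (starRingEnd ℂ) v ^ j / (starRingEnd ℂ) v := by
      rcases Nat.eq_zero_or_pos j with rfl | hj
      · simp
      · obtain ⟨l, rfl⟩ : ∃ l, j = l + 1 := ⟨j - 1, by omega⟩
        rw [Nat.add_sub_cancel, pow_succ]
        field_simp
    rw [hj]
    push_cast
    field_simp

/-- The mean value inequality along the segment from `w` to `w + d` gains one power of `|w|`, so
that `k = 2` also reaches the exponent `-5/2`. The lower bound on `‖w‖` keeps the segment at
distance at least `‖w‖ / 2 ≥ 1` from `0`. -/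
theorem norm_heckeSummand_add_sub_le {k : ℕ} (hk : 2 ≤ k) (j : ℕ) {s w d : ℂ}
    (hs : -(1 / 4) < s.re) (hw : 2 * (‖d‖ + 1) ≤ ‖w‖) :
    ‖heckeSummand k j s (w + d) - heckeSummand k j s w‖ ≤
      (k + 2 * j + 2 * ‖s‖) * ‖d‖ * (‖w‖ / 2) ^ (-(5 / 2) : ℝ) := by
  have hd := norm_nonneg d
  have hbig : ∀ θ ∈ Set.Icc (0 : ℝ) 1, ‖w‖ / 2 ≤ ‖w + θ * d‖ := fun θ hθ => by
    have h1 : ‖w‖ ≤ ‖w + θ * d‖ + ‖(θ : ℂ) * d‖ := by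
      simpa using norm_sub_le (w + θ * d) (θ * d)
    have h2 : ‖(θ : ℂ) * d‖ ≤ ‖d‖ := by
      rw [norm_mul, norm_real, Real.norm_eq_abs, abs_of_nonneg hθ.1]
      exact mul_le_of_le_one_left hd hθ.2
    linarith
  have hw1 : 1 ≤ ‖w‖ / 2 := by linarith
  have hne : ∀ θ ∈ Set.Icc (0 : ℝ) 1, w + θ * d ≠ 0 := fun θ hθ h => by
    have := hbig θ hθ
    rw [h, norm_zero] at this
    linarith
  have h := norm_image_sub_le_of_norm_deriv_le_segment_01'
    (f := fun x : ℝ => heckeSummand k j s (w + x * d))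
    (C := (k + 2 * j + 2 * ‖s‖) * ‖d‖ * (‖w‖ / 2) ^ (-(5 / 2) : ℝ))
    (fun θ hθ => (hasDerivAt_heckeSummand_line k j s (hne θ hθ)).hasDerivWithinAt)
    (fun θ hθ => by
      have hθ' : θ ∈ Set.Icc (0 : ℝ) 1 := ⟨hθ.1, hθ.2.le⟩
      have hv := hbig θ hθ'
      have hv0 := hne θ hθ'
      set v := w + θ * d
      have hvpos : 0 < ‖v‖ := norm_pos_iff.mpr hv0
      have hq : ‖d / v‖ = ‖d‖ / ‖v‖ := norm_div _ _
      have hq' : ‖(starRingEnd ℂ) d / (starRingEnd ℂ) v‖ = ‖d‖ / ‖v‖ := by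
        rw [norm_div, RCLike.norm_conj, RCLike.norm_conj]
      have hk' : ‖(k : ℂ) + j‖ = k + j := by
        rw [← Nat.cast_add, Complex.norm_natCast, Nat.cast_add]
      rw [norm_mul]
      have hc : ‖-((k : ℂ) + j) * (d / v) + j * ((starRingEnd ℂ) d / (starRingEnd ℂ) v) +
          (-s) * (d / v + (starRingEnd ℂ) d / (starRingEnd ℂ) v)‖ ≤
          (k + 2 * j + 2 * ‖s‖) * (‖d‖ / ‖v‖) := by
        refine (norm_add₃_le).trans ?_
        rw [norm_mul, norm_mul, norm_mul, norm_neg, norm_neg, hq, hq', hk', Complex.norm_natCast]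
        have := norm_add_le (d / v) ((starRingEnd ℂ) d / (starRingEnd ℂ) v)
        rw [hq, hq'] at this
        have := mul_le_mul_of_nonneg_left this (norm_nonneg s)
        linarith
      have hk2 : (2 : ℝ) ≤ k := by exact_mod_cast hk
      calc _ ≤ (k + 2 * j + 2 * ‖s‖) * (‖d‖ / ‖v‖) * ‖heckeSummand k j s v‖ := by gcongr
        _ = (k + 2 * j + 2 * ‖s‖) * ‖d‖ * (‖v‖ ^ (-1 : ℝ) * ‖v‖ ^ (-(k : ℝ) - 2 * s.re)) := by
          rw [norm_heckeSummand k j s hv0, Real.rpow_neg_one]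
          ring
        _ ≤ (k + 2 * j + 2 * ‖s‖) * ‖d‖ * ‖v‖ ^ (-(5 / 2) : ℝ) := by
          rw [← Real.rpow_add hvpos]
          gcongr
          · linarith
          · linarith
        _ ≤ _ := by
          gcongr ?_ * ?_
          exact Real.rpow_le_rpow_of_nonpos (by linarith) hv (by norm_num))
  simpa using h

/-- For `k ≥ 3` each term is small. If instead the coefficients add up to zero, the value at `w` may
be subtracted from every term, and only differences remain. -/
theorem norm_sum_heckeSummand_le {ι : Type*} [Fintype ι] {k : ℕ} (hk : 2 ≤ k) (j : ℕ) {c d : ι → ℂ}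
    {D : ℝ} (hc : ∀ i, ‖c i‖ ≤ 1) (hd : ∀ i, ‖d i‖ ≤ D) (hk3 : 3 ≤ k ∨ ∑ i, c i = 0) {s w : ℂ}
    (hs : -(1 / 4) < s.re) (hD : 0 ≤ D) (hw : 2 * (D + 1) ≤ ‖w‖) :
    ‖∑ i, c i * heckeSummand k j s (w + d i)‖ ≤
      Fintype.card ι * ((1 + (k + 2 * j + 2 * ‖s‖) * D) * (‖w‖ / 2) ^ (-(5 / 2) : ℝ)) := by
  have hpos : 0 ≤ (‖w‖ / 2) ^ (-(5 / 2) : ℝ) := by positivity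
  have hbd : 0 ≤ (k + 2 * j + 2 * ‖s‖) * D * (‖w‖ / 2) ^ (-(5 / 2) : ℝ) := by positivity
  have key : ∃ e : ℂ, ∑ i, c i * heckeSummand k j s (w + d i) =
      ∑ i, c i * (heckeSummand k j s (w + d i) - e) ∧
      ∀ i, ‖heckeSummand k j s (w + d i) - e‖ ≤
        (1 + (k + 2 * j + 2 * ‖s‖) * D) * (‖w‖ / 2) ^ (-(5 / 2) : ℝ) := by
    rcases hk3 with hk3 | hc0
    · refine ⟨0, by simp, fun i => ?_⟩
      have hv : ‖w‖ / 2 ≤ ‖w + d i‖ := by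
        have h1 : ‖w‖ ≤ ‖w + d i‖ + ‖d i‖ := by simpa using norm_sub_le (w + d i) (d i)
        have := hd i
        linarith
      rw [sub_zero]
      have h1 := norm_heckeSummand_le hk3 j hs (w := w + d i) (by linarith)
      have h2 : ‖w + d i‖ ^ (-(5 / 2) : ℝ) ≤ (‖w‖ / 2) ^ (-(5 / 2) : ℝ) :=
        Real.rpow_le_rpow_of_nonpos (by linarith) hv (by norm_num)
      linarith
    · refine ⟨heckeSummand k j s w, ?_, fun i => ?_⟩
      · simp only [mul_sub, Finset.sum_sub_distrib, ← Finset.sum_mul, hc0, zero_mul, sub_zero]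
      · have h1 := norm_heckeSummand_add_sub_le hk j hs (w := w) (d := d i)
          (by have := hd i; linarith)
        have h2 : (k + 2 * j + 2 * ‖s‖) * ‖d i‖ * (‖w‖ / 2) ^ (-(5 / 2) : ℝ) ≤
            (k + 2 * j + 2 * ‖s‖) * D * (‖w‖ / 2) ^ (-(5 / 2) : ℝ) := by
          gcongr
          exact hd i
        linarith
  obtain ⟨e, he, hle⟩ := key
  rw [he]
  refine (norm_sum_le_of_le _ fun i _ => (?_ : _ ≤ (1 + (k + 2 * j + 2 * ‖s‖) * D) *
    (‖w‖ / 2) ^ (-(5 / 2) : ℝ))).trans (by simp)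
  rw [norm_mul]
  exact (mul_le_of_le_one_left (norm_nonneg _) (hc i)).trans (hle i)

theorem summable_norm_rpow_int_prod {a : ℝ} (ha : 2 < a) :
    Summable fun x : ℤ × ℤ => ‖x‖ ^ (-a) := by
  have h := EisensteinSeries.summable_one_div_norm_rpow ha
  rw [← (finTwoArrowEquiv ℤ).symm.summable_iff] at h
  refine h.congr fun x => ?_
  simp only [Function.comp]
  congr 1
  rw [EisensteinSeries.norm_eq_max_natAbs, Prod.norm_def]
  simp [Int.norm_eq_abs, Nat.cast_natAbs]

theorem exists_mul_norm_le {z : ℂ} (hz : 0 < z.im) :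
    ∃ r > 0, ∀ x : ℤ × ℤ, r * ‖x‖ ≤ ‖x.1 * z + x.2‖ := by
  refine ⟨EisensteinSeries.r ⟨z, hz⟩, EisensteinSeries.r_pos _, fun x => ?_⟩
  rcases eq_or_ne x 0 with rfl | hx
  · simp
  · have h := EisensteinSeries.r_mul_max_le ⟨z, hz⟩ (x := ![x.1, x.2]) (fun h => hx (by
      have h0 := congrFun h 0
      have h1 := congrFun h 1
      exact Prod.ext h0 h1))
    have hn : ‖(![x.1, x.2] : Fin 2 → ℤ)‖ = ‖x‖ := by
      rw [EisensteinSeries.norm_eq_max_natAbs, Prod.norm_def]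
      simp [Int.norm_eq_abs, Nat.cast_natAbs]
    rw [hn] at h
    exact h

/-- The sum over all residue classes modulo `M` of one block of a lattice sum. -/
noncomputable def latticeBlock (M : ℕ) (f : ℤ → ℤ → ℂ) (x : ℤ × ℤ) : ℂ :=
  ∑ r : Fin M × Fin M, f (x.1 * M + r.1) (x.2 * M + r.2)

theorem HasSum.sum_residues {M : ℕ} [NeZero M] {f : ℤ → ℂ} {S : ℂ} (h : HasSum f S) :
    HasSum (fun x : ℤ => ∑ r : Fin M, f (x * M + r)) S := by
  rw [← (Int.divModEquiv M).symm.hasSum_iff] at h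
  exact h.prod_fiberwise fun x => hasSum_fintype _

theorem HasSum.latticeBlock {M : ℕ} [NeZero M] {f : ℤ → ℤ → ℂ} {S : ℂ}
    (h : HasSum (fun v : ℤ × ℤ => f v.1 v.2) S) : HasSum (latticeBlock M f) S := by
  rw [← ((Equiv.prodProdProdComm ℤ ℤ (Fin M) (Fin M)).trans
    ((Int.divModEquiv M).symm.prodCongr (Int.divModEquiv M).symm)).hasSum_iff] at h
  exact h.prod_fiberwise fun x => hasSum_fintype _

/-- A lattice sum that converges when grouped into blocks agrees with the iterated sum. -/
theorem HasSum.eq_of_latticeBlock {M : ℕ} [NeZero M] {f : ℤ → ℤ → ℂ} {S T : ℂ} {R : ℤ → ℂ}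
    (hR : ∀ m, HasSum (f m) (R m)) (hS : HasSum R S) (hT : HasSum (_root_.latticeBlock M f) T) :
    T = S := by
  refine (hT.prod_fiberwise (g := fun x => ∑ r : Fin M, R (x * M + r)) fun x => ?_).unique
    hS.sum_residues
  have h := hasSum_sum fun (r : Fin M) (_ : r ∈ Finset.univ) =>
    (hR (x * M + r)).sum_residues (M := M)
  convert! h using 1
  funext y
  rw [_root_.latticeBlock, Fintype.sum_prod_type]

theorem finite_norm_lt_int_prod (X : ℝ) : {x : ℤ × ℤ | ‖x‖ < X}.Finite := by
  have : {x : ℤ × ℤ | ‖x‖ < X} = Metric.ball 0 X := by ext; simp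
  rw [this]
  exact (Metric.isBounded_ball.isCompact_closure.finite_of_discrete).subset subset_closure

/-- A twisted lattice sum of Hecke summands. -/
noncomputable def twistedSummand (c : ℤ → ℤ → ℂ) (z : ℂ) (k j : ℕ) (s : ℂ) (m n : ℤ) : ℂ :=
  c m n * heckeSummand k j s (m * z + n)

theorem differentiable_heckeSummand {k : ℕ} (hk : k ≠ 0) (j : ℕ) (w : ℂ) :
    Differentiable ℂ fun s => heckeSummand k j s w := by
  rcases eq_or_ne w 0 with rfl | hw
  · simp only [heckeSummand_zero hk]
    exact differentiable_const 0
  · have h : ((normSq w : ℝ) : ℂ) ≠ 0 := by simpa using hw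
    exact fun s => (differentiableAt_id.neg.const_cpow (Or.inl h)).const_mul _

theorem differentiable_latticeBlock {M : ℕ} {c : ℤ → ℤ → ℂ} {z : ℂ} {k j : ℕ} (hk : k ≠ 0)
    (x : ℤ × ℤ) : Differentiable ℂ fun s => latticeBlock M (twistedSummand c z k j s) x := by
  unfold latticeBlock twistedSummand
  exact Differentiable.fun_sum fun r _ => (differentiable_heckeSummand hk j _).const_mul _

/-- A summable majorant of the blocks, uniform for `s` in a bounded part of the half-plane: it
yields holomorphy of the sum and absolute convergence at `s = 0`. -/
theorem exists_summable_latticeBlock_bound {M : ℕ} [NeZero M] {c : ℤ → ℤ → ℂ}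
    (hc : ∀ m n, ‖c m n‖ ≤ 1) (hper : ∀ x y m n : ℤ, c (x * M + m) (y * M + n) = c m n)
    {k : ℕ} (hk : 2 ≤ k) (j : ℕ)
    (hk3 : 3 ≤ k ∨ ∑ r : Fin M × Fin M, c (r.1 : ℕ) (r.2 : ℕ) = 0) {z : ℂ} (hz : 0 < z.im)
    (B : ℝ) :
    ∃ g : ℤ × ℤ → ℝ, Summable g ∧ ∀ s : ℂ, -(1 / 4) < s.re → ‖s‖ ≤ B → ∀ x,
      ‖latticeBlock M (twistedSummand c z k j s) x‖ ≤ g x := by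
  classical
  obtain ⟨r, hr, hrle⟩ := exists_mul_norm_le hz
  have hM : (1 : ℝ) ≤ M := by exact_mod_cast NeZero.one_le
  -- `D` bounds the offsets of the points of a block from its corner.
  set D : ℝ := M * ‖z‖ + M with hD
  have hD0 : 0 ≤ D := by positivity
  have hblock : ∀ s x, latticeBlock M (twistedSummand c z k j s) x =
      ∑ r : Fin M × Fin M, c (r.1 : ℕ) (r.2 : ℕ) *
        heckeSummand k j s ((x.1 * z + x.2) * M + ((r.1 : ℕ) * z + (r.2 : ℕ))) := fun s x => by
    rw [latticeBlock]
    refine Finset.sum_congr rfl fun r _ => ?_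
    rw [twistedSummand, hper]
    congr 2
    push_cast
    ring
  have hd : ∀ r : Fin M × Fin M, ‖((r.1 : ℕ) : ℂ) * z + (r.2 : ℕ)‖ ≤ D := fun r => by
    refine (norm_add_le _ _).trans ?_
    rw [norm_mul, Complex.norm_natCast, Complex.norm_natCast, hD]
    have h1 : ((r.1 : ℕ) : ℝ) ≤ M := by exact_mod_cast r.1.2.le
    have h2 : ((r.2 : ℕ) : ℝ) ≤ M := by exact_mod_cast r.2.2.le
    gcongr
  -- Beyond `X` the corner is far enough from `0` for the decay estimate. The finitely many other
  -- blocks are bounded by compactness in `s`.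
  set X : ℝ := 2 * (D + 1) / r with hX
  have hX0 : 0 < X := by positivity
  have hfinite : ∀ x : ℤ × ℤ, ∃ b : ℝ, ∀ s : ℂ, ‖s‖ ≤ B →
      ‖latticeBlock M (twistedSummand c z k j s) x‖ ≤ b := fun x => by
    have hcont : Continuous fun s => latticeBlock M (twistedSummand c z k j s) x := by
      exact (differentiable_latticeBlock (by omega) x).continuous
    obtain ⟨b, hb⟩ := (isCompact_closedBall (0 : ℂ) B).exists_bound_of_continuousOn
      hcont.continuousOn
    exact ⟨b, fun s hs => hb s (by simpa using hs)⟩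
  choose b hb using hfinite
  set E : ℝ := Fintype.card (Fin M × Fin M) * ((1 + (k + 2 * j + 2 * B) * D) *
    (r / 2) ^ (-(5 / 2) : ℝ)) with hE
  refine ⟨fun x => if ‖x‖ < X then b x else E * ‖x‖ ^ (-(5 / 2) : ℝ), ?_, fun s hs hsB x => ?_⟩
  · refine ((summable_norm_rpow_int_prod (a := 5 / 2) (by norm_num)).mul_left E).congr_cofinite ?_
    filter_upwards [(finite_norm_lt_int_prod X).compl_mem_cofinite] with x hx
    have hx' : ¬ ‖x‖ < X := hx
    simp [hx']
  · by_cases hx : ‖x‖ < X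
    · simpa [hx] using hb x s hsB
    · simp only [hx, if_false]
      push Not at hx
      have hxpos : 0 < ‖x‖ := hX0.trans_le hx
      have hB : 0 ≤ B := (norm_nonneg s).trans hsB
      have hw : r * ‖x‖ ≤ ‖(x.1 * z + x.2) * M‖ := by
        rw [norm_mul, Complex.norm_natCast]
        exact (hrle x).trans (le_mul_of_one_le_right (norm_nonneg _) hM)
      have hw2 : 2 * (D + 1) ≤ ‖(x.1 * z + x.2) * M‖ := by
        refine le_trans ?_ hw
        rw [hX, div_le_iff₀ hr] at hx
        linarith
      rw [hblock]
      refine (norm_sum_heckeSummand_le hk j (fun _ => hc _ _) hd hk3 hs hD0 hw2).trans ?_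
      have h1 : (‖(x.1 * z + x.2) * M‖ / 2) ^ (-(5 / 2) : ℝ) ≤
          (r / 2) ^ (-(5 / 2) : ℝ) * ‖x‖ ^ (-(5 / 2) : ℝ) := by
        rw [← Real.mul_rpow (by positivity) (by positivity)]
        refine Real.rpow_le_rpow_of_nonpos (by positivity) ?_ (by norm_num)
        linarith
      calc _ ≤ (Fintype.card (Fin M × Fin M) : ℝ) * ((1 + (k + 2 * j + 2 * B) * D) *
            ((r / 2) ^ (-(5 / 2) : ℝ) * ‖x‖ ^ (-(5 / 2) : ℝ))) := by gcongr
        _ = _ := by rw [hE]; ring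

theorem summable_twistedSummand {c : ℤ → ℤ → ℂ} (hc : ∀ m n, ‖c m n‖ ≤ 1) {k : ℕ} (hk : 2 ≤ k)
    (j : ℕ) {z : ℂ} (hz : 0 < z.im) {s : ℂ} (hs : 1 < s.re) :
    Summable fun v : ℤ × ℤ => twistedSummand c z k j s v.1 v.2 := by
  obtain ⟨r, hr, hrle⟩ := exists_mul_norm_le hz
  have hk2 : (2 : ℝ) ≤ k := by exact_mod_cast hk
  refine Summable.of_norm_bounded ((summable_norm_rpow_int_prod (a := k + 2 * s.re)
    (by linarith)).mul_left (r ^ (-(k + 2 * s.re)))) fun v => ?_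
  rw [twistedSummand, norm_mul]
  refine (mul_le_of_le_one_left (norm_nonneg _) (hc _ _)).trans ?_
  rcases eq_or_ne v 0 with rfl | hv
  · simp only [Prod.fst_zero, Prod.snd_zero, Int.cast_zero, zero_mul, add_zero,
      heckeSummand_zero (show k ≠ 0 by omega), norm_zero]
    positivity
  · have hvpos : 0 < ‖v‖ := norm_pos_iff.mpr hv
    have hw := hrle v
    have hw0 : (v.1 * z + v.2 : ℂ) ≠ 0 := by
      rw [← norm_pos_iff]
      exact (mul_pos hr hvpos).trans_le hw
    rw [norm_heckeSummand k j s hw0, ← Real.mul_rpow hr.le hvpos.le]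
    rw [show -(k : ℝ) - 2 * s.re = -(k + 2 * s.re) by ring]
    exact Real.rpow_le_rpow_of_nonpos (mul_pos hr hvpos) hw (by linarith)

/-- Analytic continuation of a twisted lattice sum; its value at `0` is the iterated sum. -/
theorem exists_continuation_twistedSummand {M : ℕ} [NeZero M] {c : ℤ → ℤ → ℂ}
    (hc : ∀ m n, ‖c m n‖ ≤ 1) (hper : ∀ x y m n : ℤ, c (x * M + m) (y * M + n) = c m n)
    {k : ℕ} (hk : 2 ≤ k) (j : ℕ)
    (hk3 : 3 ≤ k ∨ ∑ r : Fin M × Fin M, c (r.1 : ℕ) (r.2 : ℕ) = 0) {z : ℂ} (hz : 0 < z.im)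
    {R : ℤ → ℂ} {S : ℂ} (hR : ∀ m, HasSum (twistedSummand c z k j 0 m) (R m)) (hS : HasSum R S) :
    ∃ F : ℂ → ℂ, DifferentiableOn ℂ F {s | -(1 / 4) < s.re} ∧
      (∀ s : ℂ, 1 < s.re → HasSum (fun v : ℤ × ℤ => twistedSummand c z k j s v.1 v.2) (F s)) ∧
      F 0 = S := by
  refine ⟨fun s => ∑' x, latticeBlock M (twistedSummand c z k j s) x, ?_, fun s hs => ?_, ?_⟩
  · intro s hs
    obtain ⟨g, hg, hgle⟩ := exists_summable_latticeBlock_bound hc hper hk j hk3 hz (‖s‖ + 1)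
    have hopen : IsOpen ({w : ℂ | -(1 / 4) < w.re} ∩ Metric.ball 0 (‖s‖ + 1)) :=
      (isOpen_lt continuous_const continuous_re).inter Metric.isOpen_ball
    have h := Complex.differentiableOn_tsum_of_summable_norm hg
      (F := fun x s => latticeBlock M (twistedSummand c z k j s) x)
      (fun x => (differentiable_latticeBlock (by omega) x).differentiableOn) hopen
      (fun x w hw => hgle w hw.1 (by simpa using (mem_ball_zero_iff.mp hw.2).le) x)
    exact (h.differentiableAt (hopen.mem_nhds ⟨hs, by simp⟩)).differentiableWithinAt
  · have h := (summable_twistedSummand hc hk j hz hs).hasSum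
    convert! h using 1
    exact (HasSum.latticeBlock (M := M) h).tsum_eq
  -- At `s = 0` the block sum converges absolutely, so it may be evaluated one row of blocks at a
  -- time, which gives the iterated sum.
  · obtain ⟨g, hg, hgle⟩ := exists_summable_latticeBlock_bound hc hper hk j hk3 hz 0
    have h : Summable (latticeBlock M (twistedSummand c z k j 0)) :=
      Summable.of_norm_bounded hg (hgle 0 (by norm_num) (by simp))
    exact HasSum.eq_of_latticeBlock hR hS h.hasSum

theorem sum_residues_mul_eq_zero {u t : ℕ} [NeZero u] {g : ZMod u → ℂ}
    (hg : ∑ a, g a = 0) : ∑ r : Fin (t * u), g ((r : ℕ) : ZMod u) = 0 := by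
  rw [← finProdFinEquiv.sum_comp, Fintype.sum_prod_type]
  refine Finset.sum_eq_zero fun x _ => ?_
  obtain ⟨u, rfl⟩ := Nat.exists_eq_succ_of_ne_zero (NeZero.ne u)
  rw [← hg]
  refine Finset.sum_congr rfl fun y _ => ?_
  congr 1
  simp only [finProdFinEquiv_apply_val, Nat.cast_add, Nat.cast_mul, CharP.cast_eq_zero, zero_mul,
    add_zero]
  exact Fin.cast_val_eq_self y

theorem DirichletCharacter.IsPrimitive.sum_eq_zero {N : ℕ} [NeZero N]
    {ψ : DirichletCharacter ℂ N} (hψ : ψ.IsPrimitive) (hN : N ≠ 1) : ∑ a, ψ a = 0 := by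
  refine MulChar.sum_eq_zero_of_ne_one ?_
  rintro rfl
  rw [DirichletCharacter.isPrimitive_def, DirichletCharacter.conductor_one] at hψ
  exact hN hψ.symm

/-- The sum factors, and the factor of a nontrivial primitive character vanishes. This supplies the
cancellation needed in weight `2` and explains the exclusion of two trivial characters there. -/
theorem sum_residues_dirichlet_eq_zero {u t : ℕ} [NeZero u] [NeZero t]
    {ψ₁ : DirichletCharacter ℂ u} {ψ₂ : DirichletCharacter ℂ t} (hψ₁ : ψ₁.IsPrimitive)
    (hψ₂ : ψ₂.IsPrimitive) (h : u * t ≠ 1) :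
    ∑ r : Fin (u * t) × Fin (u * t),
      ψ₁ ((r.1 : ℕ) : ZMod u) * ψ₂ ((r.2 : ℕ) : ZMod t) = 0 := by
  rw [Fintype.sum_prod_type]
  simp only [← Finset.mul_sum, ← Finset.sum_mul]
  rcases eq_or_ne t 1 with ht | ht
  · have hu : u ≠ 1 := by rintro rfl; simp [ht] at h
    have h1 : ∑ r : Fin (t * u), ψ₁ ((r : ℕ) : ZMod u) = 0 :=
      sum_residues_mul_eq_zero (hψ₁.sum_eq_zero hu)
    rw [mul_comm u t, h1, zero_mul]
  · rw [sum_residues_mul_eq_zero (hψ₂.sum_eq_zero ht), mul_zero]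

end LatticeSums

/-! ### The value of the Hecke `L`-function as a sum over CM points -/

theorem hasSum_prod_of_fintype {C V : Type*} [Fintype C] {g : C → V → ℂ} {S : C → ℂ}
    (h : ∀ c, HasSum (g c) (S c)) : HasSum (fun p : C × V => g p.1 p.2) (∑ c, S c) := by
  classical
  have h1 : ∀ c : C, HasSum (fun p : C × V => if p.1 = c then g c p.2 else 0) (S c) := fun c => by
    refine (Function.Injective.hasSum_iff (g := fun v : V => (c, v))
      (fun _ _ h => (Prod.ext_iff.mp h).2) ?_).mp ?_
    · rintro ⟨c', v⟩ hv
      have : c' ≠ c := by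
        rintro rfl
        exact hv ⟨v, rfl⟩
      simp [this]
    · simpa [Function.comp_def] using h c
  convert! hasSum_sum fun c (_ : c ∈ Finset.univ) => h1 c using 1
  funext p
  simp

/-- Otherwise the Fourier transform of `ψ` would vanish, against Fourier inversion. -/
theorem DirichletCharacter.IsPrimitive.gaussSum_ne_zero {N : ℕ} [NeZero N]
    {ψ : DirichletCharacter ℂ N} (hψ : ψ.IsPrimitive) :
    gaussSum ψ (ZMod.stdAddChar (N := N)) ≠ 0 := by
  intro h
  have h1 : ZMod.dft ⇑ψ = 0 := by
    funext x
    rw [hψ.fourierTransform_eq_inv_mul_gaussSum, h, mul_zero]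
    rfl
  have h2 := congrFun (ZMod.dft_dft ⇑ψ) (-1)
  rw [h1, map_zero, neg_neg, map_one] at h2
  have : (N : ℂ) = 0 := by simpa using h2.symm
  exact NeZero.ne N (by exact_mod_cast this)

section CMValue

variable {K : Type*} [Field K] [NumberField K] [Algebra.IsQuadraticExtension ℚ K]
  [IsTotallyComplex K] {σ : K →+* ℂ} {u t : ℕ} [NeZero u] [NeZero t]
  {ψ₁ : DirichletCharacter ℂ u} {ψ₂ : DirichletCharacter ℂ t} {𝔲 𝔱 : Ideal (𝓞 K)}

/-- The terms of the Hecke `L`-series on one ideal class. -/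
theorem SplitFiniteType.toHom_mul_absNorm_cpow {k j : ℕ}
    {χ : HeckeCharacter σ ((k : ℤ) + j) (-(j : ℤ))} (S : SplitFiniteType χ ψ₁ ψ₂ 𝔲 𝔱)
    (hψ₁ : ψ₁.IsPrimitive) (hψ₂ : ψ₂.IsPrimitive) {δ β : 𝓞 K}
    (hδ : β - integersConj σ β = δ) (hδ𝔲 : IsCoprime (Ideal.span {δ}) 𝔲) {I 𝔟 : Ideal (𝓞 K)}
    (hI : I ≠ ⊥) (hI𝔲 : I ≤ 𝔲) (hβ : β ∈ I * 𝔱)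
    (hnorm : I * conjIdeal σ I = Ideal.span {(Ideal.absNorm I : 𝓞 K)})
    (hcop : IsCoprime (conjIdeal σ I) (𝔲 * 𝔱)) {z : ℂ} (hz : σ β = Ideal.absNorm I * z)
    {m n : ℤ} (hα0 : (m * β + n * (Ideal.absNorm I : 𝓞 K)) ≠ 0)
    (h𝔟 : I * 𝔟 = Ideal.span {m * β + n * (Ideal.absNorm I : 𝓞 K)}) (s : ℂ) :
    ((ψ₁.heckeBaseChange σ).mul χ.inv).toHom 𝔟 * (Ideal.absNorm 𝔟 : ℂ) ^ (-s) =
      ψ₁ (S.e𝔲 (Ideal.Quotient.mk 𝔲 (-δ))) * (χ.toHom (conjIdeal σ I))⁻¹ *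
        (Ideal.absNorm I : ℂ) ^ (-s) *
        twistedSummand (fun m n => ψ₁ (m : ZMod u) * ψ₂⁻¹ (n : ZMod t)) z k j s m n := by
  have hA0 : (Ideal.absNorm I : ℂ) ≠ 0 := by
    rw [Nat.cast_ne_zero, Ne, Ideal.absNorm_eq_zero_iff]; exact hI
  set A := Ideal.absNorm I with hA
  set α : 𝓞 K := m * β + n * (A : 𝓞 K) with hα
  have hσα : σ α = A * (m * z + n) := by
    rw [← embeddingIntegers_apply, hα]
    simp only [map_add, map_mul, map_intCast, map_natCast]
    rw [embeddingIntegers_apply, hz]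
    ring
  have hσA : σ ((A : 𝓞 K) : K) = A := by
    rw [← embeddingIntegers_apply, map_natCast]
  have hconjA : (starRingEnd ℂ) (A : ℂ) = A := Complex.conj_natCast A
  have hW0 : (m * z + n : ℂ) ≠ 0 := by
    intro h
    rw [h, mul_zero] at hσα
    exact hα0 (embedding_integers_injective σ (by simpa using hσα))
  -- From `A N(𝔟) = |α|² = A² |mz + n|²`. In the infinity types the powers of `A` cancel, so only
  -- `A^(-s)` survives.
  have hN : (Ideal.absNorm 𝔟 : ℂ) = (A : ℝ) * (normSq (m * z + n) : ℝ) := by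
    have h1 : (A * Ideal.absNorm 𝔟 : 𝓞 K) = α * integersConj σ α := by
      rw [← coe_absNorm_span_singleton σ, ← h𝔟, map_mul, Nat.cast_mul]
    have h2 := congrArg (embeddingIntegers σ) h1
    simp only [map_mul, map_natCast] at h2
    rw [embeddingIntegers_apply, embeddingIntegers_apply, embedding_integersConj, hσα, map_mul,
      hconjA] at h2
    have h3 : (A : ℂ) * (m * z + n) * (A * (starRingEnd ℂ) (m * z + n)) =
        A * (A * ((m * z + n) * (starRingEnd ℂ) (m * z + n))) := by ring
    rw [h3, Complex.mul_conj] at h2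
    simpa using mul_left_cancel₀ hA0 h2
  rw [S.toHom_of_mul_eq_span hψ₁ hψ₂ hδ hδ𝔲 hI hI𝔲 hβ hnorm hcop hα0 hα h𝔟, hN,
    Complex.mul_cpow_ofReal_nonneg (Nat.cast_nonneg A) (normSq_nonneg _), twistedSummand,
    heckeSummand, infinityType, infinityType, hσα, hσA, map_mul, hconjA,
    MulChar.inv_apply_eq_inv', ofReal_natCast]
  have e1 : (0 + -((k : ℤ) + j)) = -((k : ℤ) + j) := by ring
  have e2 : (0 + - -(j : ℤ)) = (j : ℤ) := by ring
  rw [e1, e2, mul_zpow, mul_zpow, zpow_natCast, zpow_natCast]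
  have hAz : (A : ℂ) ^ (-((k : ℤ) + j)) ≠ 0 := zpow_ne_zero _ hA0
  generalize (A : ℂ) ^ (-((k : ℤ) + j)) = U at *
  generalize (m * z + n : ℂ) ^ (-((k : ℤ) + j)) = V at *
  field_simp

/-- The continuation of the lattice sum attached to a CM point. -/
theorem exists_continuation_eisenstein {k j : ℕ} (hk : 2 ≤ k) (hψ₁ : ψ₁.IsPrimitive)
    (hψ₂ : ψ₂.IsPrimitive) (hpar : ψ₁ (-1) * ψ₂ (-1) = (-1) ^ k) (hE2 : k = 2 → u * t ≠ 1)
    {τ : ℂ} (hτ : 0 < τ.im) :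
    ∃ F : ℂ → ℂ, DifferentiableOn ℂ F {s | -(1 / 4) < s.re} ∧
      (∀ s : ℂ, 1 < s.re → HasSum (fun v : ℤ × ℤ => twistedSummand
        (fun m n => ψ₁ (m : ZMod u) * ψ₂⁻¹ (n : ZMod t)) (t * τ) k j s v.1 v.2) (F s)) ∧
      F 0 = 2 * eisensteinFactor k ψ₂ * (2 * Real.pi * I) ^ j / k.ascFactorial j *
        (τ - (starRingEnd ℂ) τ) ^ j * maassShimuraIter k j (twistedEisenstein k ψ₁ ψ₂) τ := by
  obtain ⟨R, hR, hS⟩ := exists_hasSum_maassShimuraIter hk hψ₁ hψ₂ hpar hτ j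
  have htpos : (0 : ℝ) < t := by exact_mod_cast Nat.pos_of_ne_zero (NeZero.ne t)
  have hz : 0 < ((t : ℂ) * τ).im := by simpa using mul_pos htpos hτ
  have : NeZero (u * t) := ⟨mul_ne_zero (NeZero.ne u) (NeZero.ne t)⟩
  -- Blocks of side `ut`, a common period of the two characters.
  refine exists_continuation_twistedSummand (M := u * t)
    (c := fun m n => ψ₁ (m : ZMod u) * ψ₂⁻¹ (n : ZMod t)) (fun m n => ?_) (fun x y m n => ?_) hk j
    ?_ hz (R := R) (fun m => ?_) hS
  · rw [norm_mul]
    exact mul_le_one₀ (ψ₁.norm_le_one _) (norm_nonneg _) (ψ₂⁻¹.norm_le_one _)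
  · simp
  · rcases Nat.lt_or_ge 2 k with h | h
    · exact Or.inl h
    · refine Or.inr ?_
      simpa using sum_residues_dirichlet_eq_zero hψ₁ hψ₂.inv (hE2 (by omega))
  · convert! hR m using 1
    funext n
    rw [twistedSummand, heckeSummand, neg_zero, cpow_zero, mul_one]
    simp [mul_assoc]

omit [Algebra.IsQuadraticExtension ℚ K] [IsTotallyComplex K] in
/-- The `L`-value of a Hecke character whose `L`-series on each ideal class is a lattice sum. -/
theorem HeckeCharacter.hasLValueAt_zero_of_lattices {a b : ℤ} (ξ : HeckeCharacter σ a b)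
    {I : ClassGroup (𝓞 K) → nonZeroDivisors (Ideal (𝓞 K))}
    (hI : Function.Bijective fun C => ClassGroup.mk0 (I C)) {β : ClassGroup (𝓞 K) → 𝓞 K}
    {A : ClassGroup (𝓞 K) → ℕ} (hA : ∀ C, A C ≠ 0)
    (hmem : ∀ C x, x ∈ (I C : Ideal (𝓞 K)) ↔ ∃ m n : ℤ, x = m * β C + n * (A C : 𝓞 K))
    (hinj : ∀ C (m n m' n' : ℤ), (m * β C + n * (A C : 𝓞 K) : 𝓞 K) = m' * β C + n' * (A C : 𝓞 K) →
      m = m' ∧ n = n')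
    (hunit : ∀ x : 𝓞 K, IsUnit x → x = 1 ∨ x = -1) {f : ClassGroup (𝓞 K) → ℂ → ℤ × ℤ → ℂ}
    (hf0 : ∀ C s, f C s 0 = 0) {F : ClassGroup (𝓞 K) → ℂ → ℂ}
    (hFdiff : ∀ C, DifferentiableOn ℂ (F C) {s | -(1 / 4) < s.re})
    (hFsum : ∀ C (s : ℂ), 1 < s.re → HasSum (f C s) (F C s)) {c : ClassGroup (𝓞 K) → ℂ}
    (hval : ∀ C (v : ℤ × ℤ) (𝔟 : Ideal (𝓞 K)) (s : ℂ), (v.1 * β C + v.2 * (A C : 𝓞 K)) ≠ 0 →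
      (I C : Ideal (𝓞 K)) * 𝔟 = Ideal.span {v.1 * β C + v.2 * (A C : 𝓞 K)} →
      ξ.toHom 𝔟 * (Ideal.absNorm 𝔟 : ℂ) ^ (-s) = c C * (A C : ℂ) ^ (-s) * f C s v) :
    ξ.HasLValueAt 0 (∑ C, c C * F C 0 / 2) := by
  refine ⟨fun s => (∑ C, c C * (A C : ℂ) ^ (-s) * F C s) / 2, -(1 / 4), 1, by norm_num, ?_,
    fun s hs => ?_, by simp [Finset.sum_div]⟩
  · refine DifferentiableOn.div_const (DifferentiableOn.fun_sum fun C _ => ?_) 2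
    refine DifferentiableOn.mul (Differentiable.differentiableOn fun s => ?_) (hFdiff C)
    exact (differentiableAt_id.neg.const_cpow
      (Or.inl (Nat.cast_ne_zero.mpr (hA C)))).const_mul _
  · refine hasSum_ideals_of_hasSum_lattices hI (β := β) (A := fun C => (A C : 𝓞 K)) hmem hinj hunit
      (g := fun C v => c C * (A C : ℂ) ^ (-s) * f C s v) ?_ (fun C => ?_)
      (fun C v 𝔟 hv h𝔟 => (hval C v 𝔟 s (fun h => hv ?_) h𝔟).symm)
      (hasSum_prod_of_fintype fun C => (hFsum C s hs).mul_left (c C * (A C : ℂ) ^ (-s)))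
    · rw [← Ideal.zero_eq_bot, map_zero, zero_mul]
    · rw [hf0, mul_zero]
    · have h2 := hinj C v.1 v.2 0 0 (by rw [h]; simp)
      exact Prod.ext h2.1 h2.2

end CMValue

/-- Comparison of the constants in the two expressions for the `L`-value. -/
theorem eisensteinFactor_constants {k j t A : ℕ} [NeZero t] (hk : 2 ≤ k) (hA : A ≠ 0)
    {ψ : DirichletCharacter ℂ t} (hψ : ψ.IsPrimitive) {X Y Q d : ℂ} (hX : X ≠ 0) (hY : Y ≠ 0)
    (hQ : Q ≠ 0) (hd : d ≠ 0) (E : ℂ) :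
    (Y * X * ((A * t : ℕ) : ℂ) ^ j)⁻¹ * E =
      (-1) ^ k * ((t : ℂ) ^ k * Complex.Gamma ((k : ℂ) + j) * Q⁻¹ * X⁻¹) /
        ((2 * Real.pi * I) ^ (k + j) * gaussSum ψ⁻¹ (ZMod.stdAddChar (N := t)) * d ^ j) *
      (Q * Y⁻¹ * (2 * eisensteinFactor k ψ * (2 * Real.pi * I) ^ j / k.ascFactorial j *
        (d / (A * t)) ^ j * E) / 2) := by
  have htc : (t : ℂ) ≠ 0 := Nat.cast_ne_zero.mpr (NeZero.ne t)
  have hAC : (A : ℂ) ≠ 0 := Nat.cast_ne_zero.mpr hA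
  have hg := hψ.inv.gaussSum_ne_zero
  have hπ := Complex.two_pi_I_ne_zero
  have hf1 : ((k - 1).factorial : ℂ) ≠ 0 := Nat.cast_ne_zero.mpr (Nat.factorial_ne_zero _)
  have hf2 : (k.ascFactorial j : ℂ) ≠ 0 := by
    obtain ⟨l, rfl⟩ : ∃ l, k = l + 1 := ⟨k - 1, by omega⟩
    exact Nat.cast_ne_zero.mpr (Nat.ascFactorial_pos l j).ne'
  have hgamma : Complex.Gamma ((k : ℂ) + j) = (k - 1).factorial * k.ascFactorial j := by
    rw [← Nat.cast_mul, Nat.factorial_mul_ascFactorial' _ _ (by omega),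
      ← Complex.Gamma_nat_eq_factorial, Nat.cast_sub (by omega)]
    push_cast
    congr 1
    ring
  -- The sign `(-1)^k` of the final formula comes from the `-2πi` of the Lipschitz formula.
  have hneg : (-2 * Real.pi * I : ℂ) ^ k = (-1) ^ k * (2 * Real.pi * I) ^ k := by
    rw [← mul_pow]; congr 1; ring
  have hsign : (-1 : ℂ) ^ k * (-1) ^ k = 1 := by rw [← mul_pow]; simp
  rw [hgamma, eisensteinFactor, hneg, zpow_neg, zpow_natCast, pow_add, div_pow]
  push_cast
  generalize (2 * Real.pi * I : ℂ) = P at *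
  generalize gaussSum ψ⁻¹ (ZMod.stdAddChar (N := t)) = g at *
  field_simp
  linear_combination -E * hsign

/-! ### The main formula -/

theorem mainTheorem11 {K : Type*} [Field K] [NumberField K]
    [Algebra.IsQuadraticExtension ℚ K] [IsTotallyComplex K] (σ : K →+* ℂ)
    (hodd : Odd (discr K)) (hD : discr K < -4)
    (δ : 𝓞 K) (hδ : δ ^ 2 = (discr K : 𝓞 K)) (hδim : 0 < (σ δ).im)
    (k j u t : ℕ) (hk : 2 ≤ k) [NeZero u] [NeZero t]
    (ψ₁ : DirichletCharacter ℂ u) (ψ₂ : DirichletCharacter ℂ t)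
    (hψ₁ : ψ₁.IsPrimitive) (hψ₂ : ψ₂.IsPrimitive)
    (hparity : ψ₁ (-1) * ψ₂ (-1) = (-1) ^ k)
    (hE2 : k = 2 → u * t ≠ 1)
    (hHeegner : ∀ ℓ : ℕ, ℓ.Prime → ℓ ∣ u * t → ∃ v w : Ideal (𝓞 K),
      v.IsPrime ∧ w.IsPrime ∧ v ≠ w ∧ Ideal.span {(ℓ : 𝓞 K)} = v * w)
    (𝔑 𝔲 𝔱 : Ideal (𝓞 K)) (h𝔑 : 𝔑 = 𝔲 * 𝔱)
    (e𝔑 : (𝓞 K ⧸ 𝔑) ≃+* ZMod (u * t)) (e𝔲 : (𝓞 K ⧸ 𝔲) ≃+* ZMod u) (e𝔱 : (𝓞 K ⧸ 𝔱) ≃+* ZMod t)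
    (χ : HeckeCharacter σ ((k : ℤ) + j) (-(j : ℤ)))
    (hχ : χ.IsOfFiniteType 𝔑 (ψ₁.primitive_mul ψ₂))
    (𝔞 : ClassGroup (𝓞 K) → nonZeroDivisors (Ideal (𝓞 K)))
    (h𝔞class : ∀ C, ClassGroup.mk0 (𝔞 C) = C)
    (h𝔞prim : ∀ C, IsPrimitiveIdeal (𝔞 C : Ideal (𝓞 K)))
    (h𝔞coprime : ∀ C, IsCoprime (𝔞 C : Ideal (𝓞 K)) (Ideal.span {((u * t : ℕ) : 𝓞 K)}))
    (τ : ClassGroup (𝓞 K) → ℂ) (hτ : ∀ C, IsCMPoint σ δ ((𝔞 C : Ideal (𝓞 K)) * 𝔑) (τ C)) :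
    ∃ Lvalue : ℂ, ((ψ₁.heckeBaseChange σ).mul χ.inv).HasLValueAt 0 Lvalue ∧
      ∑ C : ClassGroup (𝓞 K),
        (χ.normTwist j (conjIdeal σ ((𝔞 C : Ideal (𝓞 K)) * 𝔑)))⁻¹ *
          maassShimuraIter k j (twistedEisenstein k ψ₁ ψ₂) (τ C) =
      (-1) ^ k *
        ((t : ℂ) ^ k * Complex.Gamma ((k : ℂ) + j) *
          (ψ₁ (e𝔲 (Ideal.Quotient.mk 𝔲 (-δ))))⁻¹ * (χ.toHom (conjIdeal σ 𝔱))⁻¹) /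
        ((2 * Real.pi * I) ^ (k + j) * gaussSum ψ₂⁻¹ (ZMod.stdAddChar (N := t)) * (σ δ) ^ j) *
        Lvalue := by
  classical
  subst h𝔑
  have hu0 : u ≠ 0 := NeZero.ne u
  have ht0 : t ≠ 0 := NeZero.ne t
  have htc : (t : ℂ) ≠ 0 := Nat.cast_ne_zero.mpr ht0
  have h𝔲norm : Ideal.absNorm 𝔲 = u := absNorm_of_ringEquiv e𝔲
  have h𝔱norm : Ideal.absNorm 𝔱 = t := absNorm_of_ringEquiv e𝔱
  have h𝔲0 : 𝔲 ≠ ⊥ := fun h => hu0 (by rw [← h𝔲norm, h]; simp)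
  have h𝔱0 : 𝔱 ≠ ⊥ := fun h => ht0 (by rw [← h𝔱norm, h]; simp)
  have h𝔞0 : ∀ C, (𝔞 C : Ideal (𝓞 K)) ≠ ⊥ := fun C => mem_nonZeroDivisors_iff_ne_zero.mp (𝔞 C).2
  choose b β hβ hmem hτeq using hτ
  -- The lattices are those of `𝔞𝔲`, not `𝔞𝔲𝔱`: the missing `𝔱` turns `τ` into `tτ` and leaves
  -- `χ(conj 𝔱)` in the final constant.
  set 𝔦 : ClassGroup (𝓞 K) → nonZeroDivisors (Ideal (𝓞 K)) := fun C =>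
    𝔞 C * ⟨𝔲, mem_nonZeroDivisors_iff_ne_zero.mpr h𝔲0⟩ with hIdef
  have hIcoe : ∀ C, (𝔦 C : Ideal (𝓞 K)) = 𝔞 C * 𝔲 := fun C => rfl
  have hJ : ∀ C, (𝔞 C : Ideal (𝓞 K)) * (𝔲 * 𝔱) = 𝔦 C * 𝔱 := fun C => by rw [hIcoe, mul_assoc]
  have hI0 : ∀ C, (𝔦 C : Ideal (𝓞 K)) ≠ ⊥ := fun C => mul_ne_zero (h𝔞0 C) h𝔲0
  have hJ0 : ∀ C, (𝔞 C : Ideal (𝓞 K)) * (𝔲 * 𝔱) ≠ ⊥ := fun C => by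
    rw [hJ]; exact mul_ne_zero (hI0 C) h𝔱0
  have hJI : ∀ C, (𝔞 C : Ideal (𝓞 K)) * (𝔲 * 𝔱) ≤ 𝔦 C := fun C => by
    rw [hJ]; exact Ideal.mul_le_left
  have hβJ : ∀ C, β C ∈ (𝔞 C : Ideal (𝓞 K)) * (𝔲 * 𝔱) := fun C =>
    (hmem C _).mpr ⟨1, 0, by simp⟩
  have hImem := fun C => mem_iff_of_isCMPoint_of_le hδim (hβ C) (hJ0 C) (hmem C) (hJI C)
  have hspan := exists_eq_intCast_add_mul hδim (hβ 1) (hJ0 1) (hmem 1)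
  have hunit : ∀ x : 𝓞 K, IsUnit x → x = 1 ∨ x = -1 := fun x hx =>
    eq_one_or_neg_one_of_isUnit hδim (hβ 1) hspan hD hδ hx
  have hsub := fun C => sub_integersConj_eq hδim hδ (hβ C)
  have hN𝔑 : ((u * t : ℕ) : 𝓞 K) ∈ 𝔲 * 𝔱 := by
    have h := Ideal.absNorm_mem (𝔲 * 𝔱)
    rwa [map_mul, h𝔲norm, h𝔱norm] at h
  have hle : Ideal.span {((u * t : ℕ) : 𝓞 K)} ≤ 𝔲 * 𝔱 :=
    (Ideal.span_singleton_le_iff_mem _).mpr hN𝔑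
  have hδN := isCoprime_span_delta hδim (hβ 1) hspan hodd hδ (mul_ne_zero hu0 ht0) hHeegner
  have hδ𝔲 : IsCoprime (Ideal.span {δ}) 𝔲 := IsCoprime.of_isCoprime_of_dvd_right hδN
    (Ideal.dvd_iff_le.mpr (hle.trans Ideal.mul_le_left))
  have hcc : IsCoprime (conjIdeal σ (𝔲 * 𝔱)) (𝔲 * 𝔱) :=
    isCoprime_conjIdeal_self (hsub 1) (Ideal.mul_le_right (hβJ 1)) hN𝔑 hδN
  let S : SplitFiniteType χ ψ₁ ψ₂ 𝔲 𝔱 := ⟨e𝔑, e𝔲, e𝔱, hχ, hcc⟩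
  have hcc' := hcc
  rw [conjIdeal_mul] at hcc'
  have hcop𝔱 : IsCoprime (conjIdeal σ 𝔱) (𝔲 * 𝔱) := hcc'.of_mul_left_right
  have hcopI : ∀ C, IsCoprime (conjIdeal σ (𝔦 C : Ideal (𝓞 K))) (𝔲 * 𝔱) := fun C => by
    rw [hIcoe, conjIdeal_mul]
    refine IsCoprime.mul_left ?_ hcc'.of_mul_left_left
    have h := isCoprime_conjIdeal σ (h𝔞coprime C)
    rw [conjIdeal_span, map_natCast] at h
    exact IsCoprime.of_isCoprime_of_dvd_right h (Ideal.dvd_iff_le.mpr hle)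
  have hcyc : ∀ C (x : 𝓞 K), ∃ n : ℤ, x - n ∈ (𝔦 C : Ideal (𝓞 K)) := fun C x => by
    obtain ⟨n, hn⟩ := cyclic_of_isCMPoint hδim (hβ C) (hJ0 C) (hmem C) x
    exact ⟨n, hJI C hn⟩
  have hnorm := fun C => mul_conjIdeal_eq (σ := σ) (hI0 C) (hcyc C) (hImem C)
  set A : ClassGroup (𝓞 K) → ℕ := fun C => Ideal.absNorm (𝔦 C : Ideal (𝓞 K)) with hAdef
  have hA0 : ∀ C, A C ≠ 0 := fun C => by
    rw [hAdef, Ne, Ideal.absNorm_eq_zero_iff]; exact hI0 C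
  have hAc : ∀ C, (A C : ℂ) ≠ 0 := fun C => Nat.cast_ne_zero.mpr (hA0 C)
  have hJnorm : ∀ C, Ideal.absNorm ((𝔞 C : Ideal (𝓞 K)) * (𝔲 * 𝔱)) = A C * t := fun C => by
    rw [hJ, map_mul, h𝔱norm]
  have hσβ : ∀ C, σ (β C) = A C * (t * τ C) := fun C => by
    have h := congrArg (embeddingIntegers σ) (hβ C)
    simp only [map_add, map_mul, map_ofNat, map_intCast, embeddingIntegers_apply] at h
    rw [hτeq, hJnorm, ← h]
    push_cast
    have := hAc C
    field_simp
  have hτim : ∀ C, 0 < (τ C).im := fun C => by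
    have h := im_embedding_of_two_mul_eq (σ := σ) (hβ C)
    rw [hσβ, ← mul_assoc, ← Nat.cast_mul, ← ofReal_natCast, im_ofReal_mul] at h
    have h1 : (0 : ℝ) < (A C * t : ℕ) := by
      exact_mod_cast Nat.pos_of_ne_zero (mul_ne_zero (hA0 C) ht0)
    have h2 : 0 < ((A C * t : ℕ) : ℝ) * (τ C).im := by linarith
    exact (mul_pos_iff_of_pos_left h1).mp h2
  -- Through this, `(τ - τ̄)^j` supplies `√D^j` and the power of `N(𝔞𝔲𝔱)` that the norm twist in
  -- `χ_j` requires.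
  have hy : ∀ C, τ C - (starRingEnd ℂ) (τ C) = σ δ / (A C * t) := fun C => by
    have h := congrArg (embeddingIntegers σ) (hsub C)
    rw [map_sub, embeddingIntegers_apply, embeddingIntegers_apply, embeddingIntegers_apply,
      embedding_integersConj, hσβ, map_mul, map_mul, Complex.conj_natCast,
      Complex.conj_natCast] at h
    rw [← h]
    have := hAc C
    field_simp
  -- Multiplication by the class of `𝔲` permutes the class group, so the `𝔞𝔲` again represent all
  -- classes.
  have hIbij : Function.Bijective fun C => ClassGroup.mk0 (𝔦 C) := by
    simp only [hIdef, map_mul, h𝔞class]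
    exact Group.mulRight_bijective _
  have hinj : ∀ C (m n m' n' : ℤ), (m * β C + n * (A C : 𝓞 K) : 𝓞 K) = m' * β C + n' * (A C : 𝓞 K) →
      m = m' ∧ n = n' := fun C m n m' n' h => by
    have h1 := intCast_add_mul_injective (σ := σ) hδim (hβ C) (m := m) (n := n * A C) (m' := m')
      (n' := n' * A C) (by push_cast; exact h)
    exact ⟨h1.1, mul_right_cancel₀ (by exact_mod_cast hA0 C) h1.2⟩
  have hδ0 : σ (δ : K) ≠ 0 := fun h => by simp [h] at hδim
  have hψδ : ψ₁ (e𝔲 (Ideal.Quotient.mk 𝔲 (-δ))) ≠ 0 := by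
    have h1 : IsUnit (e𝔲 (Ideal.Quotient.mk 𝔲 (-δ))) := by
      rw [isUnit_ringEquiv_mk_iff, Ideal.span_singleton_neg]
      exact hδ𝔲
    exact (h1.map ψ₁).ne_zero
  have hχ𝔱 : χ.toHom (conjIdeal σ 𝔱) ≠ 0 :=
    χ.toHom_ne_zero (conjIdeal_ne_bot σ h𝔱0) (S.isCoprime_conductor hcop𝔱)
  choose F hFdiff hFsum hF0 using fun C =>
    exists_continuation_eisenstein (j := j) hk hψ₁ hψ₂ hparity hE2 (hτim C)
  refine ⟨_, HeckeCharacter.hasLValueAt_zero_of_lattices _ hIbij hA0 hImem hinj hunit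
    (fun C s => ?_) hFdiff hFsum (fun C v 𝔟 s hv h𝔟 =>
      S.toHom_mul_absNorm_cpow hψ₁ hψ₂ (hsub C) hδ𝔲 (hI0 C) ?_ ?_ (hnorm C) (hcopI C)
        (hσβ C) hv h𝔟 s), ?_⟩
  · simp [twistedSummand, heckeSummand_zero (show k ≠ 0 by omega)]
  · rw [hIcoe]; exact Ideal.mul_le_right
  · rw [← hJ]; exact hβJ C
  · rw [Finset.mul_sum]
    refine Finset.sum_congr rfl fun C _ => ?_
    have hχI : χ.toHom (conjIdeal σ (𝔦 C : Ideal (𝓞 K))) ≠ 0 :=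
      χ.toHom_ne_zero (conjIdeal_ne_bot σ (hI0 C)) (S.isCoprime_conductor (hcopI C))
    rw [hF0, hy, HeckeCharacter.normTwist, absNorm_conjIdeal, hJnorm, hJ, conjIdeal_mul, map_mul,
      zpow_natCast]
    exact eisensteinFactor_constants hk (hA0 C) hψ₂ hχ𝔱 hχI hψδ hδ0 _
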